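/- Let $l,h>0$, $\Omega=(0,\infty)\times(0,l)$ with points $(t,x)$, let $\eta_0\in H^1(0,l)$ with $\eta_0(0)=\eta_0(l)=h$ and $\eta_0\ge c>0$, and $v_0\in L^2(0,l)$. Fix a kernel $\zeta\in C_c^\infty([-1,1]^2)$, $\zeta\ge0$, $\int\zeta=1$; for a function $a$ on $\Omega$, extended by zero, let $a_\omega$ be its mollification with $\omega^{-2}\zeta(\cdot/\omega)$. Write $v^\pm=\max\{0,\pm v\}$. For a function $v$ defined a.e. on $\Omega$, $\operatorname{int}\{v\ge0\}:=\Omega\setminus\operatorname{supp}(v^-)$, with the essential support relative to $\Omega$. For continuous $\eta$, $\partial\{\eta=0\}$ is the boundary relative to $\Omega$ of $\{(t,x)\in\Omega:\eta(t,x)=0\}$. A weak solution is a triple $(\eta,F_{con},D_{con})$ with $\eta\in L^\infty(0,\infty;H^1(0,l))\cap W^{1,\infty}(0,\infty;L^2(0,l))$, $\partial_t\eta\in L^2(0,\infty;H^1(0,l))$ (we take the representative $\eta$ that is continuous on $[0,\infty)\times[0,l]$), and $F_{con},D_{con}$ non-negative, locally finite Borel measures on $[0,\infty)\times[0,l]$,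 such that: 1. $\eta\ge0$ in $\Omega$ and $\eta(t,0)=\eta(t,l)=h$ for all $t\ge0$; 2. $\operatorname{supp}D_{con}\subseteq\operatorname{supp}F_{con}\subseteq\partial\{\eta=0\}$, $\operatorname{supp}D_{con}\cap\operatorname{int}\{\partial_t\eta\ge0\}=\emptyset$, $|\operatorname{supp}D_{con}|=0$, and $\partial_t\eta=0$ a.e. on $\operatorname{supp}F_{con}$; 3. $F_{con}\,(-\partial_t\eta)_\omega\to D_{con}$ in $\mathcal D'(\Omega)$ as $\omega\to0^+$; 4. for all $\varphi\in C_c^\infty([0,\infty)\times(0,l))$, $$\int_\Omega\partial_t\eta\,\partial_t\varphi-\int_\Omega\partial_{tx}\eta\,\partial_x\varphi-\int_\Omega\partial_x\eta\,\partial_x\varphi=-\int_0^l v_0\varphi(0,\cdot)\,dx-\int\varphi\,dF_{con};$$ 5. for all $\varphi\in C_c^\infty([0,\infty)\times(0,l))$, $$-\tfrac12\int_\Omega(|\partial_t\eta|^2+|\partial_x\eta|^2)\partial_t\varphi+\int_\Omega|\partial_{tx}\eta|^2\varphi+\int\varphi\,dD_{con}+\int_\Omega(\partial_{tx}\eta+\partial_x\eta)\,\partial_t\eta\,\partial_x\varphi=\tfrac12\int_0^l(|v_0|^2+|\partial_x\eta_0|^2)\varphi(0,\cdot)\,dx;$$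 6. for all non-negative $\varphi\in C_c^\infty([0,\infty)\times(0,l))$ and all $b\in C^2([0,\infty))$ with $b(0)=b'(0)=0$, $b'(s)\le cs$ and $0\le b''(s)\le c$ for some constant $c$, with $v=\partial_t\eta$, $$\int_\Omega b(v^+)\partial_t\varphi-\int_\Omega\partial_{tx}\eta\,b'(v^+)\partial_x\varphi-\int_\Omega|\partial_xv^+|^2b''(v^+)\varphi-\int_\Omega\partial_x\eta\,b'(v^+)\partial_x\varphi-\int_\Omega\partial_x\eta\,\partial_x\big(b'(v^+)\big)\varphi\ \ge\ -\int_0^lb(v_0^+)\varphi(0,\cdot)\,dx .$$ **Theorem.** Let $(\eta,F_{con},D_{con})$ be a weak solution. (i) Let $a<b$ and let $f\in H^1(a,b)$ (continuous on $[a,b]$) have its graph $\Gamma=\{(t,f(t)):a\le t\le b\}$ contained in $\partial\{\eta=0\}$. Then $$F_{con}(\Gamma)=-\lim_{\delta\to0^+}\frac1\delta\Big[\int_a^b\!\int_{f(t)}^{f(t)+\delta}\!\partial_x\eta\,dx\,dt-\int_a^b\!\int_{f(t)-\delta}^{f(t)}\!\partial_x\eta\,dx\,dt+\int_a^b\!\int_{f(t)}^{f(t)+\delta}\!\partial_{tx}\eta\,dx\,dt-\int_a^b\!\int_{f(t)-\delta}^{f(t)}\!\partial_{tx}\eta\,dx\,dt\Big]$$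 (in particular the limit exists), and $F_{con}\big(\Gamma\cap\operatorname{int}\{\partial_t\eta\ge0\}\big)=0$. (ii) Let $x_0<x_1$ and $\{t_1\}\times(x_0,x_1)\subseteq\partial\{\eta=0\}$. Then there is a non-negative $f_{con}\in L^2(x_0,x_1)$ such that the restriction of $F_{con}$ to $\{t_1\}\times(x_0,x_1)$ is $\delta_{t_1}\otimes f_{con}\,dx$ and, for a.a. $x\in(x_0,x_1)$, $$f_{con}(x)=\lim_{\delta\to0^+}\frac1\delta\Big[\int_{t_1}^{t_1+\delta}\partial_t\eta(t,x)\,dt-\int_{t_1-\delta}^{t_1}\partial_t\eta(t,x)\,dt\Big].$$ Moreover $F_{con}\big((\{t_1\}\times(x_0,x_1))\cap\operatorname{int}\{\partial_t\eta\ge0\}\big)=0$. -/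

import Mathlib

open Set Filter Topology MeasureTheory
open scoped ContDiff NNReal ENNReal

namespace ViscoString

/-- `φ ∈ C_c^∞(U)`, extended by zero to the whole space. -/
def IsTestFunction {E : Type*} [NormedAddCommGroup E] [NormedSpace ℝ E]
    (U : Set E) (φ : E → ℝ) : Prop :=
  ContDiff ℝ ∞ φ ∧ HasCompactSupport φ ∧ tsupport φ ⊆ U

/-- `w` is the distributional derivative on the open set `U` of `u` in the direction `e`. -/
def HasWeakDeriv {E : Type*} [NormedAddCommGroup E] [NormedSpace ℝ E] [MeasureSpace E]
    (U : Set E) (e : E) (u w : E → ℝ) : Prop :=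
  LocallyIntegrableOn u U ∧ LocallyIntegrableOn w U ∧
    ∀ φ : E → ℝ, IsTestFunction U φ →
      ∫ p in U, u p * fderiv ℝ φ p e = -∫ p in U, w p * φ p

/-- `u ∈ H¹(a,b)` with weak derivative `u'`, where `u` is the representative that is continuous
on `[a,b]`. -/
structure IsSobolevH1 (a b : ℝ) (u u' : ℝ → ℝ) : Prop where
  continuousOn : ContinuousOn u (Icc a b)
  memLp : MemLp u 2 (volume.restrict (Ioo a b))
  memLp_deriv : MemLp u' 2 (volume.restrict (Ioo a b))
  hasWeakDeriv : HasWeakDeriv (Ioo a b) 1 u u'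

/-- The open space-time domain `(0,∞) × (0,l)`; points are `(t, x)`. -/
def domain (l : ℝ) : Set (ℝ × ℝ) := Ioi 0 ×ˢ Ioo 0 l

/-- The space-time domain `[0,∞) × [0,l]`. -/
def closedDomain (l : ℝ) : Set (ℝ × ℝ) := Ici 0 ×ˢ Icc 0 l

/-- `u ∈ L^∞(0,∞; L²(0,l))`. -/
def MemLinftyL2 (l : ℝ) (u : ℝ × ℝ → ℝ) : Prop :=
  AEStronglyMeasurable u (volume.restrict (domain l)) ∧
    ∃ C : ℝ≥0, ∀ᵐ t ∂(volume.restrict (Ioi (0 : ℝ))),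
      eLpNorm (fun x => u (t, x)) 2 (volume.restrict (Ioo 0 l)) ≤ C

/-- Restrictions to `t ≥ 0` of these functions are exactly the functions in
`C_c^∞([0,∞) × (0,l))`. -/
def IsTestFunctionUpToZero (l : ℝ) (φ : ℝ × ℝ → ℝ) : Prop :=
  IsTestFunction (univ ×ˢ Ioo 0 l) φ

/-- `∂_t φ` for a smooth `φ`. -/
noncomputable def dt (φ : ℝ × ℝ → ℝ) (p : ℝ × ℝ) : ℝ := fderiv ℝ φ p (1, 0)

/-- `∂_x φ` for a smooth `φ`. -/
noncomputable def dx (φ : ℝ × ℝ → ℝ) (p : ℝ × ℝ) : ℝ := fderiv ℝ φ p (0, 1)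

/-- The essential support, relative to the open set `U`, of `u : U → ℝ`. -/
def essSupport (U : Set (ℝ × ℝ)) (u : ℝ × ℝ → ℝ) : Set (ℝ × ℝ) :=
  U \ ⋃₀ {O | IsOpen O ∧ O ⊆ U ∧ ∀ᵐ p ∂(volume.restrict O), u p = 0}

/-- `int{v ≥ 0}`, for an almost everywhere defined `v` on `(0,∞) × (0,l)`: the complement in the
domain of the essential support of the negative part of `v`. -/
def intNonneg (l : ℝ) (v : ℝ × ℝ → ℝ) : Set (ℝ × ℝ) :=
  domain l \ essSupport (domain l) (fun p => max 0 (-v p))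

/-- `∂{η = 0}`: the boundary, relative to the open domain `(0,∞) × (0,l)`, of the contact set. -/
def contactBoundary (l : ℝ) (η : ℝ × ℝ → ℝ) : Set (ℝ × ℝ) :=
  frontier {p | p ∈ domain l ∧ η p = 0} ∩ domain l

/-- A mollification kernel: `ζ ∈ C_c^∞([-1,1]²)`, `ζ ≥ 0`, `∫ ζ = 1`. -/
structure IsMollifier (ζ : ℝ × ℝ → ℝ) : Prop where
  smooth : ContDiff ℝ ∞ ζ
  tsupport_subset : tsupport ζ ⊆ Icc (-1) 1 ×ˢ Icc (-1) 1
  nonneg : ∀ p, 0 ≤ ζ p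
  integral_eq_one : ∫ p, ζ p = 1

/-- The time-space mollification at scale `r` of `a`, extended by zero outside
`(0,∞) × (0,l)`. -/
noncomputable def mollify (l : ℝ) (ζ : ℝ × ℝ → ℝ) (r : ℝ) (a : ℝ × ℝ → ℝ) (p : ℝ × ℝ) : ℝ :=
  ∫ q in domain l, 1 / r ^ 2 * ζ ((p.1 - q.1) / r, (p.2 - q.2) / r) * a q

/-- Global weak solutions `(η, F, D)` of the viscoelastic string with obstacle, with string length
`l`, boundary height `h`, initial displacement `η₀` (with weak derivative `η₀x`) and initial
velocity `v₀`. The functions `ηt`, `ηx`, `ηtx` are representatives of the weak derivatives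
`∂_t η`, `∂_x η`, `∂_{tx} η`, while `η` itself is the representative that is continuous on
`[0,∞) × [0,l]`; `F` and `D` are the contact force and the contact dissipation, as Borel measures
on the plane that are carried by `[0,∞) × [0,l]`. -/
structure IsWeakSolution (l h : ℝ) (ζ : ℝ × ℝ → ℝ) (η₀ η₀x v₀ : ℝ → ℝ)
    (η ηt ηx ηtx : ℝ × ℝ → ℝ) (F D : Measure (ℝ × ℝ)) : Prop where
  -- initial data
  initial_displacement : IsSobolevH1 0 l η₀ η₀x
  initial_boundary : η₀ 0 = h ∧ η₀ l = h
  initial_pos : ∃ c > 0, ∀ x ∈ Icc 0 l, c ≤ η₀ x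
  initial_velocity : MemLp v₀ 2 (volume.restrict (Ioo 0 l))
  -- regularity of the displacement
  continuousOn : ContinuousOn η (closedDomain l)
  weakDeriv_t : HasWeakDeriv (domain l) (1, 0) η ηt
  weakDeriv_x : HasWeakDeriv (domain l) (0, 1) η ηx
  weakDeriv_tx : HasWeakDeriv (domain l) (0, 1) ηt ηtx
  bound : MemLinftyL2 l η
  bound_x : MemLinftyL2 l ηx
  bound_t : MemLinftyL2 l ηt
  memLp_t : MemLp ηt 2 (volume.restrict (domain l))
  memLp_tx : MemLp ηtx 2 (volume.restrict (domain l))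
  -- contact force and contact dissipation are Radon measures on `[0,∞) × [0,l]`
  force_locallyFinite : IsLocallyFiniteMeasure F
  force_carried : F (closedDomain l)ᶜ = 0
  dissipation_locallyFinite : IsLocallyFiniteMeasure D
  dissipation_carried : D (closedDomain l)ᶜ = 0
  -- non-penetration and boundary conditions
  nonneg : ∀ p ∈ domain l, 0 ≤ η p
  boundary : ∀ t, 0 ≤ t → η (t, 0) = h ∧ η (t, l) = h
  -- supports
  support_dissipation_subset : D.support ⊆ F.support
  support_force_subset : F.support ⊆ contactBoundary l η
  support_dissipation_disjoint : D.support ∩ intNonneg l ηt = ∅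
  support_dissipation_null : volume D.support = 0
  velocity_zero : ∀ᵐ p ∂(volume.restrict F.support), ηt p = 0
  -- `F (-∂_t η)_r → D` as `r → 0+` in the sense of distributions
  dissipation_limit : ∀ φ : ℝ × ℝ → ℝ, IsTestFunction (domain l) φ →
    Tendsto (fun r : ℝ => ∫ p, mollify l ζ r (fun q => -ηt q) p * φ p ∂F)
      (𝓝[>] 0) (𝓝 (∫ p, φ p ∂D))
  -- momentum equation
  momentum : ∀ φ : ℝ × ℝ → ℝ, IsTestFunctionUpToZero l φ →
    (∫ p in domain l, ηt p * dt φ p) - (∫ p in domain l, ηtx p * dx φ p)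
        - (∫ p in domain l, ηx p * dx φ p)
      = -(∫ x in Ioo 0 l, v₀ x * φ (0, x)) - ∫ p, φ p ∂F
  -- local energy balance
  energy : ∀ φ : ℝ × ℝ → ℝ, IsTestFunctionUpToZero l φ →
    -(1 / 2) * (∫ p in domain l, ηt p ^ 2 * dt φ p)
        - 1 / 2 * (∫ p in domain l, ηx p ^ 2 * dt φ p)
        + (∫ p in domain l, ηtx p ^ 2 * φ p)
        + (∫ p, φ p ∂D)
        + (∫ p in domain l, ηtx p * ηt p * dx φ p)
        + (∫ p in domain l, ηx p * ηt p * dx φ p)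
      = 1 / 2 * (∫ x in Ioo 0 l, v₀ x ^ 2 * φ (0, x))
        + 1 / 2 * (∫ x in Ioo 0 l, η₀x x ^ 2 * φ (0, x))
  -- renormalized momentum inequality for `v⁺ = max 0 ηt`; `b ∈ C²([0,∞))` has derivatives `b₁`,
  -- `b₂`, and `∂_x v⁺` is `ηtx` on `{ηt > 0}` and `0` elsewhere
  renormalized : ∀ b b₁ b₂ : ℝ → ℝ, ∀ c : ℝ,
    (∀ s, 0 ≤ s → HasDerivWithinAt b (b₁ s) (Ici 0) s) →
    (∀ s, 0 ≤ s → HasDerivWithinAt b₁ (b₂ s) (Ici 0) s) →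
    ContinuousOn b₂ (Ici 0) → b 0 = 0 → b₁ 0 = 0 →
    (∀ s, 0 ≤ s → b₁ s ≤ c * s) → (∀ s, 0 ≤ s → 0 ≤ b₂ s ∧ b₂ s ≤ c) →
    ∀ φ : ℝ × ℝ → ℝ, IsTestFunctionUpToZero l φ → (∀ p, 0 ≤ φ p) →
    (∫ p in domain l, b (max 0 (ηt p)) * dt φ p)
        - (∫ p in domain l, ηtx p * b₁ (max 0 (ηt p)) * dx φ p)
        - (∫ p in domain l, ({q | 0 < ηt q}.indicator ηtx p) ^ 2 * b₂ (max 0 (ηt p)) * φ p)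
        - (∫ p in domain l, ηx p * b₁ (max 0 (ηt p)) * dx φ p)
        - (∫ p in domain l,
            ηx p * (b₂ (max 0 (ηt p)) * {q | 0 < ηt q}.indicator ηtx p) * φ p)
      ≥ -∫ x in Ioo 0 l, b (max 0 (v₀ x)) * φ (0, x)

end ViscoString

open Set Filter Topology MeasureTheory
open scoped ContDiff NNReal ENNReal

namespace ViscoString

/-! ### Smooth approximations of steps, ramps and tents -/

/-! Everything follows from testing the momentum equation with tents of half-width `δ` around the
contact set and letting `δ → 0`.

Part (i), formula. Take `φ = χ(t) T(x - f(t))`, with `χ` the indicator of `[a,b]` and `T` a tent of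
height 1. On the force side `φ` shrinks to the indicator of the graph, so the limit is the mass of
the graph. In the stress term `T` contributes its slopes `±1/δ`, which gives the difference of strip
averages. It remains to see that `∫ ηt ∂ₜφ` vanishes. The part with `χ'` is `O(√δ)`, since `ηt` is
in `L^∞ L²` and the tent lives on a band of width `2δ`. The part `-f'(t) ∂ₓφ` looks of order `1/δ`,
but `f'` does not depend on `x`, and integration by parts in `x` turns it into `∫ ηtx f' φ`, again
`O(√δ)` because `ηtx` and `f'` are in `L²`. Admissible tests are smooth, so window, tent and curve
are first replaced by smooth ones with uniform bounds. The chain is `force_eq_of_smooth_curve`,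
`exists_force_estimate`, `exists_tent_estimate`, `force_curve_tendsto`.

Part (i), no force. Where the velocity is non-negative, `η` increases in time, so `0 ≤ η(s, f(t)) ≤
η(t, f(t)) = 0` for `s ≤ t`: contact propagates backwards in time. The strips are approximated by
rectangles whose space interval is read off at the final time. On these, integrals of `ηx` and `ηtx`
are differences of `η` with a definite sign, so the bracket is non-negative and the force on the
graph is at most 0 (`setIntegral_strip_nonneg`, `force_curve_eq_zero`).

Part (ii), density. The weight `T(t - t₁) θ(x)` shows that the velocity jump `J_δ` (mean velocity
after minus mean velocity before `t₁`) converges weakly to the slice of the force. As `J_δ` is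
bounded in `L²`, the slice is absolutely continuous (`sliceForce_absolutelyContinuous`), and once
pointwise convergence is known, Fatou puts its density in `L²`. Pointwise convergence uses parabolic
boxes, `δ` in time by `√δ` in space. Around almost every point the box has `o(δ)` mass of any `L²`
function and `o(√δ)` mass of the force off the line. Hence `J_δ` oscillates by `o(1)` over the box,
and averaging it against a bump of width `√δ` gives the force density at Lebesgue points
(`ae_tendsto_velocityJump`).

Part (ii), no force. Before `t₁` the string already rests on the obstacle, by the monotonicity
above, so its kinetic energy there is zero. The renormalized inequality with `b(s) = s²/2` forbids a
jump of the energy of the positive velocity across `t₁`. So the mean velocity after `t₁` tends to 0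
and the slice of the force vanishes (`exists_kinetic_energy_lower_bound`,
`integral_sliceForce_eq_zero`). -/

/-- A smooth monotone approximation of the indicator function of `(0,∞)`. -/
noncomputable def stepApprox (n : ℕ) (y : ℝ) : ℝ := Real.smoothTransition ((n + 1) * y)

lemma stepApprox_contDiff (n : ℕ) : ContDiff ℝ ∞ (stepApprox n) :=
  Real.smoothTransition.contDiff.comp (contDiff_const.mul contDiff_id)

lemma stepApprox_nonneg (n : ℕ) (y : ℝ) : 0 ≤ stepApprox n y := Real.smoothTransition.nonneg _

lemma stepApprox_le_one (n : ℕ) (y : ℝ) : stepApprox n y ≤ 1 := Real.smoothTransition.le_one _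

lemma stepApprox_of_nonpos (n : ℕ) {y : ℝ} (hy : y ≤ 0) : stepApprox n y = 0 :=
  Real.smoothTransition.zero_of_nonpos (mul_nonpos_of_nonneg_of_nonpos (by positivity) hy)

lemma stepApprox_of_le (n : ℕ) {y : ℝ} (hy : 1 / ((n : ℝ) + 1) ≤ y) : stepApprox n y = 1 := by
  refine Real.smoothTransition.one_of_one_le ?_
  rw [div_le_iff₀ (by positivity)] at hy
  linarith

lemma stepApprox_monotone (n : ℕ) : Monotone (stepApprox n) := fun _ _ h =>
  Real.smoothTransition.monotone (mul_le_mul_of_nonneg_left h (by positivity))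

lemma stepApprox_hasDerivAt (n : ℕ) (y : ℝ) :
    HasDerivAt (stepApprox n) (deriv (stepApprox n) y) y :=
  ((stepApprox_contDiff n).differentiable (by simp) y).hasDerivAt

lemma deriv_stepApprox_continuous (n : ℕ) : Continuous (deriv (stepApprox n)) :=
  (stepApprox_contDiff n).continuous_deriv (by simp)

lemma deriv_stepApprox_nonneg (n : ℕ) (y : ℝ) : 0 ≤ deriv (stepApprox n) y :=
  (stepApprox_monotone n).deriv_nonneg

lemma deriv_stepApprox_of_neg (n : ℕ) {y : ℝ} (hy : y < 0) : deriv (stepApprox n) y = 0 := by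
  have : stepApprox n =ᶠ[𝓝 y] fun _ => 0 := by
    filter_upwards [Iio_mem_nhds hy] with z hz using stepApprox_of_nonpos n (le_of_lt hz)
  rw [this.deriv_eq]; simp

lemma deriv_stepApprox_of_gt (n : ℕ) {y : ℝ} (hy : 1 / ((n : ℝ) + 1) < y) :
    deriv (stepApprox n) y = 0 := by
  have : stepApprox n =ᶠ[𝓝 y] fun _ => 1 := by
    filter_upwards [Ioi_mem_nhds hy] with z hz using stepApprox_of_le n (le_of_lt hz)
  rw [this.deriv_eq]; simp

lemma integral_deriv_stepApprox (n : ℕ) (p q : ℝ) :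
    ∫ y in p..q, deriv (stepApprox n) y = stepApprox n q - stepApprox n p :=
  intervalIntegral.integral_deriv_eq_sub
    (fun y _ => (stepApprox_contDiff n).differentiable (by simp) y)
    ((deriv_stepApprox_continuous n).intervalIntegrable _ _)

lemma tendsto_one_div_succ : Tendsto (fun n : ℕ => 1 / ((n : ℝ) + 1)) atTop (𝓝 0) :=
  tendsto_one_div_add_atTop_nhds_zero_nat

/-- The transition layer `[0, 1/(n+1)]` shrinks to the jump, so away from 0 the argument may move
with `n`. This freedom is needed when the curve itself is being approximated. -/
lemma stepApprox_tendsto_of_ne {y : ℝ} (hy : y ≠ 0) {u : ℕ → ℝ} (hu : Tendsto u atTop (𝓝 y)) :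
    Tendsto (fun n => stepApprox n (u n)) atTop (𝓝 ((Ioi (0 : ℝ)).indicator 1 y)) := by
  rcases lt_or_gt_of_ne hy with h | h
  · rw [indicator_of_notMem (by simpa using h.le)]
    refine tendsto_const_nhds.congr' ?_
    filter_upwards [hu.eventually (Iio_mem_nhds h)] with n hn
    exact (stepApprox_of_nonpos n (le_of_lt hn)).symm
  · rw [indicator_of_mem (by simpa using h)]
    refine tendsto_const_nhds.congr' ?_
    filter_upwards [hu.eventually (Ioi_mem_nhds (half_lt_self h)),
      tendsto_one_div_succ.eventually (Iio_mem_nhds (half_pos h))] with n hn hn'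
    have h1 : y / 2 < u n := hn
    have h2 : 1 / ((n : ℝ) + 1) < y / 2 := hn'
    exact (stepApprox_of_le n (by linarith)).symm

/-- For a fixed argument the jump is harmless: every approximation vanishes at 0, as does the
indicator of the open half-line. -/
lemma stepApprox_tendsto (y : ℝ) :
    Tendsto (fun n => stepApprox n y) atTop (𝓝 ((Ioi (0 : ℝ)).indicator 1 y)) := by
  rcases eq_or_ne y 0 with rfl | h
  · simp only [stepApprox_of_nonpos _ le_rfl, mem_Ioi, lt_irrefl, not_false_eq_true,
      indicator_of_notMem]
    exact tendsto_const_nhds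
  · exact stepApprox_tendsto_of_ne h tendsto_const_nhds

/-- A smooth approximation of the positive part. -/
noncomputable def rampApprox (n : ℕ) (y : ℝ) : ℝ := ∫ z in (0 : ℝ)..y, stepApprox n z

lemma rampApprox_hasDerivAt (n : ℕ) (y : ℝ) :
    HasDerivAt (rampApprox n) (stepApprox n y) y :=
  ((stepApprox_contDiff n).continuous).integral_hasStrictDerivAt 0 y |>.hasDerivAt

lemma rampApprox_contDiff (n : ℕ) : ContDiff ℝ ∞ (rampApprox n) := by
  rw [contDiff_infty_iff_deriv]
  refine ⟨fun y => (rampApprox_hasDerivAt n y).differentiableAt, ?_⟩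
  rw [show deriv (rampApprox n) = stepApprox n from funext fun y => (rampApprox_hasDerivAt n y).deriv]
  exact stepApprox_contDiff n

lemma rampApprox_sub (n : ℕ) (p q : ℝ) :
    rampApprox n q - rampApprox n p = ∫ z in p..q, stepApprox n z :=
  intervalIntegral.integral_interval_sub_left
    ((stepApprox_contDiff n).continuous.intervalIntegrable _ _)
    ((stepApprox_contDiff n).continuous.intervalIntegrable _ _)

lemma rampApprox_of_nonpos (n : ℕ) {y : ℝ} (hy : y ≤ 0) : rampApprox n y = 0 := by
  rw [rampApprox, intervalIntegral.integral_symm, intervalIntegral.integral_congr (g := fun _ => 0)]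
  · simp
  · intro z hz
    rw [uIcc_of_le hy] at hz
    exact stepApprox_of_nonpos n hz.2

/-- Past the layer the ramp is affine of slope one. The constant left implicit here cancels in the
second differences that define tents, so smoothed tents have compact support. -/
lemma rampApprox_of_le (n : ℕ) {y : ℝ} (hy : 1 / ((n : ℝ) + 1) ≤ y) :
    rampApprox n y = rampApprox n (1 / ((n : ℝ) + 1)) + (y - 1 / ((n : ℝ) + 1)) := by
  have h := rampApprox_sub n (1 / ((n : ℝ) + 1)) y
  rw [intervalIntegral.integral_congr (g := fun _ => 1)] at h
  · simp only [intervalIntegral.integral_const, smul_eq_mul, mul_one] at h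
    linarith
  · intro z hz
    rw [uIcc_of_le hy] at hz
    exact stepApprox_of_le n hz.1

lemma rampApprox_sub_nonneg (n : ℕ) {p q : ℝ} (h : p ≤ q) : 0 ≤ rampApprox n q - rampApprox n p := by
  rw [rampApprox_sub]
  exact intervalIntegral.integral_nonneg h fun z _ => stepApprox_nonneg n z

lemma rampApprox_sub_le (n : ℕ) {p q : ℝ} (h : p ≤ q) :
    rampApprox n q - rampApprox n p ≤ q - p := by
  rw [rampApprox_sub]
  calc _ ≤ ∫ z in p..q, (1 : ℝ) := intervalIntegral.integral_mono_on h
        ((stepApprox_contDiff n).continuous.intervalIntegrable _ _) (by simp)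
        fun z _ => stepApprox_le_one n z
    _ = q - p := by simp

/-- Convexity of the ramp: its derivative `stepApprox n` is monotone. -/
lemma rampApprox_second_diff_nonneg (n : ℕ) {y δ : ℝ} (hδ : 0 ≤ δ) :
    0 ≤ rampApprox n (y + δ) - 2 * rampApprox n y + rampApprox n (y - δ) := by
  have h1 := rampApprox_sub n y (y + δ)
  have h2 := rampApprox_sub n (y - δ) y
  have h3 : ∫ z in (y - δ)..y, stepApprox n z ≤ ∫ z in y..(y + δ), stepApprox n z := by
    have : ∫ z in y..(y + δ), stepApprox n z = ∫ z in (y - δ)..y, stepApprox n (z + δ) := by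
      rw [intervalIntegral.integral_comp_add_right]; simp
    rw [this]
    refine intervalIntegral.integral_mono_on (by linarith)
      ((stepApprox_contDiff n).continuous.intervalIntegrable _ _)
      (((stepApprox_contDiff n).continuous.comp (by fun_prop)).intervalIntegrable _ _) fun z _ =>
        stepApprox_monotone n (by linarith)
  linarith

lemma abs_rampApprox_sub_max_le (n : ℕ) (y : ℝ) :
    |rampApprox n y - max 0 y| ≤ 1 / ((n : ℝ) + 1) := by
  have hN : 0 < 1 / ((n : ℝ) + 1) := by positivity
  have h0 : rampApprox n 0 = 0 := by simp [rampApprox]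
  rcases le_total y 0 with h | h
  · rw [rampApprox_of_nonpos n h, max_eq_left h]; simpa using hN.le
  · rw [max_eq_right h]
    rcases le_total y (1 / ((n : ℝ) + 1)) with h' | h'
    · have h1 := rampApprox_sub_nonneg n h
      have h2 := rampApprox_sub_le n h
      rw [abs_le]; constructor <;> linarith
    · rw [rampApprox_of_le n h']
      have h1 := rampApprox_sub_nonneg n hN.le
      have h2 := rampApprox_sub_le n hN.le
      rw [abs_le]; constructor <;> linarith

/-- The tent function of half-width `δ` and height `1`, centred at the origin. -/
noncomputable def tent (δ y : ℝ) : ℝ := (max 0 (y + δ) - 2 * max 0 y + max 0 (y - δ)) / δ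

/-- The derivative of `tent δ` away from its corners. -/
noncomputable def tentDeriv (δ y : ℝ) : ℝ :=
  ((Ioi (0 : ℝ)).indicator 1 (y + δ) - 2 * (Ioi (0 : ℝ)).indicator 1 y
    + (Ioi (0 : ℝ)).indicator 1 (y - δ)) / δ

/-- A smooth approximation of `tent δ`. -/
noncomputable def tentApprox (n : ℕ) (δ y : ℝ) : ℝ :=
  (rampApprox n (y + δ) - 2 * rampApprox n y + rampApprox n (y - δ)) / δ

/-- The derivative of `tentApprox n δ`. -/
noncomputable def tentApproxDeriv (n : ℕ) (δ y : ℝ) : ℝ :=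
  (stepApprox n (y + δ) - 2 * stepApprox n y + stepApprox n (y - δ)) / δ

lemma tentApprox_contDiff (n : ℕ) (δ : ℝ) : ContDiff ℝ ∞ (tentApprox n δ) := by
  have h := rampApprox_contDiff n
  exact (((h.comp (contDiff_id.add contDiff_const)).sub (contDiff_const.mul h)).add
    (h.comp (contDiff_id.sub contDiff_const))).div_const δ

lemma tentApprox_hasDerivAt (n : ℕ) (δ y : ℝ) :
    HasDerivAt (tentApprox n δ) (tentApproxDeriv n δ y) y := by
  have h1 := (rampApprox_hasDerivAt n (y + δ)).comp_add_const y δ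
  have h2 := (rampApprox_hasDerivAt n y).const_mul 2
  have h3 := (rampApprox_hasDerivAt n (y - δ)).comp_sub_const y δ
  exact ((h1.sub h2).add h3).div_const δ

lemma tentApproxDeriv_continuous (n : ℕ) (δ : ℝ) : Continuous (tentApproxDeriv n δ) := by
  have h := (stepApprox_contDiff n).continuous
  unfold tentApproxDeriv
  fun_prop

variable {δ : ℝ}

lemma tentApprox_nonneg (n : ℕ) (hδ : 0 < δ) (y : ℝ) : 0 ≤ tentApprox n δ y :=
  div_nonneg (rampApprox_second_diff_nonneg n hδ.le) hδ.le

lemma tentApprox_le_one (n : ℕ) (hδ : 0 < δ) (y : ℝ) : tentApprox n δ y ≤ 1 := by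
  have h1 := rampApprox_sub_le n (show y ≤ y + δ by linarith)
  have h2 := rampApprox_sub_nonneg n (show y - δ ≤ y by linarith)
  rw [tentApprox, div_le_one hδ]
  linarith

lemma tentApprox_of_lt (n : ℕ) (hδ : 0 < δ) {y : ℝ} (hy : y ≤ -δ) : tentApprox n δ y = 0 := by
  rw [tentApprox, rampApprox_of_nonpos n (by linarith), rampApprox_of_nonpos n (by linarith),
    rampApprox_of_nonpos n (by linarith)]
  simp

lemma tentApprox_of_gt (n : ℕ) (hδ : 0 < δ) {y : ℝ} (hy : δ + 1 / ((n : ℝ) + 1) ≤ y) :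
    tentApprox n δ y = 0 := by
  rw [tentApprox, rampApprox_of_le n (y := y + δ) (by linarith),
    rampApprox_of_le n (y := y) (by linarith), rampApprox_of_le n (y := y - δ) (by linarith)]
  ring_nf

lemma abs_tentApproxDeriv_le (n : ℕ) (hδ : 0 < δ) (y : ℝ) : |tentApproxDeriv n δ y| ≤ 2 / δ := by
  have h1 := stepApprox_nonneg n (y + δ)
  have h2 := stepApprox_nonneg n y
  have h3 := stepApprox_nonneg n (y - δ)
  have h4 := stepApprox_le_one n (y + δ)
  have h5 := stepApprox_le_one n y
  have h6 := stepApprox_le_one n (y - δ)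
  rw [tentApproxDeriv, abs_div, abs_of_pos hδ]
  gcongr
  rw [abs_le]; constructor <;> linarith

lemma tentApproxDeriv_of_lt (n : ℕ) (hδ : 0 < δ) {y : ℝ} (hy : y ≤ -δ) :
    tentApproxDeriv n δ y = 0 := by
  rw [tentApproxDeriv, stepApprox_of_nonpos n (by linarith), stepApprox_of_nonpos n (by linarith),
    stepApprox_of_nonpos n (by linarith)]
  simp

lemma tentApproxDeriv_of_gt (n : ℕ) (hδ : 0 < δ) {y : ℝ} (hy : δ + 1 / ((n : ℝ) + 1) ≤ y) :
    tentApproxDeriv n δ y = 0 := by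
  rw [tentApproxDeriv, stepApprox_of_le n (y := y + δ) (by linarith),
    stepApprox_of_le n (y := y) (by linarith), stepApprox_of_le n (y := y - δ) (by linarith)]
  norm_num

lemma tent_nonneg (hδ : 0 < δ) (y : ℝ) : 0 ≤ tent δ y := by
  refine div_nonneg ?_ hδ.le
  rcases max_cases 0 (y + δ) with h1 | h1 <;> rcases max_cases 0 y with h2 | h2 <;>
    rcases max_cases 0 (y - δ) with h3 | h3 <;> linarith [h1.1, h1.2, h2.1, h2.2, h3.1, h3.2]

lemma tent_le_one (hδ : 0 < δ) (y : ℝ) : tent δ y ≤ 1 := by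
  rw [tent, div_le_one hδ]
  rcases max_cases 0 (y + δ) with h1 | h1 <;> rcases max_cases 0 y with h2 | h2 <;>
    rcases max_cases 0 (y - δ) with h3 | h3 <;> linarith [h1.1, h1.2, h2.1, h2.2, h3.1, h3.2]

lemma tent_zero (hδ : 0 < δ) : tent δ 0 = 1 := by
  rw [tent, zero_add, max_eq_right hδ.le, max_self, max_eq_left (by linarith)]
  field_simp; ring

lemma tent_of_le_abs (hδ : 0 < δ) {y : ℝ} (hy : δ ≤ |y|) : tent δ y = 0 := by
  rw [tent, div_eq_zero_iff]
  left
  rcases le_abs.1 hy with h | h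
  · rw [max_eq_right (by linarith), max_eq_right (by linarith), max_eq_right (by linarith)]; ring
  · rw [max_eq_left (by linarith), max_eq_left (by linarith), max_eq_left (by linarith)]; ring

lemma tent_continuous (δ : ℝ) : Continuous (tent δ) := by
  unfold tent
  fun_prop

/-- The ramps converge uniformly, so in contrast to the derivatives there are no exceptional points
even for a moving argument. This matters because `F` may charge the corners. -/
lemma tentApprox_tendsto {y : ℝ} {u : ℕ → ℝ} (hu : Tendsto u atTop (𝓝 y)) :
    Tendsto (fun n => tentApprox n δ (u n)) atTop (𝓝 (tent δ y)) := by
  have key : ∀ {z : ℝ} {v : ℕ → ℝ}, Tendsto v atTop (𝓝 z) →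
      Tendsto (fun n => rampApprox n (v n)) atTop (𝓝 (max 0 z)) := by
    intro z v hv
    have h1 : Tendsto (fun n => max 0 (v n)) atTop (𝓝 (max 0 z)) := tendsto_const_nhds.max hv
    have h2 : Tendsto (fun n => rampApprox n (v n) - max 0 (v n)) atTop (𝓝 0) :=
      squeeze_zero_norm (fun n => abs_rampApprox_sub_max_le n (v n)) tendsto_one_div_succ
    simpa using h2.add h1
  exact (((key (hu.add_const δ)).sub ((key hu).const_mul 2)).add
    (key (hu.sub_const δ))).div_const δ

lemma tentApproxDeriv_tendsto_of_ne {y : ℝ} {u : ℕ → ℝ} (h0 : y ≠ 0) (h1 : y ≠ δ) (h2 : y ≠ -δ)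
    (hu : Tendsto u atTop (𝓝 y)) :
    Tendsto (fun n => tentApproxDeriv n δ (u n)) atTop (𝓝 (tentDeriv δ y)) :=
  (((stepApprox_tendsto_of_ne (fun h => h2 (by linarith)) (hu.add_const δ)).sub
    ((stepApprox_tendsto_of_ne h0 hu).const_mul 2)).add
    (stepApprox_tendsto_of_ne (fun h => h1 (by linarith)) (hu.sub_const δ))).div_const δ

lemma tentApproxDeriv_tendsto (δ y : ℝ) :
    Tendsto (fun n => tentApproxDeriv n δ y) atTop (𝓝 (tentDeriv δ y)) :=
  (((stepApprox_tendsto (y + δ)).sub ((stepApprox_tendsto y).const_mul 2)).add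
    (stepApprox_tendsto (y - δ))).div_const δ

/-- A smooth approximation of the indicator function of an interval from outside. -/
noncomputable def windowApprox (n : ℕ) (a b t : ℝ) : ℝ :=
  stepApprox n (t - (a - 1 / ((n : ℝ) + 1))) - stepApprox n (t - b)

lemma windowApprox_contDiff (n : ℕ) (a b : ℝ) : ContDiff ℝ ∞ (windowApprox n a b) :=
  ((stepApprox_contDiff n).comp (contDiff_id.sub contDiff_const)).sub
    ((stepApprox_contDiff n).comp (contDiff_id.sub contDiff_const))

lemma windowApprox_hasDerivAt (n : ℕ) (a b t : ℝ) :
    HasDerivAt (windowApprox n a b) (deriv (stepApprox n) (t - (a - 1 / ((n : ℝ) + 1)))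
      - deriv (stepApprox n) (t - b)) t :=
  ((stepApprox_hasDerivAt n _).comp_sub_const t _).sub
    ((stepApprox_hasDerivAt n _).comp_sub_const t _)

variable {a b : ℝ}

lemma windowApprox_mem (n : ℕ) (hab : a ≤ b) (t : ℝ) : windowApprox n a b t ∈ Icc (0 : ℝ) 1 := by
  have hN : 0 < 1 / ((n : ℝ) + 1) := by positivity
  have h1 := stepApprox_monotone n (show t - b ≤ t - (a - 1 / ((n : ℝ) + 1)) by linarith)
  have h2 := stepApprox_nonneg n (t - b)
  have h3 := stepApprox_le_one n (t - (a - 1 / ((n : ℝ) + 1)))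
  rw [windowApprox]
  constructor <;> linarith

lemma windowApprox_eq_zero (n : ℕ) (hab : a ≤ b) {t : ℝ}
    (ht : t ∉ Icc (a - 1 / ((n : ℝ) + 1)) (b + 1 / ((n : ℝ) + 1))) : windowApprox n a b t = 0 := by
  have hN : 0 < 1 / ((n : ℝ) + 1) := by positivity
  rw [windowApprox]
  rcases lt_or_ge t (a - 1 / ((n : ℝ) + 1)) with h | h
  · rw [stepApprox_of_nonpos n (by linarith), stepApprox_of_nonpos n (by linarith), sub_zero]
  · have : b + 1 / ((n : ℝ) + 1) < t := by
      by_contra h'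
      exact ht ⟨h, by linarith⟩
    rw [stepApprox_of_le n (by linarith), stepApprox_of_le n (by linarith), sub_self]

/-- The left step is shifted by a full layer so that it already equals 1 at `a`, while the right
step still vanishes at `b`. Convergence at the endpoints is needed because `F` may charge the lines
`t = a` and `t = b`. -/
lemma windowApprox_tendsto (hab : a ≤ b) (t : ℝ) :
    Tendsto (fun n => windowApprox n a b t) atTop (𝓝 ((Icc a b).indicator 1 t)) := by
  have h1 : Tendsto (fun n => stepApprox n (t - (a - 1 / ((n : ℝ) + 1)))) atTop
      (𝓝 ((Ici a).indicator 1 t)) := by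
    rcases lt_or_ge t a with h | h
    · have hs : Tendsto (fun n : ℕ => t - (a - 1 / ((n : ℝ) + 1))) atTop (𝓝 (t - a)) := by
        simpa using tendsto_one_div_succ.const_sub a |>.const_sub t
      have := stepApprox_tendsto_of_ne (sub_ne_zero.2 h.ne) hs
      rw [indicator_of_notMem (by simpa using h)]
      rwa [indicator_of_notMem (by simpa using h.le)] at this
    · rw [indicator_of_mem (by simpa using h)]
      refine tendsto_const_nhds.congr fun n => ?_
      exact (stepApprox_of_le n (by linarith)).symm
  have h2 := stepApprox_tendsto (t - b)
  have h3 : (Icc a b).indicator (1 : ℝ → ℝ) t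
      = (Ici a).indicator 1 t - (Ioi (0 : ℝ)).indicator 1 (t - b) := by
    simp only [indicator_apply, mem_Icc, mem_Ici, mem_Ioi, Pi.one_apply]
    split_ifs <;> first | (exfalso; grind) | norm_num
  rw [h3]
  exact h1.sub h2

end ViscoString

namespace ViscoString

/-! ### Integrals against bounded compactly supported weights -/

section Weights

variable {E : Type*} [MeasurableSpace E] {μ : Measure E} {U K : Set E} {u c : E → ℝ} {M : ℝ}

lemma integrable_mul_of_bounded (hK : MeasurableSet K) (hu : IntegrableOn u K μ)
    (hc : Measurable c) (hM : ∀ p, |c p| ≤ M) (h0 : ∀ p, p ∉ K → c p = 0) :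
    Integrable (fun p => u p * c p) μ := by
  have h1 : (fun p => u p * c p) = fun p => K.indicator u p * c p := by
    ext p
    by_cases hp : p ∈ K
    · simp [hp]
    · simp [hp, h0 p hp]
  rw [h1]
  exact ((integrable_indicator_iff hK).2 hu).mul_bdd (c := M) hc.aestronglyMeasurable
    (Eventually.of_forall hM)

/-- Dominated convergence with majorant `M |u|` on `K`. The filter is general, so the same lemma
serves smoothing (`n → ∞`) and concentration (`δ → 0+`). -/
lemma tendsto_setIntegral_mul {ι : Type*} {l : Filter ι} [l.IsCountablyGenerated]
    {C : ι → E → ℝ} (hK : MeasurableSet K) (hu : IntegrableOn u K μ)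
    (hc : ∀ᶠ n in l, Measurable (C n)) (hM : ∀ᶠ n in l, ∀ p, |C n p| ≤ M)
    (h0 : ∀ᶠ n in l, ∀ p, p ∉ K → C n p = 0)
    (hlim : ∀ᵐ p ∂μ, Tendsto (fun n => C n p) l (𝓝 (c p))) :
    Tendsto (fun n => ∫ p in U, u p * C n p ∂μ) l (𝓝 (∫ p in U, u p * c p ∂μ)) := by
  refine tendsto_integral_filter_of_dominated_convergence (fun p => K.indicator (fun p => |u p| * M) p)
    ?_ ?_ ?_ ?_
  · filter_upwards [hc, hM, h0] with n hc hM h0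
    exact (integrable_mul_of_bounded hK hu hc hM h0).restrict.aestronglyMeasurable
  · filter_upwards [hM, h0] with n hM h0
    refine Eventually.of_forall fun p => ?_
    by_cases hp : p ∈ K
    · simp only [hp, indicator_of_mem, norm_mul, Real.norm_eq_abs]
      exact mul_le_mul_of_nonneg_left (hM p) (abs_nonneg _)
    · simp [hp, h0 p hp]
  · exact ((integrable_indicator_iff hK).2 (hu.abs.mul_const M)).restrict
  · exact ae_restrict_of_ae (hlim.mono fun p hp => hp.const_mul _)

lemma tendsto_integral_mul {ι : Type*} {l : Filter ι} [l.IsCountablyGenerated]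
    {C : ι → E → ℝ} (hK : MeasurableSet K) (hu : IntegrableOn u K μ)
    (hc : ∀ᶠ n in l, Measurable (C n)) (hM : ∀ᶠ n in l, ∀ p, |C n p| ≤ M)
    (h0 : ∀ᶠ n in l, ∀ p, p ∉ K → C n p = 0)
    (hlim : ∀ᵐ p ∂μ, Tendsto (fun n => C n p) l (𝓝 (c p))) :
    Tendsto (fun n => ∫ p, u p * C n p ∂μ) l (𝓝 (∫ p, u p * c p ∂μ)) := by
  simpa using tendsto_setIntegral_mul (U := univ) hK hu hc hM h0 hlim

end Weights

/-! ### The fundamental theorem of calculus for weak derivatives on an interval -/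

lemma isTestFunction_of_support {E : Type*} [NormedAddCommGroup E] [NormedSpace ℝ E] {U K : Set E}
    {φ : E → ℝ} (hφ : ContDiff ℝ ∞ φ) (hK : IsCompact K) (hKU : K ⊆ U)
    (h0 : ∀ p, p ∉ K → φ p = 0) : IsTestFunction U φ := by
  have hs : tsupport φ ⊆ K := closure_minimal (fun p hp => by
    by_contra h
    exact hp (h0 p h)) hK.isClosed
  exact ⟨hφ, HasCompactSupport.intro hK h0, hs.trans hKU⟩

/-- The derivatives of the steps form an approximate identity, supported to the right of `s` in `[s,
s + 1/(n+1)]`. -/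
lemma tendsto_setIntegral_deriv_stepApprox {a b s : ℝ} {u : ℝ → ℝ} (hu : ContinuousOn u (Ioo a b))
    (hs : s ∈ Ioo a b) :
    Tendsto (fun n => ∫ y in Ioo a b, u y * deriv (stepApprox n) (y - s)) atTop (𝓝 (u s)) := by
  rw [Metric.tendsto_atTop']
  intro ε hε
  have hcont : ContinuousAt u s := hu.continuousAt (Ioo_mem_nhds hs.1 hs.2)
  obtain ⟨r, hr, hr'⟩ := Metric.continuousAt_iff.1 hcont (ε / 2) (half_pos hε)
  have hev : ∀ᶠ n : ℕ in atTop, 1 / ((n : ℝ) + 1) < min r (b - s) :=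
    tendsto_one_div_succ.eventually (Iio_mem_nhds (lt_min hr (by linarith [hs.2])))
  obtain ⟨N, hN⟩ := eventually_atTop.1 hev
  refine ⟨N, fun n hn => ?_⟩
  have hn := hN n hn.le
  have hn1 := hn.trans_le (min_le_left _ _)
  have hn2 := hn.trans_le (min_le_right _ _)
  set d := 1 / ((n : ℝ) + 1) with hd
  have hd0 : 0 < d := by positivity
  have hsub : Icc s (s + d) ⊆ Ioo a b := fun y hy => ⟨hs.1.trans_le hy.1, by linarith [hy.2]⟩
  have hzero : ∀ y, y ∉ Icc s (s + d) → deriv (stepApprox n) (y - s) = 0 := by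
    intro y hy
    rcases lt_or_ge y s with h | h
    · exact deriv_stepApprox_of_neg n (by linarith)
    · refine deriv_stepApprox_of_gt n ?_
      by_contra h'
      exact hy ⟨h, by linarith⟩
  have h1 : ∫ y in Ioo a b, u y * deriv (stepApprox n) (y - s)
      = ∫ y in s..(s + d), u y * deriv (stepApprox n) (y - s) := by
    rw [intervalIntegral.integral_of_le (by linarith), ← integral_Icc_eq_integral_Ioc]
    refine (setIntegral_eq_of_subset_of_forall_sdiff_eq_zero measurableSet_Ioo hsub fun y hy => ?_)
    rw [hzero y hy.2, mul_zero]
  have hdc : Continuous fun y => deriv (stepApprox n) (y - s) :=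
    (deriv_stepApprox_continuous n).comp (continuous_id.sub continuous_const)
  have h2 : ∫ y in s..(s + d), deriv (stepApprox n) (y - s) = 1 := by
    rw [intervalIntegral.integral_comp_sub_right (fun y => deriv (stepApprox n) y),
      integral_deriv_stepApprox, stepApprox_of_le n (by linarith), stepApprox_of_nonpos n (by linarith)]
    simp
  have hui : IntervalIntegrable (fun y => u y * deriv (stepApprox n) (y - s)) volume s (s + d) := by
    refine ContinuousOn.intervalIntegrable ?_
    rw [uIcc_of_le (by linarith)]
    exact (hu.mono hsub).mul hdc.continuousOn
  have h3 : (∫ y in s..(s + d), u y * deriv (stepApprox n) (y - s)) - u s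
      = ∫ y in s..(s + d), (u y - u s) * deriv (stepApprox n) (y - s) := by
    simp_rw [sub_mul]
    rw [intervalIntegral.integral_sub hui ((hdc.const_mul _).intervalIntegrable _ _),
      intervalIntegral.integral_const_mul, h2, mul_one]
  rw [h1, Real.dist_eq, h3]
  have h4 : |∫ y in s..(s + d), (u y - u s) * deriv (stepApprox n) (y - s)|
      ≤ ∫ y in s..(s + d), ε / 2 * deriv (stepApprox n) (y - s) := by
    rw [← Real.norm_eq_abs]
    refine intervalIntegral.norm_integral_le_of_norm_le (by linarith) ?_
      ((hdc.const_mul _).intervalIntegrable _ _)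
    refine Eventually.of_forall fun y hy => ?_
    rw [norm_mul, Real.norm_eq_abs, Real.norm_of_nonneg (deriv_stepApprox_nonneg n _)]
    refine mul_le_mul_of_nonneg_right (le_of_lt (hr' ?_)) (deriv_stepApprox_nonneg n _)
    rw [Real.dist_eq, abs_of_nonneg (by linarith [hy.1])]
    linarith [hy.2]
  rw [intervalIntegral.integral_const_mul, h2] at h4
  linarith

/-- Testing with a step up at `s` minus a step up at `t`: the function tends to the indicator of
`(s,t]`, its derivative to the difference of the point masses at `s` and `t`. -/
lemma HasWeakDeriv.sub_eq_integral_of_lt {a b s t : ℝ} {u w : ℝ → ℝ}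
    (h : HasWeakDeriv (Ioo a b) 1 u w) (hu : ContinuousOn u (Ioo a b)) (hs : s ∈ Ioo a b)
    (ht : t ∈ Ioo a b) (hst : s < t) : u t - u s = ∫ y in s..t, w y := by
  -- The falling layer of the test function extends beyond `t`; the midpoint leaves room for it
  -- inside `(a,b)`.
  set t' := (t + b) / 2 with ht'
  have htb := ht.2
  have htt' : t < t' := by linarith
  have hK : Icc s t' ⊆ Ioo a b := fun y hy => ⟨hs.1.trans_le hy.1, by linarith [hy.2]⟩
  let φ : ℕ → ℝ → ℝ := fun n y => stepApprox n (y - s) - stepApprox n (y - t)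
  have hφc : ∀ n, ContDiff ℝ ∞ (φ n) := fun n =>
    ((stepApprox_contDiff n).comp (contDiff_id.sub contDiff_const)).sub
      ((stepApprox_contDiff n).comp (contDiff_id.sub contDiff_const))
  have hev : ∀ᶠ n : ℕ in atTop, 1 / ((n : ℝ) + 1) < t' - t :=
    tendsto_one_div_succ.eventually (Iio_mem_nhds (by linarith))
  have hφ0 : ∀ᶠ n in atTop, ∀ y, y ∉ Icc s t' → φ n y = 0 := by
    filter_upwards [hev] with n hn y hy
    rcases lt_or_ge y s with h | h
    · simp only [φ]
      rw [stepApprox_of_nonpos n (by linarith), stepApprox_of_nonpos n (by linarith), sub_zero]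
    · have : t' < y := by
        by_contra h'
        exact hy ⟨h, by linarith⟩
      simp only [φ]
      rw [stepApprox_of_le n (by linarith), stepApprox_of_le n (by linarith), sub_self]
  have hφd : ∀ n y, fderiv ℝ (φ n) y 1
      = deriv (stepApprox n) (y - s) - deriv (stepApprox n) (y - t) := fun n y => by
    rw [fderiv_apply_one_eq_deriv]
    exact (((stepApprox_hasDerivAt n _).comp_sub_const y s).sub
      ((stepApprox_hasDerivAt n _).comp_sub_const y t)).deriv
  have hwK : IntegrableOn w (Icc s t') := h.2.1.integrableOn_compact_subset hK isCompact_Icc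
  have hR : Tendsto (fun n => ∫ y in Ioo a b, w y * φ n y) atTop
      (𝓝 (∫ y in Ioo a b, w y * (Ioc s t).indicator 1 y)) := by
    refine tendsto_setIntegral_mul (M := 1) measurableSet_Icc hwK
      (Eventually.of_forall fun n => (hφc n).continuous.measurable)
      (Eventually.of_forall fun n y => ?_) hφ0 (Eventually.of_forall fun y => ?_)
    · have h1 := stepApprox_nonneg n (y - s)
      have h2 := stepApprox_nonneg n (y - t)
      have h3 := stepApprox_le_one n (y - s)
      have h4 := stepApprox_le_one n (y - t)
      simp only [φ]
      rw [abs_le]; constructor <;> linarith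
    · have : (Ioc s t).indicator (1 : ℝ → ℝ) y
        = (Ioi (0 : ℝ)).indicator 1 (y - s) - (Ioi (0 : ℝ)).indicator 1 (y - t) := by
        simp only [indicator_apply, mem_Ioc, mem_Ioi, Pi.one_apply]
        split_ifs <;> first | (exfalso; grind) | norm_num
      rw [this]
      exact (stepApprox_tendsto _).sub (stepApprox_tendsto _)
  have hRv : ∫ y in Ioo a b, w y * (Ioc s t).indicator 1 y = ∫ y in s..t, w y := by
    rw [intervalIntegral.integral_of_le hst.le]
    have : ∀ y, w y * (Ioc s t).indicator 1 y = (Ioc s t).indicator w y := fun y => by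
      by_cases hy : y ∈ Ioc s t <;> simp [hy]
    simp_rw [this]
    rw [setIntegral_indicator measurableSet_Ioc, inter_eq_self_of_subset_right]
    exact fun y hy => hK ⟨hy.1.le, by linarith [hy.2]⟩
  have hL : Tendsto (fun n => ∫ y in Ioo a b, u y * fderiv ℝ (φ n) y 1) atTop (𝓝 (u s - u t)) := by
    refine ((tendsto_setIntegral_deriv_stepApprox hu hs).sub
      (tendsto_setIntegral_deriv_stepApprox hu ht)).congr' ?_
    filter_upwards [hev] with n hn
    have hint : ∀ r ∈ Icc s t, IntegrableOn (fun y => u y * deriv (stepApprox n) (y - r)) (Ioo a b) := by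
      intro r hr
      have hdc : Continuous fun y => deriv (stepApprox n) (y - r) :=
        (deriv_stepApprox_continuous n).comp (continuous_id.sub continuous_const)
      have h1 : IntegrableOn (fun y => u y * deriv (stepApprox n) (y - r)) (Icc s t') :=
        ((hu.mono hK).mul hdc.continuousOn).integrableOn_compact isCompact_Icc
      refine (integrableOn_iff_integrable_of_support_subset (fun y hy => ?_) |>.1 h1).integrableOn
      by_contra hy'
      refine hy ?_
      rcases lt_or_ge y s with h | h
      · simp [deriv_stepApprox_of_neg n (show y - r < 0 by linarith [hr.1])]
      · have : t' < y := by
          by_contra h'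
          exact hy' ⟨h, by linarith⟩
        simp [deriv_stepApprox_of_gt n (show 1 / ((n : ℝ) + 1) < y - r by linarith [hr.2])]
    rw [← integral_sub (hint s ⟨le_rfl, hst.le⟩) (hint t ⟨hst.le, le_rfl⟩)]
    refine integral_congr_ae (Eventually.of_forall fun y => ?_)
    simp only [hφd]
    ring
  have hL' : Tendsto (fun n => ∫ y in Ioo a b, u y * fderiv ℝ (φ n) y 1) atTop
      (𝓝 (-∫ y in s..t, w y)) := by
    rw [← hRv]
    refine hR.neg.congr' ?_
    filter_upwards [hφ0] with n hn
    exact (h.2.2 _ (isTestFunction_of_support (hφc n) isCompact_Icc hK hn)).symm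
  linarith [tendsto_nhds_unique hL hL']

lemma HasWeakDeriv.sub_eq_integral {a b s t : ℝ} {u w : ℝ → ℝ}
    (h : HasWeakDeriv (Ioo a b) 1 u w) (hu : ContinuousOn u (Ioo a b)) (hs : s ∈ Ioo a b)
    (ht : t ∈ Ioo a b) : u t - u s = ∫ y in s..t, w y := by
  rcases lt_trichotomy s t with hst | rfl | hst
  · exact h.sub_eq_integral_of_lt hu hs ht hst
  · simp
  · rw [intervalIntegral.integral_symm, ← h.sub_eq_integral_of_lt hu ht hs hst, neg_sub]

lemma IsSobolevH1.integrableOn_deriv {a b : ℝ} {f f' : ℝ → ℝ} (h : IsSobolevH1 a b f f') :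
    IntegrableOn f' (Ioo a b) :=
  h.memLp_deriv.integrable one_le_two

/-- The weak derivative sees only the open interval, where `f` minus the primitive of `f'` is
constant; continuity of both carries this to the endpoints. -/
lemma IsSobolevH1.sub_eq_integral {a b t : ℝ} {f f' : ℝ → ℝ} (hab : a < b)
    (h : IsSobolevH1 a b f f') (ht : t ∈ Icc a b) : f t - f a = ∫ y in a..t, f' y := by
  have hi : IntegrableOn f' (Icc a b) := (integrableOn_Icc_iff_integrableOn_Ioo).2 h.integrableOn_deriv
  have hI : IntegrableOn f' (uIcc a b) := by rwa [uIcc_of_le hab.le]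
  have hcont : ContinuousOn (fun t => ∫ y in a..t, f' y) (Icc a b) := by
    simpa [uIcc_of_le hab.le] using intervalIntegral.continuousOn_primitive_interval hI
  have hm : (a + b) / 2 ∈ Ioo a b := ⟨by linarith, by linarith⟩
  have key : ∀ t ∈ Icc a b, f t - (∫ y in a..t, f' y)
      = f ((a + b) / 2) - ∫ y in a..((a + b) / 2), f' y := by
    have hcl : closure (Ioo a b) = Icc a b := closure_Ioo hab.ne
    have hE : EqOn (fun t => f t - ∫ y in a..t, f' y)
        (fun _ => f ((a + b) / 2) - ∫ y in a..((a + b) / 2), f' y) (Ioo a b) := by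
      intro t ht
      have h1 := h.hasWeakDeriv.sub_eq_integral (h.continuousOn.mono Ioo_subset_Icc_self) hm ht
      have hii : ∀ p ∈ Icc a b, IntervalIntegrable f' volume a p := fun p hp => by
        rw [intervalIntegrable_iff_integrableOn_Ioc_of_le hp.1]
        exact hi.mono_set fun y hy => ⟨hy.1.le, hy.2.trans hp.2⟩
      have h2 := intervalIntegral.integral_interval_sub_left (hii t (Ioo_subset_Icc_self ht))
        (hii _ (Ioo_subset_Icc_self hm))
      simp only
      linarith
    intro t ht
    exact hE.of_subset_closure (h.continuousOn.sub hcont) continuousOn_const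
      Ioo_subset_Icc_self hcl.ge ht
  have h1 := key t ht
  have h2 := key a ⟨le_rfl, hab.le⟩
  simp only [intervalIntegral.integral_same, sub_zero] at h2
  linarith

lemma IsSobolevH1.mono {a b a' b' : ℝ} {f f' : ℝ → ℝ} (h : IsSobolevH1 a b f f') (ha : a ≤ a')
    (hb : b' ≤ b) : IsSobolevH1 a' b' f f' := by
  have hs : Ioo a' b' ⊆ Ioo a b := Ioo_subset_Ioo ha hb
  refine ⟨h.continuousOn.mono (Icc_subset_Icc ha hb), h.memLp.mono_measure (Measure.restrict_mono hs le_rfl),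
    h.memLp_deriv.mono_measure (Measure.restrict_mono hs le_rfl), h.hasWeakDeriv.1.mono_set hs,
    h.hasWeakDeriv.2.1.mono_set hs, fun φ hφ => ?_⟩
  have h0 : ∀ y, y ∉ Ioo a' b' → φ y = 0 := fun y hy => image_eq_zero_of_notMem_tsupport
    fun hy' => hy (hφ.2.2 hy')
  have h1 : ∀ y, y ∉ Ioo a' b' → fderiv ℝ φ y 1 = 0 := fun y hy => by
    have : y ∉ tsupport (fderiv ℝ φ) := fun hy' => hy (hφ.2.2 (tsupport_fderiv_subset ℝ hy'))
    simp [image_eq_zero_of_notMem_tsupport this]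
  have := h.hasWeakDeriv.2.2 φ ⟨hφ.1, hφ.2.1, hφ.2.2.trans hs⟩
  rw [← setIntegral_eq_of_subset_of_forall_sdiff_eq_zero measurableSet_Ioo hs
      (fun y hy => by rw [h1 y hy.2, mul_zero]),
    ← setIntegral_eq_of_subset_of_forall_sdiff_eq_zero measurableSet_Ioo hs
      (fun y hy => by rw [h0 y hy.2, mul_zero])]
  exact this

end ViscoString

namespace ViscoString

/-! ### Space-time integrals against product weights -/

lemma isOpen_domain (l : ℝ) : IsOpen (domain l) := isOpen_Ioi.prod isOpen_Ioo

lemma measurableSet_domain (l : ℝ) : MeasurableSet (domain l) := (isOpen_domain l).measurableSet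

section Product

variable {l : ℝ} {u w : ℝ × ℝ → ℝ} {α β : ℝ → ℝ} {A B : Set ℝ} {M N : ℝ}

lemma integrable_mul_prod (hu : LocallyIntegrableOn u (domain l)) (hA : IsCompact A)
    (hB : IsCompact B) (hAs : A ⊆ Ioi 0) (hBs : B ⊆ Ioo 0 l) (hα : Measurable α)
    (hβ : Measurable β) (hM : ∀ t, |α t| ≤ M) (hN : ∀ x, |β x| ≤ N) (hA0 : ∀ t, t ∉ A → α t = 0)
    (hB0 : ∀ x, x ∉ B → β x = 0) : Integrable (fun p => u p * (α p.1 * β p.2)) := by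
  refine integrable_mul_of_bounded (K := A ×ˢ B) (M := M * N) (hA.prod hB).measurableSet
    (hu.integrableOn_compact_subset (prod_mono hAs hBs) (hA.prod hB))
    ((hα.comp measurable_fst).mul (hβ.comp measurable_snd)) (fun p => ?_) fun p hp => ?_
  · rw [abs_mul]
    exact mul_le_mul (hM _) (hN _) (abs_nonneg _) ((abs_nonneg _).trans (hM p.1))
  · rw [mem_prod, not_and_or] at hp
    rcases hp with h | h
    · rw [hA0 _ h, zero_mul]
    · rw [hB0 _ h, mul_zero]

lemma setIntegral_domain_eq {f : ℝ × ℝ → ℝ} (hf : Integrable f) :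
    ∫ p in domain l, f p = ∫ t in Ioi (0 : ℝ), ∫ x in Ioo 0 l, f (t, x) := by
  rw [domain, Measure.volume_eq_prod]
  exact setIntegral_prod f hf.integrableOn

lemma setIntegral_domain_eq_symm {f : ℝ × ℝ → ℝ} (hf : Integrable f) :
    ∫ p in domain l, f p = ∫ x in Ioo 0 l, ∫ t in Ioi (0 : ℝ), f (t, x) := by
  have h : Integrable f (((volume : Measure ℝ).restrict (Ioi 0)).prod
      ((volume : Measure ℝ).restrict (Ioo 0 l))) := by
    rw [Measure.prod_restrict]; exact hf.integrableOn
  rw [domain, Measure.volume_eq_prod, ← Measure.prod_restrict]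
  exact integral_prod_symm f h

end Product

lemma fderiv_apply_one_zero {φ : ℝ × ℝ → ℝ} {p : ℝ × ℝ} {d : ℝ} (hφ : ContDiff ℝ ∞ φ)
    (h : HasDerivAt (fun s => φ (s, p.2)) d p.1) : fderiv ℝ φ p (1, 0) = d := by
  have h1 : HasFDerivAt φ (fderiv ℝ φ p) (p.1, p.2) := (hφ.differentiable (by simp) p).hasFDerivAt
  have h2 : HasDerivAt (fun s : ℝ => (s, p.2)) (1, 0) p.1 :=
    (hasDerivAt_id p.1).prodMk (hasDerivAt_const p.1 p.2)
  exact (h1.comp_hasDerivAt p.1 h2).unique h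

lemma fderiv_apply_zero_one {φ : ℝ × ℝ → ℝ} {p : ℝ × ℝ} {d : ℝ} (hφ : ContDiff ℝ ∞ φ)
    (h : HasDerivAt (fun s => φ (p.1, s)) d p.2) : fderiv ℝ φ p (0, 1) = d := by
  have h1 : HasFDerivAt φ (fderiv ℝ φ p) (p.1, p.2) := (hφ.differentiable (by simp) p).hasFDerivAt
  have h2 : HasDerivAt (fun s : ℝ => (p.1, s)) (0, 1) p.2 :=
    (hasDerivAt_const p.2 p.1).prodMk (hasDerivAt_id p.2)
  exact (h1.comp_hasDerivAt p.2 h2).unique h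

lemma exists_abs_le_of_hasCompactSupport {φ : ℝ → ℝ} (hφ : Continuous φ) (hc : HasCompactSupport φ) :
    ∃ M, ∀ x, |φ x| ≤ M := by
  obtain ⟨M, hM⟩ := hφ.bounded_above_of_compact_support hc
  exact ⟨M, hM⟩

/-! ### Slicing weak derivatives: integration over a time interval, pairing in space. -/

section Slices

variable {l s t : ℝ} {u w : ℝ × ℝ → ℝ} {θ : ℝ → ℝ}

lemma integrable_slab (hu : LocallyIntegrableOn u (domain l)) (hs : 0 < s)
    (hθ : Continuous θ) (hc : HasCompactSupport θ) (hθs : tsupport θ ⊆ Ioo 0 l) :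
    Integrable (fun p => u p * ((Ioc s t).indicator 1 p.1 * θ p.2)) := by
  obtain ⟨N, hN⟩ := exists_abs_le_of_hasCompactSupport hθ hc
  refine integrable_mul_prod (A := Icc s t) (B := tsupport θ) (M := 1) hu isCompact_Icc hc
    (fun y hy => hs.trans_le hy.1) hθs (measurable_one.indicator measurableSet_Ioc)
    hθ.measurable (fun y => ?_) hN (fun y hy => ?_) (fun y hy => image_eq_zero_of_notMem_tsupport hy)
  · by_cases hy : y ∈ Ioc s t <;> simp [hy]
  · exact indicator_of_notMem (fun h => hy (Ioc_subset_Icc_self h)) _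

lemma setIntegral_slab (hu : LocallyIntegrableOn u (domain l)) (hs : 0 < s) (hst : s ≤ t)
    (hθ : Continuous θ) (hc : HasCompactSupport θ) (hθs : tsupport θ ⊆ Ioo 0 l) :
    ∫ p in domain l, u p * ((Ioc s t).indicator 1 p.1 * θ p.2)
      = ∫ x in Ioo 0 l, (∫ τ in s..t, u (τ, x)) * θ x := by
  rw [setIntegral_domain_eq_symm (integrable_slab hu hs hθ hc hθs)]
  refine integral_congr_ae (Eventually.of_forall fun x => ?_)
  simp only
  rw [intervalIntegral.integral_of_le hst, ← integral_mul_const]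
  have : ∀ τ, u (τ, x) * ((Ioc s t).indicator 1 τ * θ x)
      = (Ioc s t).indicator (fun τ => u (τ, x) * θ x) τ := fun τ => by
    by_cases hτ : τ ∈ Ioc s t <;> simp [hτ]
  simp_rw [this]
  rw [setIntegral_indicator measurableSet_Ioc, inter_eq_self_of_subset_right]
  exact fun y hy => hs.trans hy.1

lemma setIntegral_slab' (hu : LocallyIntegrableOn u (domain l)) (hs : 0 < s) (hst : s ≤ t)
    (hθ : Continuous θ) (hc : HasCompactSupport θ) (hθs : tsupport θ ⊆ Ioo 0 l) :
    ∫ p in domain l, u p * ((Ioc s t).indicator 1 p.1 * θ p.2)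
      = ∫ τ in s..t, ∫ x in Ioo 0 l, u (τ, x) * θ x := by
  rw [setIntegral_domain_eq (integrable_slab hu hs hθ hc hθs),
    intervalIntegral.integral_of_le hst]
  have : ∀ τ, ∫ x in Ioo 0 l, u (τ, x) * ((Ioc s t).indicator 1 τ * θ x)
      = (Ioc s t).indicator (fun τ => ∫ x in Ioo 0 l, u (τ, x) * θ x) τ := fun τ => by
    by_cases hτ : τ ∈ Ioc s t <;> simp [hτ]
  simp_rw [this]
  rw [setIntegral_indicator measurableSet_Ioc, inter_eq_self_of_subset_right]
  exact fun y hy => hs.trans hy.1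

lemma locallyIntegrableOn_slice (hu : LocallyIntegrableOn u (domain l)) (hs : 0 < s) (hst : s ≤ t) :
    LocallyIntegrableOn (fun x => ∫ τ in s..t, u (τ, x)) (Ioo 0 l) := by
  rw [locallyIntegrableOn_iff isOpen_Ioo.isLocallyClosed]
  intro K hKs hK
  have h : IntegrableOn u (Icc s t ×ˢ K) :=
    hu.integrableOn_compact_subset (prod_mono (fun y hy => hs.trans_le hy.1) hKs)
      (isCompact_Icc.prod hK)
  have h' : IntegrableOn u (Ioc s t ×ˢ K) := h.mono_set (prod_mono Ioc_subset_Icc_self le_rfl)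
  rw [IntegrableOn, Measure.volume_eq_prod, ← Measure.prod_restrict] at h'
  simp_rw [intervalIntegral.integral_of_le hst]
  exact h'.integral_prod_right

/-- Integration in time over a compact interval commutes with the weak space derivative. -/
lemma HasWeakDeriv.slice (h : HasWeakDeriv (domain l) (0, 1) u w) (hs : 0 < s) (hst : s ≤ t) :
    HasWeakDeriv (Ioo 0 l) 1 (fun x => ∫ τ in s..t, u (τ, x)) (fun x => ∫ τ in s..t, w (τ, x)) := by
  refine ⟨locallyIntegrableOn_slice h.1 hs hst, locallyIntegrableOn_slice h.2.1 hs hst, fun θ hθ => ?_⟩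
  have hd : ∀ x, fderiv ℝ θ x 1 = deriv θ x := fun x => fderiv_apply_one_eq_deriv
  have hdc : Continuous (deriv θ) := hθ.1.continuous_deriv (by simp)
  have hds : HasCompactSupport (deriv θ) := hθ.2.1.deriv
  have hdt : tsupport (deriv θ) ⊆ Ioo 0 l := (tsupport_deriv_subset).trans hθ.2.2
  simp_rw [hd]
  rw [← setIntegral_slab h.1 hs hst hdc hds hdt, ← setIntegral_slab h.2.1 hs hst
    hθ.1.continuous hθ.2.1 hθ.2.2]
  -- A weak space derivative does not differentiate the factor in time, so smooth `χ n` can be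
  -- replaced in the limit by the indicator of `(s,t]`.
  let χ : ℕ → ℝ → ℝ := fun n y => stepApprox n (y - s) - stepApprox n (y - t)
  have hχc : ∀ n, ContDiff ℝ ∞ (χ n) := fun n =>
    ((stepApprox_contDiff n).comp (contDiff_id.sub contDiff_const)).sub
      ((stepApprox_contDiff n).comp (contDiff_id.sub contDiff_const))
  have hχ0 : ∀ n, ∀ y, y ∉ Icc s (t + 1) → χ n y = 0 := by
    intro n y hy
    rcases lt_or_ge y s with h | h
    · simp only [χ]
      rw [stepApprox_of_nonpos n (by linarith), stepApprox_of_nonpos n (by linarith), sub_zero]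
    · have : t + 1 < y := by
        by_contra h'
        exact hy ⟨h, by linarith⟩
      have h1 : 1 / ((n : ℝ) + 1) ≤ 1 := by
        rw [div_le_one (by positivity)]; linarith [n.cast_nonneg (α := ℝ)]
      simp only [χ]
      rw [stepApprox_of_le n (by linarith), stepApprox_of_le n (by linarith), sub_self]
  have hχ1 : ∀ n y, |χ n y| ≤ 1 := fun n y => by
    have h1 := stepApprox_nonneg n (y - s)
    have h2 := stepApprox_nonneg n (y - t)
    have h3 := stepApprox_le_one n (y - s)
    have h4 := stepApprox_le_one n (y - t)
    simp only [χ]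
    rw [abs_le]; constructor <;> linarith
  have hχt : ∀ y, Tendsto (fun n => χ n y) atTop (𝓝 ((Ioc s t).indicator 1 y)) := fun y => by
    have : (Ioc s t).indicator (1 : ℝ → ℝ) y
        = (Ioi (0 : ℝ)).indicator 1 (y - s) - (Ioi (0 : ℝ)).indicator 1 (y - t) := by
      simp only [indicator_apply, mem_Ioc, mem_Ioi, Pi.one_apply]
      split_ifs <;> first | (exfalso; grind) | norm_num
    rw [this]
    exact (stepApprox_tendsto _).sub (stepApprox_tendsto _)
  have hK : IsCompact (Icc s (t + 1) ×ˢ tsupport θ) := isCompact_Icc.prod hθ.2.1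
  have hKs : Icc s (t + 1) ×ˢ tsupport θ ⊆ domain l :=
    prod_mono (fun y hy => hs.trans_le hy.1) hθ.2.2
  have lim : ∀ {v : ℝ × ℝ → ℝ} {ϑ : ℝ → ℝ}, LocallyIntegrableOn v (domain l) → Continuous ϑ →
      HasCompactSupport ϑ → tsupport ϑ ⊆ tsupport θ →
      Tendsto (fun n => ∫ p in domain l, v p * (χ n p.1 * ϑ p.2)) atTop
        (𝓝 (∫ p in domain l, v p * ((Ioc s t).indicator 1 p.1 * ϑ p.2))) := by
    intro v ϑ hv hϑ hϑc hϑs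
    obtain ⟨N, hN⟩ := exists_abs_le_of_hasCompactSupport hϑ hϑc
    refine tendsto_setIntegral_mul (M := 1 * N) hK.measurableSet
      (hv.integrableOn_compact_subset hKs hK) (Eventually.of_forall fun n =>
      ((hχc n).continuous.measurable.comp measurable_fst).mul (hϑ.measurable.comp measurable_snd))
      (Eventually.of_forall fun n p => ?_) (Eventually.of_forall fun n p hp => ?_)
      (Eventually.of_forall fun p => (hχt p.1).mul_const _)
    · rw [abs_mul]
      exact mul_le_mul (hχ1 n _) (hN _) (abs_nonneg _) zero_le_one
    · rw [mem_prod, not_and_or] at hp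
      rcases hp with h | h
      · rw [hχ0 n _ h, zero_mul]
      · rw [image_eq_zero_of_notMem_tsupport fun h' => h (hϑs h'), mul_zero]
  have h1 := lim h.1 hdc hds tsupport_deriv_subset
  have h2 := (lim h.2.1 hθ.1.continuous hθ.2.1 le_rfl).neg
  refine tendsto_nhds_unique h1 (h2.congr fun n => ?_)
  have hc : ContDiff ℝ ∞ fun p : ℝ × ℝ => χ n p.1 * θ p.2 := (hχc n).fst'.mul hθ.1.snd'
  rw [← h.2.2 (fun p => χ n p.1 * θ p.2) (isTestFunction_of_support hc hK hKs fun p hp => ?_)]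
  · refine integral_congr_ae (Eventually.of_forall fun p => ?_)
    simp only
    rw [fderiv_apply_zero_one hc (d := χ n p.1 * deriv θ p.2)]
    exact ((hθ.1.differentiable (by simp) p.2).hasDerivAt.const_mul (χ n p.1))
  · rw [mem_prod, not_and_or] at hp
    rcases hp with h | h
    · rw [hχ0 n _ h, zero_mul]
    · rw [image_eq_zero_of_notMem_tsupport h, mul_zero]

/-- Pairing in space with a test function commutes with the weak time derivative. -/
lemma HasWeakDeriv.pairing (h : HasWeakDeriv (domain l) (1, 0) u w) (hθ : IsTestFunction (Ioo 0 l) θ)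
    (T : ℝ) :
    HasWeakDeriv (Ioo 0 T) 1 (fun τ => ∫ x in Ioo 0 l, u (τ, x) * θ x)
      (fun τ => ∫ x in Ioo 0 l, w (τ, x) * θ x) := by
  obtain ⟨N, hN⟩ := exists_abs_le_of_hasCompactSupport hθ.1.continuous hθ.2.1
  have loc : ∀ {v : ℝ × ℝ → ℝ}, LocallyIntegrableOn v (domain l) →
      LocallyIntegrableOn (fun τ => ∫ x in Ioo 0 l, v (τ, x) * θ x) (Ioo 0 T) := by
    intro v hv
    rw [locallyIntegrableOn_iff isOpen_Ioo.isLocallyClosed]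
    intro K hKs hK
    have h1 : Integrable (fun p => v p * (K.indicator 1 p.1 * θ p.2)) := by
      refine integrable_mul_prod (A := K) (B := tsupport θ) (M := 1) hv hK hθ.2.1
        (fun y hy => (hKs hy).1) hθ.2.2 (measurable_one.indicator hK.measurableSet)
        hθ.1.continuous.measurable (fun y => ?_) hN (fun y hy => indicator_of_notMem hy _)
        (fun y hy => image_eq_zero_of_notMem_tsupport hy)
      by_cases hy : y ∈ K <;> simp [hy]
    have h2 : Integrable (fun p => v p * (K.indicator 1 p.1 * θ p.2))
        (((volume : Measure ℝ).restrict K).prod ((volume : Measure ℝ).restrict (Ioo 0 l))) := by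
      rw [Measure.prod_restrict]
      exact h1.integrableOn
    refine h2.integral_prod_left.congr ?_
    filter_upwards [ae_restrict_mem hK.measurableSet] with τ hτ
    simp [hτ]
  refine ⟨loc h.1, loc h.2.1, fun χ hχ => ?_⟩
  have hd : ∀ x, fderiv ℝ χ x 1 = deriv χ x := fun x => fderiv_apply_one_eq_deriv
  have hs0 : tsupport χ ⊆ Ioi 0 := hχ.2.2.trans fun y hy => hy.1
  have pair : ∀ {v : ℝ × ℝ → ℝ} {ϑ : ℝ → ℝ}, LocallyIntegrableOn v (domain l) → Continuous ϑ →
      HasCompactSupport ϑ → tsupport ϑ ⊆ tsupport χ →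
      ∫ p in domain l, v p * (ϑ p.1 * θ p.2)
        = ∫ τ in Ioo 0 T, (∫ x in Ioo 0 l, v (τ, x) * θ x) * ϑ τ := by
    intro v ϑ hv hϑ hϑc hϑs
    obtain ⟨M, hM⟩ := exists_abs_le_of_hasCompactSupport hϑ hϑc
    rw [setIntegral_domain_eq (integrable_mul_prod (A := tsupport ϑ) (B := tsupport θ) hv hϑc hθ.2.1
      (hϑs.trans hs0) hθ.2.2 hϑ.measurable hθ.1.continuous.measurable hM hN
      (fun y hy => image_eq_zero_of_notMem_tsupport hy)
      (fun y hy => image_eq_zero_of_notMem_tsupport hy))]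
    have : ∀ τ, ∫ x in Ioo 0 l, v (τ, x) * (ϑ τ * θ x)
        = (∫ x in Ioo 0 l, v (τ, x) * θ x) * ϑ τ := fun τ => by
      rw [← integral_mul_const]
      congr 1; ext x; ring
    simp_rw [this]
    refine setIntegral_eq_of_subset_of_forall_sdiff_eq_zero measurableSet_Ioi Ioo_subset_Ioi_self
      fun τ hτ => ?_
    rw [image_eq_zero_of_notMem_tsupport fun h' => hτ.2 (hχ.2.2 (hϑs h')), mul_zero]
  have hdc : Continuous (deriv χ) := hχ.1.continuous_deriv (by simp)
  simp_rw [hd]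
  rw [← pair h.1 hdc hχ.2.1.deriv tsupport_deriv_subset, ← pair h.2.1 hχ.1.continuous hχ.2.1 le_rfl]
  have hc : ContDiff ℝ ∞ fun p : ℝ × ℝ => χ p.1 * θ p.2 := hχ.1.fst'.mul hθ.1.snd'
  rw [← h.2.2 (fun p => χ p.1 * θ p.2) (isTestFunction_of_support hc (hχ.2.1.isCompact.prod hθ.2.1)
    (prod_mono hs0 hθ.2.2) fun p hp => ?_)]
  · refine integral_congr_ae (Eventually.of_forall fun p => ?_)
    simp only
    rw [fderiv_apply_one_zero hc (d := deriv χ p.1 * θ p.2)]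
    exact ((hχ.1.differentiable (by simp) p.1).hasDerivAt.mul_const (θ p.2))
  · rw [mem_prod, not_and_or] at hp
    rcases hp with h | h
    · rw [image_eq_zero_of_notMem_tsupport h, zero_mul]
    · rw [image_eq_zero_of_notMem_tsupport h, mul_zero]

end Slices

end ViscoString

namespace ViscoString

/-! ### Difference formulas for weak solutions -/

/-- Extension of a function on `[0,∞) × [0,l]` to the plane by projecting onto that set. -/
noncomputable def planeExtension (l : ℝ) (u : ℝ × ℝ → ℝ) (p : ℝ × ℝ) : ℝ :=
  u (max 0 p.1, max 0 (min l p.2))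

lemma planeExtension_continuous {l : ℝ} (hl : 0 ≤ l) {u : ℝ × ℝ → ℝ}
    (hu : ContinuousOn u (closedDomain l)) : Continuous (planeExtension l u) := by
  refine hu.comp_continuous (by fun_prop) fun p => ?_
  exact mem_prod.2 ⟨mem_Ici.2 (le_max_left _ _),
    mem_Icc.2 ⟨le_max_left _ _, max_le hl (min_le_left _ _)⟩⟩

lemma planeExtension_eq {l : ℝ} {u : ℝ × ℝ → ℝ} {p : ℝ × ℝ} (hp : p ∈ closedDomain l) :
    planeExtension l u p = u p := by
  have h1 : 0 ≤ p.1 := hp.1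
  have h2 := hp.2
  rw [planeExtension, max_eq_right h1, min_eq_right h2.2, max_eq_right h2.1]

lemma domain_subset_closedDomain (l : ℝ) : domain l ⊆ closedDomain l :=
  prod_mono Ioi_subset_Ici_self Ioo_subset_Icc_self

variable {l h : ℝ} {ζ : ℝ × ℝ → ℝ} {η₀ η₀x v₀ : ℝ → ℝ} {η ηt ηx ηtx : ℝ × ℝ → ℝ}
  {F D : Measure (ℝ × ℝ)}

namespace IsWeakSolution

lemma continuousOn_domain (hsol : IsWeakSolution l h ζ η₀ η₀x v₀ η ηt ηx ηtx F D) :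
    ContinuousOn η (domain l) := hsol.continuousOn.mono (domain_subset_closedDomain l)

/-- Paired with a test function `θ` in space, `η` becomes a continuous function of time with weak
derivative `∫ ηt θ`, to which the one-dimensional fundamental theorem applies. Since `θ` is
arbitrary, Fubini gives the identity almost everywhere in `x`. -/
lemma sub_ae_eq_integral_of_lt (hsol : IsWeakSolution l h ζ η₀ η₀x v₀ η ηt ηx ηtx F D)
    (hl : 0 < l) {s t : ℝ} (hs : 0 < s) (hst : s ≤ t) :
    ∀ᵐ x ∂(volume.restrict (Ioo 0 l)), η (t, x) - η (s, x) = ∫ τ in s..t, ηt (τ, x) := by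
  have hcont : Continuous (planeExtension l η) := planeExtension_continuous hl.le hsol.continuousOn
  have hline : ∀ r, 0 < r → ContinuousOn (fun x => η (r, x)) (Ioo 0 l) := fun r hr =>
    hsol.continuousOn_domain.comp (by fun_prop) fun x hx => ⟨hr, hx⟩
  have hloc : LocallyIntegrableOn (fun x => η (t, x) - η (s, x) - ∫ τ in s..t, ηt (τ, x))
      (Ioo 0 l) :=
    ((((hline t (hs.trans_le hst)).sub (hline s hs)).locallyIntegrableOn measurableSet_Ioo).sub
      (locallyIntegrableOn_slice hsol.weakDeriv_t.2.1 hs hst))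
  have key := isOpen_Ioo.ae_eq_zero_of_integral_contDiff_smul_eq_zero hloc fun θ hθ hθc hθs => ?_
  · filter_upwards [ae_restrict_of_ae key, ae_restrict_mem measurableSet_Ioo] with x hx hx'
    exact sub_eq_zero.1 (hx hx')
  have hsupp : ∀ x, x ∉ Ioo 0 l → θ x = 0 := fun x hx =>
    image_eq_zero_of_notMem_tsupport fun h' => hx (hθs h')
  have hint : ∀ r, 0 < r → IntegrableOn (fun x => η (r, x) * θ x) (Ioo 0 l) := by
    intro r hr
    have h1 : Continuous fun x => planeExtension l η (r, x) * θ x :=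
      (hcont.comp (by fun_prop)).mul hθ.continuous
    refine ((h1.integrable_of_hasCompactSupport hθc.mul_left).integrableOn).congr_fun
      (fun x hx => ?_) measurableSet_Ioo
    simp only
    rw [planeExtension_eq (domain_subset_closedDomain l (mk_mem_prod hr hx))]
  have hpair := hsol.weakDeriv_t.pairing ⟨hθ, hθc, hθs⟩ (t + 1)
  have hpc : ContinuousOn (fun τ => ∫ x in Ioo 0 l, η (τ, x) * θ x) (Ioo 0 (t + 1)) := by
    have h1 : Continuous fun τ => ∫ x in (0 : ℝ)..l, planeExtension l η (τ, x) * θ x :=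
      intervalIntegral.continuous_parametric_intervalIntegral_of_continuous'
        (f := fun τ x => planeExtension l η (τ, x) * θ x)
        (hcont.mul (hθ.continuous.comp continuous_snd)) 0 l
    refine h1.continuousOn.congr fun τ hτ => ?_
    beta_reduce
    rw [intervalIntegral.integral_of_le hl.le, integral_Ioc_eq_integral_Ioo]
    refine setIntegral_congr_fun measurableSet_Ioo fun x hx => ?_
    rw [planeExtension_eq (domain_subset_closedDomain l (mk_mem_prod hτ.1 hx))]
  have hftc := hpair.sub_eq_integral hpc (s := s) (t := t) ⟨hs, by linarith⟩
    ⟨by linarith, by linarith⟩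
  rw [← setIntegral_slab' hsol.weakDeriv_t.2.1 hs hst hθ.continuous hθc hθs,
    setIntegral_slab hsol.weakDeriv_t.2.1 hs hst hθ.continuous hθc hθs] at hftc
  have hint2 : IntegrableOn (fun x => (∫ τ in s..t, ηt (τ, x)) * θ x) (Ioo 0 l) := by
    obtain ⟨N, hN⟩ := exists_abs_le_of_hasCompactSupport hθ.continuous hθc
    exact (integrable_mul_of_bounded (K := tsupport θ) hθc.isCompact.measurableSet
      ((locallyIntegrableOn_slice hsol.weakDeriv_t.2.1 hs hst).integrableOn_compact_subset hθs
      hθc.isCompact) hθ.continuous.measurable hN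
      fun y hy => image_eq_zero_of_notMem_tsupport hy).integrableOn
  have h3 : ∫ x, θ x • (η (t, x) - η (s, x) - ∫ τ in s..t, ηt (τ, x))
      = ∫ x in Ioo 0 l, (η (t, x) * θ x - η (s, x) * θ x - (∫ τ in s..t, ηt (τ, x)) * θ x) := by
    rw [← setIntegral_eq_integral_of_forall_compl_eq_zero (s := Ioo 0 l)]
    · refine integral_congr_ae (Eventually.of_forall fun x => ?_)
      simp only [smul_eq_mul]
      ring
    · intro x hx
      rw [hsupp x hx, zero_smul]
  have h4 := integral_sub (hint t (hs.trans_le hst)) (hint s hs)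
  have h5 := integral_sub ((hint t (hs.trans_le hst)).sub (hint s hs)) hint2
  simp only [Pi.sub_apply] at h4 h5
  rw [h3, h5, h4]
  linarith

lemma ae_integrableOn_velocity (hsol : IsWeakSolution l h ζ η₀ η₀x v₀ η ηt ηx ηtx F D) :
    ∀ᵐ x ∂(volume.restrict (Ioo 0 l)), ∀ n : ℕ,
      IntegrableOn (fun τ => ηt (τ, x)) (Ioo 0 (n : ℝ)) := by
  rw [ae_all_iff]
  intro n
  have hs : Ioo 0 (n : ℝ) ×ˢ Ioo 0 l ⊆ domain l := prod_mono Ioo_subset_Ioi_self le_rfl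
  have h1 : MemLp ηt 2 (volume.restrict (Ioo 0 (n : ℝ) ×ˢ Ioo 0 l)) :=
    hsol.memLp_t.mono_measure (Measure.restrict_mono hs le_rfl)
  have : IsFiniteMeasure ((volume : Measure (ℝ × ℝ)).restrict (Ioo 0 (n : ℝ) ×ˢ Ioo 0 l)) := by
    refine isFiniteMeasure_restrict.2 (ne_top_of_le_ne_top ?_ (measure_mono (prod_mono
      Ioo_subset_Icc_self Ioo_subset_Icc_self)))
    exact (isCompact_Icc.prod isCompact_Icc).measure_ne_top
  have h2 : Integrable ηt (volume.restrict (Ioo 0 (n : ℝ) ×ˢ Ioo 0 l)) := h1.integrable one_le_two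
  rw [Measure.volume_eq_prod, ← Measure.prod_restrict] at h2
  exact h2.prod_left_ae

/-- For almost every `x`, the displacement at `x` is the primitive of the velocity at `x`. -/
lemma ae_sub_eq_integral (hsol : IsWeakSolution l h ζ η₀ η₀x v₀ η ηt ηx ηtx F D) (hl : 0 < l) :
    ∀ᵐ x ∂(volume.restrict (Ioo 0 l)), ∀ s t, 0 < s → s ≤ t →
      η (t, x) - η (s, x) = ∫ τ in s..t, ηt (τ, x) := by
  -- The null set of `sub_ae_eq_integral_of_lt` depends on the two times. Countably many rational
  -- pairs give a common null set, and both sides are continuous in the times.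
  have hq : ∀ᵐ x ∂(volume.restrict (Ioo 0 l)), ∀ q : ℚ, ∀ r : ℚ, 0 < (q : ℝ) → (q : ℝ) ≤ r →
      η (r, x) - η (q, x) = ∫ τ in (q : ℝ)..r, ηt (τ, x) := by
    rw [ae_all_iff]; intro q
    rw [ae_all_iff]; intro r
    by_cases hq : 0 < (q : ℝ)
    · by_cases hqr : (q : ℝ) ≤ r
      · filter_upwards [hsol.sub_ae_eq_integral_of_lt hl hq hqr] with x hx _ _ using hx
      · exact Eventually.of_forall fun x _ h => absurd h hqr
    · exact Eventually.of_forall fun x h => absurd h hq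
  filter_upwards [hq, hsol.ae_integrableOn_velocity, ae_restrict_mem measurableSet_Ioo]
    with x hx hi hxm
  have hcη : Continuous fun τ => planeExtension l η (τ, x) :=
    (planeExtension_continuous hl.le hsol.continuousOn).comp (by fun_prop)
  have hη : ∀ τ, 0 < τ → planeExtension l η (τ, x) = η (τ, x) := fun τ hτ =>
    planeExtension_eq (domain_subset_closedDomain l (mk_mem_prod hτ hxm))
  have main : ∀ s t, 0 < s → s < t → η (t, x) - η (s, x) = ∫ τ in s..t, ηt (τ, x) := by
    intro s t hs hst
    obtain ⟨n, hn⟩ := exists_nat_gt t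
    have hint : IntegrableOn (fun τ => ηt (τ, x)) (uIcc 0 n) := by
      rw [uIcc_of_le (by linarith : (0 : ℝ) ≤ n), integrableOn_Icc_iff_integrableOn_Ioo]
      exact hi n
    have hcI : ContinuousOn (fun r => ∫ τ in (0 : ℝ)..r, ηt (τ, x)) (Icc 0 n) := by
      have := intervalIntegral.continuousOn_primitive_interval hint
      rwa [uIcc_of_le (by linarith : (0 : ℝ) ≤ n)] at this
    have hii : ∀ r ∈ Icc (0 : ℝ) n, IntervalIntegrable (fun τ => ηt (τ, x)) volume 0 r := by
      intro r hr
      rw [intervalIntegrable_iff_integrableOn_Ioc_of_le hr.1]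
      refine hint.mono_set fun y hy => ?_
      rw [uIcc_of_le (by linarith : (0 : ℝ) ≤ n)]
      exact ⟨hy.1.le, hy.2.trans hr.2⟩
    have hsplit : ∀ p ∈ Icc (0 : ℝ) n, ∀ q ∈ Icc (0 : ℝ) n, ∫ τ in p..q, ηt (τ, x)
        = (∫ τ in (0 : ℝ)..q, ηt (τ, x)) - ∫ τ in (0 : ℝ)..p, ηt (τ, x) := fun p hp q hq =>
      (intervalIntegral.integral_interval_sub_left (hii q hq) (hii p hp)).symm
    have hopen : IsOpen (Ioo 0 t) := isOpen_Ioo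
    let G : ℝ → ℝ := fun r => planeExtension l η (r, x) - ∫ τ in (0 : ℝ)..r, ηt (τ, x)
    have hG : ContinuousOn G (Ioo 0 (n : ℝ)) :=
      hcη.continuousOn.sub (hcI.mono Ioo_subset_Icc_self)
    obtain ⟨q₀, hq₀⟩ := exists_rat_btwn hs
    have hq₀' : (q₀ : ℝ) ∈ Ioo (0 : ℝ) n := ⟨hq₀.1, by linarith [hq₀.2]⟩
    have hrat : ∀ r : ℚ, (r : ℝ) ∈ Ioo (0 : ℝ) n → G r = G q₀ := by
      intro r hr
      have h1 := hsplit q₀ (Ioo_subset_Icc_self hq₀') r (Ioo_subset_Icc_self hr)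
      have h2 := hsplit r (Ioo_subset_Icc_self hr) q₀ (Ioo_subset_Icc_self hq₀')
      simp only [G]
      rw [hη _ hr.1, hη _ hq₀'.1]
      rcases le_total (q₀ : ℝ) r with hle | hle
      · linarith [hx q₀ r hq₀'.1 hle]
      · linarith [hx r q₀ hr.1 hle]
    have hall : EqOn G (fun _ => G q₀) (Ioo 0 (n : ℝ)) := by
      refine EqOn.of_subset_closure (s := Ioo 0 (n : ℝ) ∩ range ((↑) : ℚ → ℝ)) ?_ hG
        continuousOn_const inter_subset_left ?_
      · rintro _ ⟨hr, r, rfl⟩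
        exact hrat r hr
      · exact Rat.denseRange_cast.open_subset_closure_inter isOpen_Ioo
    have h1 := hall (show s ∈ Ioo 0 (n : ℝ) from ⟨hs, by linarith⟩)
    have h2 := hall (show t ∈ Ioo 0 (n : ℝ) from ⟨by linarith, hn⟩)
    have h3 := hsplit s ⟨hs.le, by linarith⟩ t ⟨by linarith, hn.le⟩
    simp only [G] at h1 h2
    rw [hη _ hs] at h1
    rw [hη _ (hs.trans hst)] at h2
    linarith
  intro s t hs hst
  rcases hst.eq_or_lt with rfl | hlt
  · simp
  · exact main s t hs hlt

/-- The mixed difference of the displacement over a rectangle. -/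
lemma mixed_difference (hsol : IsWeakSolution l h ζ η₀ η₀x v₀ η ηt ηx ηtx F D) (hl : 0 < l)
    {s t x y : ℝ} (hs : 0 < s) (hst : s ≤ t) (hx : x ∈ Ioo 0 l) (hy : y ∈ Ioo 0 l) :
    η (t, y) - η (s, y) - (η (t, x) - η (s, x)) = ∫ z in x..y, ∫ τ in s..t, ηtx (τ, z) := by
  have hline : ∀ r, 0 < r → ContinuousOn (fun x => η (r, x)) (Ioo 0 l) := fun r hr =>
    hsol.continuousOn_domain.comp (by fun_prop) fun x hx => ⟨hr, hx⟩
  have hc : ContinuousOn (fun x => η (t, x) - η (s, x)) (Ioo 0 l) :=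
    (hline t (hs.trans_le hst)).sub (hline s hs)
  have h1 := hsol.weakDeriv_tx.slice hs hst
  -- The time increment of `η` agrees almost everywhere with the time integral of `ηt` and inherits
  -- its weak space derivative; being continuous, it satisfies the fundamental theorem at every pair
  -- of points.
  have h2 : HasWeakDeriv (Ioo 0 l) 1 (fun x => η (t, x) - η (s, x))
      (fun x => ∫ τ in s..t, ηtx (τ, x)) := by
    refine ⟨hc.locallyIntegrableOn measurableSet_Ioo, h1.2.1, fun φ hφ => ?_⟩
    rw [← h1.2.2 φ hφ]
    refine integral_congr_ae ?_
    filter_upwards [hsol.sub_ae_eq_integral_of_lt hl hs hst] with x hx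
    rw [hx]
  exact h2.sub_eq_integral hc hx hy

/-- The space difference of the displacement, integrated in time. -/
lemma space_difference (hsol : IsWeakSolution l h ζ η₀ η₀x v₀ η ηt ηx ηtx F D) (hl : 0 < l)
    {s t x y : ℝ} (hs : 0 < s) (hst : s ≤ t) (hx : x ∈ Ioo 0 l) (hy : y ∈ Ioo 0 l) :
    (∫ τ in s..t, η (τ, y)) - (∫ τ in s..t, η (τ, x)) = ∫ z in x..y, ∫ τ in s..t, ηx (τ, z) := by
  have h1 := hsol.weakDeriv_x.slice hs hst
  have hcont : Continuous (planeExtension l η) := planeExtension_continuous hl.le hsol.continuousOn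
  have h2 : Continuous fun x => ∫ τ in s..t, planeExtension l η (τ, x) :=
    intervalIntegral.continuous_parametric_intervalIntegral_of_continuous'
      (f := fun x τ => planeExtension l η (τ, x)) (hcont.comp continuous_swap) s t
  refine h1.sub_eq_integral (h2.continuousOn.congr fun x hx => ?_) hx hy
  refine intervalIntegral.integral_congr fun τ hτ => ?_
  rw [uIcc_of_le hst] at hτ
  exact (planeExtension_eq (domain_subset_closedDomain l (mk_mem_prod (hs.trans_le hτ.1) hx))).symm

end IsWeakSolution

end ViscoString

namespace ViscoString

/-! ### Square integrability -/

lemma MemLinftyL2.exists_integral_sq_le {l : ℝ} {u : ℝ × ℝ → ℝ} (hu : MemLinftyL2 l u) :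
    ∃ C, 0 ≤ C ∧ ∀ᵐ t ∂(volume.restrict (Ioi (0 : ℝ))),
      MemLp (fun x => u (t, x)) 2 (volume.restrict (Ioo 0 l)) ∧
        ∫ x in Ioo 0 l, u (t, x) ^ 2 ≤ C := by
  obtain ⟨hm, C, hC⟩ := hu
  refine ⟨(C : ℝ) ^ 2, by positivity, ?_⟩
  rw [domain, Measure.volume_eq_prod, ← Measure.prod_restrict] at hm
  filter_upwards [hC, hm.prodMk_left] with t ht hmt
  refine ⟨⟨hmt, ht.trans_lt ENNReal.coe_lt_top⟩, ?_⟩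
  rw [integral_eq_lintegral_of_nonneg_ae (Eventually.of_forall fun x => sq_nonneg _) (hmt.pow 2)]
  have h1 : ∫⁻ x in Ioo 0 l, ENNReal.ofReal (u (t, x) ^ 2)
      = eLpNorm (fun x => u (t, x)) 2 (volume.restrict (Ioo 0 l)) ^ 2 := by
    have := eLpNorm_nnreal_pow_eq_lintegral (p := 2) (f := fun x => u (t, x))
      (μ := volume.restrict (Ioo 0 l)) two_ne_zero
    simp only [ENNReal.coe_ofNat, NNReal.coe_ofNat, ENNReal.rpow_ofNat] at this
    rw [this]
    refine lintegral_congr fun x => ?_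
    rw [← sq_abs, ENNReal.ofReal_pow (abs_nonneg _), Real.enorm_eq_ofReal_abs]
  rw [h1]
  have h2 : eLpNorm (fun x => u (t, x)) 2 (volume.restrict (Ioo 0 l)) ^ 2 ≤ (C : ℝ≥0∞) ^ 2 := by
    gcongr
  calc _ ≤ ((C : ℝ≥0∞) ^ 2).toReal := ENNReal.toReal_mono (by simp) h2
    _ = _ := by simp

lemma MemLinftyL2.memLp {l : ℝ} {u : ℝ × ℝ → ℝ} (hu : MemLinftyL2 l u) (T : ℝ) :
    MemLp u 2 (volume.restrict (Ioo 0 T ×ˢ Ioo 0 l)) := by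
  obtain ⟨C, hC0, hC⟩ := hu.exists_integral_sq_le
  have hm : AEStronglyMeasurable u (volume.restrict (Ioo 0 T ×ˢ Ioo 0 l)) :=
    hu.1.mono_measure (Measure.restrict_mono (Set.prod_mono Ioo_subset_Ioi_self le_rfl) le_rfl)
  rw [memLp_two_iff_integrable_sq hm]
  rw [Measure.volume_eq_prod, ← Measure.prod_restrict] at hm ⊢
  have hC' : ∀ᵐ t ∂(volume.restrict (Ioo 0 T)), MemLp (fun x => u (t, x)) 2 (volume.restrict (Ioo 0 l)) ∧
        ∫ x in Ioo 0 l, u (t, x) ^ 2 ≤ C := ae_restrict_of_ae_restrict_of_subset Ioo_subset_Ioi_self hC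
  have hm2 : AEStronglyMeasurable (fun p => u p ^ 2)
      ((volume.restrict (Ioo 0 T)).prod (volume.restrict (Ioo 0 l))) := hm.pow 2
  rw [integrable_prod_iff hm2]
  refine ⟨hC'.mono fun t ht => ht.1.integrable_sq, ?_⟩
  refine Integrable.of_bound hm2.norm.integral_prod_right' C (hC'.mono fun t ht => ?_)
  simp only [norm_pow, Real.norm_eq_abs, sq_abs]
  rw [abs_of_nonneg (integral_nonneg fun x => sq_nonneg _)]
  exact ht.2

/-! ### The momentum equation along a smooth curve -/

variable {l h : ℝ} {ζ : ℝ × ℝ → ℝ} {η₀ η₀x v₀ : ℝ → ℝ} {η ηt ηx ηtx : ℝ × ℝ → ℝ}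
  {F D : Measure (ℝ × ℝ)}

lemma integrable_mul_of_tsupport {u c φ : ℝ × ℝ → ℝ} (hu : LocallyIntegrableOn u (domain l))
    (hφ : IsTestFunction (domain l) φ) (hc : Continuous c) (h0 : ∀ p, p ∉ tsupport φ → c p = 0) :
    Integrable (fun p => u p * c p) := by
  obtain ⟨M, hM⟩ := hc.bounded_above_of_compact_support (HasCompactSupport.intro hφ.2.1.isCompact h0)
  exact integrable_mul_of_bounded (K := tsupport φ) hφ.2.1.isCompact.measurableSet
    (hu.integrableOn_compact_subset hφ.2.2 hφ.2.1.isCompact) hc.measurable hM h0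

namespace IsWeakSolution

lemma locallyIntegrableOn_stress (hsol : IsWeakSolution l h ζ η₀ η₀x v₀ η ηt ηx ηtx F D) :
    LocallyIntegrableOn (fun p => ηtx p + ηx p) (domain l) :=
  hsol.weakDeriv_tx.2.1.add hsol.weakDeriv_x.2.1

/-- For `φ = χ(t) ψ(x - g(t))` one has `∂ₜφ = χ' ψ - g' ∂ₓφ`. As `g'` depends on time only, the weak
space derivative of `ηt` turns the last contribution into a term with `ηtx` and the undifferentiated
`ψ`, removing the factor `ψ'` of size `1/δ`. -/
lemma force_eq_of_smooth_curve (hsol : IsWeakSolution l h ζ η₀ η₀x v₀ η ηt ηx ηtx F D)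
    {χ ψ g : ℝ → ℝ} (hχ : ContDiff ℝ ∞ χ) (hψ : ContDiff ℝ ∞ ψ) (hg : ContDiff ℝ ∞ g)
    (hφ : IsTestFunction (domain l) (fun p => χ p.1 * ψ (p.2 - g p.1))) :
    ∫ p, χ p.1 * ψ (p.2 - g p.1) ∂F
      = (∫ p in domain l, (ηtx p + ηx p) * (χ p.1 * deriv ψ (p.2 - g p.1)))
        - (∫ p in domain l, ηt p * (deriv χ p.1 * ψ (p.2 - g p.1)))
        - ∫ p in domain l, ηtx p * (χ p.1 * deriv g p.1 * ψ (p.2 - g p.1)) := by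
  set φ : ℝ × ℝ → ℝ := fun p => χ p.1 * ψ (p.2 - g p.1) with hφdef
  have hχ' : ∀ t, HasDerivAt χ (deriv χ t) t := fun t => (hχ.differentiable (by simp) t).hasDerivAt
  have hψ' : ∀ t, HasDerivAt ψ (deriv ψ t) t := fun t => (hψ.differentiable (by simp) t).hasDerivAt
  have hg' : ∀ t, HasDerivAt g (deriv g t) t := fun t => (hg.differentiable (by simp) t).hasDerivAt
  have hχc : Continuous (deriv χ) := hχ.continuous_deriv (by simp)
  have hψc : Continuous (deriv ψ) := hψ.continuous_deriv (by simp)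
  have hgs : ContDiff ℝ ∞ (deriv g) := (contDiff_infty_iff_deriv.1 hg).2
  have hgc : Continuous (deriv g) := hgs.continuous
  have hdx : ∀ p, fderiv ℝ φ p (0, 1) = χ p.1 * deriv ψ (p.2 - g p.1) := fun p => by
    refine fderiv_apply_zero_one hφ.1 ?_
    exact ((hψ' _).comp_sub_const p.2 (g p.1)).const_mul (χ p.1)
  have hdt : ∀ p, fderiv ℝ φ p (1, 0)
      = deriv χ p.1 * ψ (p.2 - g p.1) - deriv g p.1 * (χ p.1 * deriv ψ (p.2 - g p.1)) := fun p => by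
    refine fderiv_apply_one_zero hφ.1 ?_
    have h1 : HasDerivAt (fun s => p.2 - g s) (-deriv g p.1) p.1 := (hg' p.1).const_sub p.2
    have h2 := (hχ' p.1).mul ((hψ' (p.2 - g p.1)).comp p.1 h1)
    refine h2.congr_deriv ?_
    simp only [Function.comp]
    ring
  have hφ0 : ∀ p, p ∉ tsupport φ → φ p = 0 := fun p hp => image_eq_zero_of_notMem_tsupport hp
  have hd0 : ∀ e p, p ∉ tsupport φ → fderiv ℝ φ p e = 0 := fun e p hp => by
    rw [image_eq_zero_of_notMem_tsupport (f := fderiv ℝ φ)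
      fun h' => hp (tsupport_fderiv_subset ℝ h')]
    rfl
  have hc1 : Continuous fun p : ℝ × ℝ => χ p.1 * deriv ψ (p.2 - g p.1) := by
    have := hχ.continuous; have := hg.continuous; fun_prop
  have hc2 : Continuous fun p : ℝ × ℝ => deriv χ p.1 * ψ (p.2 - g p.1) := by
    have := hψ.continuous; have := hg.continuous; fun_prop
  have h01 : ∀ p, p ∉ tsupport φ → χ p.1 * deriv ψ (p.2 - g p.1) = 0 := fun p hp => by
    rw [← hdx, hd0 _ p hp]
  -- Only the product `φ` is known to have compact support in the domain, so the vanishing of `χ' ψ`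
  -- is read off from that of `∂ₜφ` and `∂ₓφ`.
  have h02 : ∀ p, p ∉ tsupport φ → deriv χ p.1 * ψ (p.2 - g p.1) = 0 := fun p hp => by
    have := hdt p
    rw [hd0 _ p hp, h01 p hp] at this
    linarith
  have hmom := hsol.momentum φ ⟨hφ.1, hφ.2.1, hφ.2.2.trans (prod_mono (subset_univ _) le_rfl)⟩
  have hinit : ∫ x in Ioo 0 l, v₀ x * φ (0, x) = 0 := by
    have : ∀ x, v₀ x * φ (0, x) = 0 := fun x => by
      rw [hφ0 (0, x) (fun h' => lt_irrefl (0 : ℝ) (hφ.2.2 h').1), mul_zero]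
    simp [this]
  have hφ2 : IsTestFunction (domain l) (fun p => deriv g p.1 * φ p) :=
    isTestFunction_of_support (hgs.fst'.mul hφ.1) hφ.2.1.isCompact hφ.2.2 fun p hp => by
      rw [hφ0 p hp, mul_zero]
  have hw := hsol.weakDeriv_tx.2.2 _ hφ2
  have hdx2 : ∀ p, fderiv ℝ (fun p => deriv g p.1 * φ p) p (0, 1)
      = deriv g p.1 * (χ p.1 * deriv ψ (p.2 - g p.1)) := fun p => by
    refine fderiv_apply_zero_one hφ2.1 ?_
    exact (((hψ' _).comp_sub_const p.2 (g p.1)).const_mul (χ p.1)).const_mul (deriv g p.1)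
  simp only [dt, dx, hdx, hdt, hinit, hdx2] at hmom hw
  have i1 := integrable_mul_of_tsupport hsol.weakDeriv_t.2.1 hφ hc2 h02
  have i2 := integrable_mul_of_tsupport hsol.weakDeriv_t.2.1 hφ
    (c := fun p => deriv g p.1 * (χ p.1 * deriv ψ (p.2 - g p.1)))
    ((hgc.comp continuous_fst).mul hc1) (fun p hp => by rw [h01 p hp, mul_zero])
  have i3 := integrable_mul_of_tsupport hsol.weakDeriv_tx.2.1 hφ hc1 h01
  have i4 := integrable_mul_of_tsupport hsol.weakDeriv_x.2.1 hφ hc1 h01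
  have e1 : ∫ p in domain l, ηt p * (deriv χ p.1 * ψ (p.2 - g p.1)
        - deriv g p.1 * (χ p.1 * deriv ψ (p.2 - g p.1)))
      = (∫ p in domain l, ηt p * (deriv χ p.1 * ψ (p.2 - g p.1)))
        - ∫ p in domain l, ηt p * (deriv g p.1 * (χ p.1 * deriv ψ (p.2 - g p.1))) := by
    rw [← integral_sub i1.integrableOn i2.integrableOn]
    simp_rw [mul_sub]
  have e2 : ∫ p in domain l, (ηtx p + ηx p) * (χ p.1 * deriv ψ (p.2 - g p.1))
      = (∫ p in domain l, ηtx p * (χ p.1 * deriv ψ (p.2 - g p.1)))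
        + ∫ p in domain l, ηx p * (χ p.1 * deriv ψ (p.2 - g p.1)) := by
    rw [← integral_add i3.integrableOn i4.integrableOn]
    simp_rw [add_mul]
  have e3 : ∫ p in domain l, ηtx p * (χ p.1 * deriv g p.1 * ψ (p.2 - g p.1))
      = ∫ p in domain l, ηtx p * (deriv g p.1 * φ p) := by
    refine integral_congr_ae (Eventually.of_forall fun p => ?_)
    simp only [hφdef]
    ring
  have e4 : ∫ p, χ p.1 * ψ (p.2 - g p.1) ∂F = ∫ p, φ p ∂F := rfl
  rw [e1] at hmom
  rw [e2, e3, e4]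
  linarith

end IsWeakSolution

/-- Every time slice of the band around the curve has length `2d`, whatever `g` is. -/
lemma integrable_band {k g : ℝ → ℝ} {d : ℝ} (hk : Integrable k) (hg : Continuous g) (hd : 0 ≤ d) :
    Integrable (fun p : ℝ × ℝ => k p.1 * (Icc (-d) d).indicator 1 (p.2 - g p.1)) ∧
    ∫ p : ℝ × ℝ, k p.1 * (Icc (-d) d).indicator 1 (p.2 - g p.1) = 2 * d * ∫ t, k t := by
  have hind : Measurable ((Icc (-d) d).indicator (1 : ℝ → ℝ)) :=
    measurable_one.indicator measurableSet_Icc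
  have hii : Integrable ((Icc (-d) d).indicator (1 : ℝ → ℝ)) :=
    (integrable_indicator_iff measurableSet_Icc).2 (by
      rw [show (1 : ℝ → ℝ) = fun _ => (1 : ℝ) from rfl, integrableOn_const_iff]
      right; simp)
  have hval : ∫ x : ℝ, (Icc (-d) d).indicator (1 : ℝ → ℝ) x = 2 * d := by
    rw [integral_indicator_one measurableSet_Icc, measureReal_def, Real.volume_Icc,
      ENNReal.toReal_ofReal (by linarith)]
    ring
  have hslice : ∀ t : ℝ, ∫ x, k t * (Icc (-d) d).indicator 1 (x - g t) = k t * (2 * d) := fun t => by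
    rw [integral_const_mul, integral_sub_right_eq_self (fun x => (Icc (-d) d).indicator (1 : ℝ → ℝ) x),
      hval]
  have hm : AEStronglyMeasurable (fun p : ℝ × ℝ => k p.1 * (Icc (-d) d).indicator 1 (p.2 - g p.1))
      ((volume : Measure ℝ).prod volume) := by
    refine (hk.aestronglyMeasurable.comp_fst).mul ?_
    exact (hind.comp (measurable_snd.sub (hg.measurable.comp measurable_fst))).aestronglyMeasurable
  have hint : Integrable (fun p : ℝ × ℝ => k p.1 * (Icc (-d) d).indicator 1 (p.2 - g p.1))
      ((volume : Measure ℝ).prod volume) := by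
    rw [integrable_prod_iff hm]
    refine ⟨Eventually.of_forall fun t => (hii.comp_sub_right (g t)).const_mul (k t), ?_⟩
    refine (hk.norm.mul_const (2 * d)).congr (Eventually.of_forall fun t => ?_)
    simp only [norm_mul]
    rw [integral_const_mul]
    congr 1
    rw [← hval, ← integral_sub_right_eq_self (fun x => (Icc (-d) d).indicator (1 : ℝ → ℝ) x) (g t)]
    refine integral_congr_ae (Eventually.of_forall fun x => ?_)
    exact (Real.norm_of_nonneg (indicator_nonneg (fun _ _ => zero_le_one) _)).symm
  refine ⟨hint, ?_⟩
  rw [Measure.volume_eq_prod, integral_prod _ hint]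
  simp only [hslice, integral_mul_const]
  ring

namespace IsWeakSolution

/-- Quantitative form of the momentum equation near a smooth curve. -/
lemma exists_force_estimate (hsol : IsWeakSolution l h ζ η₀ η₀x v₀ η ηt ηx ηtx F D) :
    ∃ C, 0 ≤ C ∧ ∀ (χ ψ g : ℝ → ℝ) (d G p q : ℝ), ContDiff ℝ ∞ χ → ContDiff ℝ ∞ ψ → ContDiff ℝ ∞ g →
      0 < d → (∀ t, |χ t| ≤ 1) → (∀ t, t ∉ Icc p q → χ t = 0) → ∫ t, |deriv χ t| ≤ 2 →
      (∀ y, |ψ y| ≤ 1) → (∀ y, y ∉ Icc (-d) d → ψ y = 0) → ∫ t in Icc p q, deriv g t ^ 2 ≤ G →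
      IsTestFunction (domain l) (fun p => χ p.1 * ψ (p.2 - g p.1)) →
      |(∫ p, χ p.1 * ψ (p.2 - g p.1) ∂F)
        - ∫ p in domain l, (ηtx p + ηx p) * (χ p.1 * deriv ψ (p.2 - g p.1))|
        ≤ (C + G) * √d := by
  obtain ⟨C, hC0, hC⟩ := hsol.bound_t.exists_integral_sq_le
  have hN0 : 0 ≤ ∫ p in domain l, ηtx p ^ 2 := integral_nonneg fun p => sq_nonneg _
  -- The summand `C + 2` pays for the cutoff term, `C` being the squared bound of `ηt` in `L^∞ L²`
  -- and 2 the bound on `∫ |χ'|`. The integral of `ηtx²`, together with `G`, pays for the slope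
  -- term.
  refine ⟨C + 2 + ∫ p in domain l, ηtx p ^ 2, by positivity, ?_⟩
  intro χ ψ g d G p q hχ hψ hg hd hχ1 hχ0 hχd hψ1 hψ0 hG hφ
  have hr : 0 < √d := Real.sqrt_pos.2 hd
  have hrd : √d * √d = d := Real.mul_self_sqrt hd.le
  have hχc : Continuous (deriv χ) := hχ.continuous_deriv (by simp)
  have hgc : Continuous (deriv g) := hg.continuous_deriv (by simp)
  have hχs : HasCompactSupport χ := HasCompactSupport.intro isCompact_Icc hχ0
  have hχi : Integrable (fun t => |deriv χ t|) :=
    (hχc.integrable_of_hasCompactSupport hχs.deriv).abs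
  -- The weight `√d` balances the two errors: `a²` has an integral of order 1, while `b²` lives on
  -- the band and has an integral of order `d`.
  have amgm : ∀ a b : ℝ, |a * b| ≤ √d / 2 * a ^ 2 + 1 / (2 * √d) * b ^ 2 := fun a b => by
    have h1 : √d / 2 * a ^ 2 + 1 / (2 * √d) * b ^ 2 - |a * b|
        = 1 / (2 * √d) * (√d * |a| - |b|) ^ 2 := by
      rw [abs_mul, sub_sq, mul_pow, sq_abs, sq_abs]
      field_simp
      ring
    have h2 : 0 ≤ 1 / (2 * √d) * (√d * |a| - |b|) ^ 2 := by positivity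
    linarith
  have hψsq : ∀ y, ψ y ^ 2 ≤ (Icc (-d) d).indicator 1 y := fun y => by
    by_cases hy : y ∈ Icc (-d) d
    · rw [indicator_of_mem hy, Pi.one_apply, ← sq_abs]
      exact pow_le_one₀ (abs_nonneg _) (hψ1 y)
    · rw [indicator_of_notMem hy, hψ0 y hy]; norm_num
  -- the term containing the time derivative of the cutoff
  have E1 : |∫ p in domain l, ηt p * (deriv χ p.1 * ψ (p.2 - g p.1))| ≤ (C + 2) * √d := by
    obtain ⟨b1, b2⟩ := integrable_band hχi hg.continuous hd.le
    obtain ⟨M, hM⟩ := exists_abs_le_of_hasCompactSupport hχc hχs.deriv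
    have a1 : IntegrableOn (fun p => ηt p ^ 2 * |deriv χ p.1|) (domain l) :=
      (hsol.memLp_t.integrable_sq).mul_bdd (c := M)
        (hχc.abs.comp continuous_fst).aestronglyMeasurable
        (Eventually.of_forall fun p => by simpa using hM p.1)
    have a2 : ∫ p in domain l, ηt p ^ 2 * |deriv χ p.1| ≤ C * 2 := by
      have a1' := a1
      rw [IntegrableOn, domain, Measure.volume_eq_prod, ← Measure.prod_restrict] at a1'
      rw [domain, Measure.volume_eq_prod, ← Measure.prod_restrict, integral_prod _ a1']
      calc _ ≤ ∫ t in Ioi (0 : ℝ), C * |deriv χ t| := by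
            refine integral_mono_ae a1'.integral_prod_left (hχi.const_mul C).integrableOn ?_
            filter_upwards [hC] with t ht
            rw [integral_mul_const]
            exact mul_le_mul_of_nonneg_right ht.2 (abs_nonneg _)
        _ = C * ∫ t in Ioi (0 : ℝ), |deriv χ t| := integral_const_mul _ _
        _ ≤ C * ∫ t, |deriv χ t| := by
            refine mul_le_mul_of_nonneg_left (setIntegral_le_integral hχi
              (Eventually.of_forall fun t => abs_nonneg _)) hC0
        _ ≤ _ := mul_le_mul_of_nonneg_left hχd hC0
    have a3 : ∫ p in domain l, |deriv χ p.1| * (Icc (-d) d).indicator 1 (p.2 - g p.1)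
        ≤ 2 * d * 2 := by
      calc _ ≤ ∫ p : ℝ × ℝ, |deriv χ p.1| * (Icc (-d) d).indicator 1 (p.2 - g p.1) :=
            setIntegral_le_integral b1 (Eventually.of_forall fun p =>
              mul_nonneg (abs_nonneg _) (indicator_nonneg (fun _ _ => zero_le_one) _))
        _ = 2 * d * ∫ t, |deriv χ t| := b2
        _ ≤ _ := mul_le_mul_of_nonneg_left hχd (by positivity)
    calc _ ≤ ∫ p in domain l, (√d / 2 * (ηt p ^ 2 * |deriv χ p.1|)
          + 1 / (2 * √d) * (|deriv χ p.1| * (Icc (-d) d).indicator 1 (p.2 - g p.1))) := by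
          rw [← Real.norm_eq_abs]
          refine norm_integral_le_of_norm_le ((a1.const_mul _).add (b1.integrableOn.const_mul _))
            (Eventually.of_forall fun p => ?_)
          have h1 := mul_le_mul_of_nonneg_left (amgm (ηt p) (ψ (p.2 - g p.1)))
            (abs_nonneg (deriv χ p.1))
          have h2 : 1 / (2 * √d) * (|deriv χ p.1| * ψ (p.2 - g p.1) ^ 2) ≤ 1 / (2 * √d) *
              (|deriv χ p.1| * (Icc (-d) d).indicator 1 (p.2 - g p.1)) := by
            gcongr
            exact hψsq _
          rw [Real.norm_eq_abs, show ηt p * (deriv χ p.1 * ψ (p.2 - g p.1))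
            = deriv χ p.1 * (ηt p * ψ (p.2 - g p.1)) by ring, abs_mul]
          linarith
      _ = √d / 2 * (∫ p in domain l, ηt p ^ 2 * |deriv χ p.1|) + 1 / (2 * √d) *
          ∫ p in domain l, |deriv χ p.1| * (Icc (-d) d).indicator 1 (p.2 - g p.1) := by
          rw [integral_add (a1.const_mul _) (b1.integrableOn.const_mul _), integral_const_mul,
            integral_const_mul]
      _ ≤ √d / 2 * (C * 2) + 1 / (2 * √d) * (2 * d * 2) := by gcongr
      _ = (C + 2) * √d := by
          field_simp
          rw [Real.sq_sqrt hd.le]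
          ring
  -- the term containing the slope of the curve
  have E2 : |∫ p in domain l, ηtx p * (χ p.1 * deriv g p.1 * ψ (p.2 - g p.1))|
      ≤ ((∫ p in domain l, ηtx p ^ 2) + G) * √d := by
    have hk : Integrable ((Icc p q).indicator fun t => deriv g t ^ 2) :=
      (integrable_indicator_iff measurableSet_Icc).2
        ((hgc.pow 2).continuousOn.integrableOn_compact isCompact_Icc)
    obtain ⟨b1, b2⟩ := integrable_band hk hg.continuous hd.le
    have a1 : IntegrableOn (fun p => ηtx p ^ 2) (domain l) := hsol.memLp_tx.integrable_sq
    have hknn : ∀ t, 0 ≤ (Icc p q).indicator (fun t => deriv g t ^ 2) t := fun t =>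
      indicator_nonneg (fun _ _ => sq_nonneg _) _
    have a3 : ∫ z in domain l, (Icc p q).indicator (fun t => deriv g t ^ 2) z.1
        * (Icc (-d) d).indicator 1 (z.2 - g z.1) ≤ 2 * d * G := by
      calc _ ≤ ∫ z : ℝ × ℝ, (Icc p q).indicator (fun t => deriv g t ^ 2) z.1
              * (Icc (-d) d).indicator 1 (z.2 - g z.1) :=
            setIntegral_le_integral b1 (Eventually.of_forall fun z =>
              mul_nonneg (hknn _) (indicator_nonneg (fun _ _ => zero_le_one) _))
        _ = 2 * d * ∫ t in Icc p q, deriv g t ^ 2 := by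
            rw [b2, integral_indicator measurableSet_Icc]
        _ ≤ _ := by gcongr
    calc _ ≤ ∫ z in domain l, (√d / 2 * ηtx z ^ 2 + 1 / (2 * √d) *
          ((Icc p q).indicator (fun t => deriv g t ^ 2) z.1
            * (Icc (-d) d).indicator 1 (z.2 - g z.1))) := by
          rw [← Real.norm_eq_abs]
          refine norm_integral_le_of_norm_le ((a1.const_mul _).add (b1.integrableOn.const_mul _))
            (Eventually.of_forall fun z => ?_)
          refine (amgm _ _).trans ?_
          gcongr
          rw [mul_pow, mul_pow]
          refine mul_le_mul ?_ (hψsq _) (sq_nonneg _) (hknn _)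
          by_cases hz : z.1 ∈ Icc p q
          · rw [indicator_of_mem hz]
            refine mul_le_of_le_one_left (sq_nonneg _) ?_
            rw [← sq_abs]
            exact pow_le_one₀ (abs_nonneg _) (hχ1 _)
          · rw [indicator_of_notMem hz, hχ0 _ hz]; norm_num
      _ = √d / 2 * (∫ p in domain l, ηtx p ^ 2) + 1 / (2 * √d) *
          ∫ z in domain l, (Icc p q).indicator (fun t => deriv g t ^ 2) z.1
            * (Icc (-d) d).indicator 1 (z.2 - g z.1) := by
          rw [integral_add (a1.const_mul _) (b1.integrableOn.const_mul _), integral_const_mul,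
            integral_const_mul]
      _ ≤ √d / 2 * (∫ p in domain l, ηtx p ^ 2) + 1 / (2 * √d) * (2 * d * G) := by gcongr
      _ = √d / 2 * (∫ p in domain l, ηtx p ^ 2) + G * √d := by
          congr 1
          field_simp
          rw [Real.sq_sqrt hd.le]
      _ ≤ _ := by nlinarith
  rw [hsol.force_eq_of_smooth_curve hχ hψ hg hφ]
  rw [show ∀ a b c : ℝ, a - b - c - a = -(b + c) from fun a b c => by ring, abs_neg]
  refine (abs_add_le _ _).trans ((add_le_add E1 E2).trans (le_of_eq ?_))
  ring

end IsWeakSolution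

end ViscoString

namespace ViscoString

/-! ### Smooth approximation of Sobolev curves -/

lemma integral_sq_le_of_eLpNorm_le {E : Type*} [MeasurableSpace E] {μ : Measure E} {u : E → ℝ}
    {c : ℝ} (hc : 0 ≤ c) (hm : AEStronglyMeasurable u μ) (hu : eLpNorm u 2 μ ≤ ENNReal.ofReal c) :
    ∫ x, u x ^ 2 ∂μ ≤ c ^ 2 := by
  rw [integral_eq_lintegral_of_nonneg_ae (Eventually.of_forall fun x => sq_nonneg _) (hm.pow 2)]
  have h1 : ∫⁻ x, ENNReal.ofReal (u x ^ 2) ∂μ = eLpNorm u 2 μ ^ 2 := by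
    have := eLpNorm_nnreal_pow_eq_lintegral (p := 2) (f := u) (μ := μ) two_ne_zero
    simp only [ENNReal.coe_ofNat, NNReal.coe_ofNat, ENNReal.rpow_ofNat] at this
    rw [this]
    refine lintegral_congr fun x => ?_
    rw [← sq_abs, ENNReal.ofReal_pow (abs_nonneg _), Real.enorm_eq_ofReal_abs]
  rw [h1]
  have h2 : eLpNorm u 2 μ ^ 2 ≤ ENNReal.ofReal c ^ 2 := by gcongr
  calc _ ≤ (ENNReal.ofReal c ^ 2).toReal := ENNReal.toReal_mono (by simp) h2
    _ = _ := by rw [ENNReal.toReal_pow, ENNReal.toReal_ofReal hc]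

/-- Cauchy–Schwarz against the constant 1, from `0 ≤ ∫ (|u| - c)²` at the optimal `c`, the mean of
`|u|`. -/
lemma integral_abs_sq_le {E : Type*} [MeasurableSpace E] {μ : Measure E} [IsFiniteMeasure μ]
    {u : E → ℝ} (hu : MemLp u 2 μ) : (∫ x, |u x| ∂μ) ^ 2 ≤ μ.real univ * ∫ x, u x ^ 2 ∂μ := by
  have hi : Integrable (fun x => |u x|) μ := (hu.integrable one_le_two).abs
  set I := ∫ x, |u x| ∂μ with hI
  have key : ∀ c : ℝ, 0 ≤ (∫ x, u x ^ 2 ∂μ) - 2 * c * I + c ^ 2 * μ.real univ := fun c => by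
    have h1 : 0 ≤ ∫ x, (|u x| - c) ^ 2 ∂μ := integral_nonneg fun x => sq_nonneg _
    have h2 : ∀ x, (|u x| - c) ^ 2 = u x ^ 2 - 2 * c * |u x| + c ^ 2 := fun x => by
      rw [sub_sq, sq_abs]; ring
    simp_rw [h2] at h1
    have h3 : Integrable (fun x => u x ^ 2 - 2 * c * |u x|) μ := hu.integrable_sq.sub (hi.const_mul _)
    rw [integral_add h3 (integrable_const _), integral_sub hu.integrable_sq (hi.const_mul _),
      integral_const_mul, integral_const, smul_eq_mul] at h1
    linarith
  rcases eq_or_ne (μ.real univ) 0 with h0 | h0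
  · have : μ = 0 := by
      rw [measureReal_def, ENNReal.toReal_eq_zero_iff] at h0
      exact Measure.measure_univ_eq_zero.1 (h0.resolve_right (measure_ne_top _ _))
    simp [hI, this]
  · have hpos : 0 < μ.real univ := lt_of_le_of_ne measureReal_nonneg (Ne.symm h0)
    have h1 := key (I / μ.real univ)
    have h2 : 2 * (I / μ.real univ) * I - (I / μ.real univ) ^ 2 * μ.real univ
        = I ^ 2 / μ.real univ := by
      field_simp; ring
    have h3 : I ^ 2 / μ.real univ ≤ ∫ x, u x ^ 2 ∂μ := by linarith
    rwa [div_le_iff₀ hpos, mul_comm] at h3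

/-- The continuous extension of `f : [a,b] → ℝ` that is constant on either side of `[a,b]`. -/
noncomputable def constExtension (a b : ℝ) (f : ℝ → ℝ) (t : ℝ) : ℝ := f (max a (min b t))

lemma constExtension_continuous {a b : ℝ} {f : ℝ → ℝ} (hab : a ≤ b)
    (hf : ContinuousOn f (Icc a b)) : Continuous (constExtension a b f) :=
  hf.comp_continuous (by fun_prop) fun _ => ⟨le_max_left _ _, max_le hab (min_le_left _ _)⟩

lemma constExtension_eq {a b : ℝ} {f : ℝ → ℝ} {t : ℝ} (ht : t ∈ Icc a b) :
    constExtension a b f t = f t := by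
  rw [constExtension, min_eq_right ht.2, max_eq_right ht.1]

lemma constExtension_mem {a b : ℝ} {f : ℝ → ℝ} (hab : a ≤ b) {s : Set ℝ}
    (hs : ∀ t ∈ Icc a b, f t ∈ s) (t : ℝ) : constExtension a b f t ∈ s :=
  hs _ ⟨le_max_left _ _, max_le hab (min_le_left _ _)⟩

/-- The derivative, extended by zero, is approximated in `L²` by smooth `v n`, and `g n` is the
primitive of `v n` that equals `f a` at `a`. The primitive of the extended derivative is
`constExtension`. Cauchy–Schwarz on `[a-1, b+1]`, of length `b - a + 2`, makes the convergence
uniform. The unit margins accommodate smoothed windows that overshoot `[a,b]`. -/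
lemma IsSobolevH1.exists_smooth_approx {a b : ℝ} {f f' : ℝ → ℝ} (hab : a < b)
    (hf : IsSobolevH1 a b f f') :
    ∃ G, 0 ≤ G ∧ ∃ g : ℕ → ℝ → ℝ, ∀ n, ContDiff ℝ ∞ (g n) ∧
      (∀ t ∈ Icc (a - 1) (b + 1),
        |g n t - constExtension a b f t| ≤ √(b - a + 2) * (1 / ((n : ℝ) + 1))) ∧
      ∫ t in Icc (a - 1) (b + 1), deriv (g n) t ^ 2 ≤ G := by
  set w : ℝ → ℝ := (Ioo a b).indicator f' with hw
  have hwL : MemLp w 2 := (memLp_indicator_iff_restrict measurableSet_Ioo).2 hf.memLp_deriv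
  have hchoose : ∀ n : ℕ, ∃ v : ℝ → ℝ, HasCompactSupport v ∧ ContDiff ℝ ∞ v ∧
      eLpNorm (w - v) 2 volume ≤ ENNReal.ofReal (1 / ((n : ℝ) + 1)) := fun n =>
    hwL.exist_eLpNorm_sub_le (by simp) one_le_two (by positivity)
  choose v hvc hvs hv using hchoose
  have hvL : ∀ n, MemLp (v n) 2 := fun n => (hvs n).continuous.memLp_of_hasCompactSupport (hvc n)
  have hdL : ∀ n, MemLp (w - v n) 2 := fun n => hwL.sub (hvL n)
  have hsq : ∀ n, ∫ t, (w t - v n t) ^ 2 ≤ (1 / ((n : ℝ) + 1)) ^ 2 := fun n =>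
    integral_sq_le_of_eLpNorm_le (by positivity) (hdL n).1 (hv n)
  have hwloc : LocallyIntegrable w := hwL.locallyIntegrable one_le_two
  have hwi : ∀ p q, IntervalIntegrable w volume p q := fun p q =>
    (hwloc.integrableOn_isCompact isCompact_uIcc).intervalIntegrable
  have hvi : ∀ n p q, IntervalIntegrable (v n) volume p q := fun n p q =>
    (hvs n).continuous.intervalIntegrable p q
  have hext : ∀ t, constExtension a b f t = f a + ∫ y in a..t, w y := by
    intro t
    have hval : ∀ r ∈ Icc a b, ∫ y in a..r, w y = f r - f a := by
      intro r hr
      rw [hf.sub_eq_integral hab hr, intervalIntegral.integral_of_le hr.1,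
        intervalIntegral.integral_of_le hr.1, integral_Ioc_eq_integral_Ioo,
        integral_Ioc_eq_integral_Ioo]
      refine setIntegral_congr_fun measurableSet_Ioo fun y hy => ?_
      exact indicator_of_mem (s := Ioo a b) ⟨hy.1, hy.2.trans_le hr.2⟩ f'
    have hzero : ∀ p q, p ≤ q → (q ≤ a ∨ b ≤ p) → ∫ y in p..q, w y = 0 := by
      intro p q hpq h
      rw [intervalIntegral.integral_of_le hpq, integral_Ioc_eq_integral_Ioo]
      refine (setIntegral_congr_fun measurableSet_Ioo (g := fun _ => (0 : ℝ)) fun y hy => ?_).trans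
        (by simp)
      refine indicator_of_notMem (fun hy' => ?_) _
      rcases h with h | h
      · linarith [hy.2, hy'.1]
      · linarith [hy.1, hy'.2]
    rcases le_total t a with h | h
    · rw [intervalIntegral.integral_symm, hzero t a h (Or.inl le_rfl), constExtension,
        min_eq_right (h.trans hab.le), max_eq_left h]
      simp
    · rcases le_total t b with h' | h'
      · rw [constExtension_eq ⟨h, h'⟩, hval t ⟨h, h'⟩]; ring
      · rw [← intervalIntegral.integral_add_adjacent_intervals (hwi a b) (hwi b t),
          hzero b t h' (Or.inr le_rfl), hval b ⟨hab.le, le_rfl⟩, constExtension, min_eq_left h',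
          max_eq_right hab.le]
        ring
  have hfin : IsFiniteMeasure ((volume : Measure ℝ).restrict (Icc (a - 1) (b + 1))) :=
    isFiniteMeasure_restrict.2 isCompact_Icc.measure_ne_top
  have hvol : ((volume : Measure ℝ).restrict (Icc (a - 1) (b + 1))).real univ = b - a + 2 := by
    rw [measureReal_restrict_apply_univ, measureReal_def, Real.volume_Icc,
      ENNReal.toReal_ofReal (by linarith)]
    ring
  have hl1 : ∀ n, ∫ t in Icc (a - 1) (b + 1), |w t - v n t| ≤ √(b - a + 2) * (1 / ((n : ℝ) + 1)) := by
    intro n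
    have h1 := integral_abs_sq_le ((hdL n).restrict (Icc (a - 1) (b + 1)))
    rw [hvol] at h1
    have h2 : ∫ t in Icc (a - 1) (b + 1), (w - v n) t ^ 2 ≤ (1 / ((n : ℝ) + 1)) ^ 2 :=
      (setIntegral_le_integral (hdL n).integrable_sq
        (Eventually.of_forall fun t => sq_nonneg _)).trans (hsq n)
    refine abs_le_of_sq_le_sq' ?_ (by positivity) |>.2
    rw [mul_pow, Real.sq_sqrt (by linarith)]
    exact h1.trans (mul_le_mul_of_nonneg_left h2 (by linarith))
  -- The bound comes from `v² ≤ 2w² + 2(w - v)²`, where the error has squared norm at most 1.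
  refine ⟨2 * (∫ t, w t ^ 2) + 2, by have : 0 ≤ ∫ t, w t ^ 2 := integral_nonneg fun t => sq_nonneg _
                                     positivity, fun n t => f a + ∫ y in a..t, v n y, fun n => ?_⟩
  have hderiv : ∀ t, HasDerivAt (fun t => f a + ∫ y in a..t, v n y) (v n t) t := fun t =>
    ((hvs n).continuous.integral_hasStrictDerivAt a t).hasDerivAt.const_add _
  have hdeq : deriv (fun t => f a + ∫ y in a..t, v n y) = v n := funext fun t => (hderiv t).deriv
  refine ⟨?_, fun t ht => ?_, ?_⟩
  · rw [contDiff_infty_iff_deriv, hdeq]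
    exact ⟨fun t => (hderiv t).differentiableAt, hvs n⟩
  · rw [hext]
    have h1 : f a + (∫ y in a..t, v n y) - (f a + ∫ y in a..t, w y) = ∫ y in a..t, (v n y - w y) := by
      rw [intervalIntegral.integral_sub (hvi n a t) (hwi a t)]; ring
    rw [h1, ← Real.norm_eq_abs]
    refine (intervalIntegral.norm_integral_le_integral_norm_uIoc).trans (le_trans ?_ (hl1 n))
    simp_rw [Real.norm_eq_abs, abs_sub_comm (v n _)]
    refine setIntegral_mono_set ((hdL n).restrict _ |>.integrable one_le_two).abs
      (Eventually.of_forall fun t => abs_nonneg _) ?_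
    refine (show uIoc a t ⊆ Icc (a - 1) (b + 1) from ?_).eventuallyLE
    intro y hy
    rw [uIoc, mem_Ioc] at hy
    refine ⟨?_, hy.2.trans (max_le (by linarith) ht.2)⟩
    exact (le_min (by linarith) ht.1).trans hy.1.le
  · rw [hdeq]
    have h1 : ∫ t in Icc (a - 1) (b + 1), v n t ^ 2 ≤ ∫ t, v n t ^ 2 :=
      setIntegral_le_integral (hvL n).integrable_sq (Eventually.of_forall fun t => sq_nonneg _)
    have h2 : ∫ t, v n t ^ 2 ≤ ∫ t, (2 * w t ^ 2 + 2 * (w t - v n t) ^ 2) := by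
      refine integral_mono (hvL n).integrable_sq
        ((hwL.integrable_sq.const_mul 2).add ((hdL n).integrable_sq.const_mul 2)) fun t => ?_
      nlinarith [sq_nonneg (2 * w t - v n t)]
    have h3 := integral_add (hwL.integrable_sq.const_mul 2) ((hdL n).integrable_sq.const_mul 2)
    simp only [Pi.sub_apply] at h3
    rw [h3, integral_const_mul, integral_const_mul] at h2
    have h4 : (1 / ((n : ℝ) + 1)) ^ 2 ≤ 1 := by
      refine pow_le_one₀ (by positivity) ?_
      rw [div_le_one (by positivity)]
      linarith [n.cast_nonneg (α := ℝ)]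
    linarith [hsq n]

/-! ### Integrals over strips along a curve -/

/-- The points above `[a,b]` between the graphs of `p` and `q`. -/
def strip (a b : ℝ) (p q : ℝ → ℝ) : Set (ℝ × ℝ) :=
  {z | z.1 ∈ Icc a b ∧ p z.1 < z.2 ∧ z.2 ≤ q z.1}

lemma measurableSet_strip {a b : ℝ} {p q : ℝ → ℝ} (hp : Measurable p) (hq : Measurable q) :
    MeasurableSet (strip a b p q) :=
  (measurable_fst measurableSet_Icc).inter
    ((measurableSet_lt (hp.comp measurable_fst) measurable_snd).inter
      (measurableSet_le measurable_snd (hq.comp measurable_fst)))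

lemma strip_subset {a b c d : ℝ} {p q : ℝ → ℝ} (hc : ∀ t ∈ Icc a b, c ≤ p t)
    (hd : ∀ t ∈ Icc a b, q t ≤ d) : strip a b p q ⊆ Icc a b ×ˢ Icc c d := fun _ hz =>
  mk_mem_prod hz.1 ⟨(hc _ hz.1).trans hz.2.1.le, hz.2.2.trans (hd _ hz.1)⟩

lemma setIntegral_strip {l a b c d : ℝ} {p q : ℝ → ℝ} {u : ℝ × ℝ → ℝ}
    (hu : LocallyIntegrableOn u (domain l)) (ha : 0 < a) (hab : a ≤ b) (hc0 : 0 < c) (hdl : d < l)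
    (hp : Measurable p) (hq : Measurable q) (hpq : ∀ t ∈ Icc a b, p t ≤ q t)
    (hc : ∀ t ∈ Icc a b, c ≤ p t) (hd : ∀ t ∈ Icc a b, q t ≤ d) :
    IntegrableOn u (strip a b p q) ∧
      ∫ z in strip a b p q, u z = ∫ t in a..b, ∫ x in (p t)..(q t), u (t, x) := by
  have hm := measurableSet_strip (a := a) (b := b) hp hq
  have hi : IntegrableOn u (strip a b p q) :=
    (hu.integrableOn_compact_subset (Set.prod_mono (fun t ht => ha.trans_le ht.1)
      fun x hx => ⟨hc0.trans_le hx.1, hx.2.trans_lt hdl⟩) (isCompact_Icc.prod isCompact_Icc)).mono_set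
      (strip_subset hc hd)
  refine ⟨hi, ?_⟩
  have hi' := (integrable_indicator_iff hm).2 hi
  rw [← integral_indicator hm, Measure.volume_eq_prod, integral_prod _ hi',
    intervalIntegral.integral_of_le hab, ← integral_Icc_eq_integral_Ioc,
    ← integral_indicator measurableSet_Icc]
  refine integral_congr_ae (Eventually.of_forall fun t => ?_)
  by_cases ht : t ∈ Icc a b
  · simp only [ht, indicator_of_mem]
    rw [intervalIntegral.integral_of_le (hpq t ht), ← integral_indicator measurableSet_Ioc]
    refine integral_congr_ae (Eventually.of_forall fun x => ?_)
    beta_reduce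
    by_cases hx : x ∈ Ioc (p t) (q t)
    · rw [indicator_of_mem hx, indicator_of_mem (show (t, x) ∈ strip a b p q from ⟨ht, hx⟩)]
    · rw [indicator_of_notMem hx,
        indicator_of_notMem (show (t, x) ∉ strip a b p q from fun h => hx h.2)]
  · have : ∀ x, (strip a b p q).indicator u (t, x) = 0 := fun x =>
      indicator_of_notMem (fun h => ht h.1) _
    simp [this, ht]

/-- The half-open intervals match the convention chosen at the corners, so no point has to be
excluded. -/
lemma tentDeriv_eq_indicator {δ : ℝ} (hδ : 0 < δ) (c x : ℝ) :
    tentDeriv δ (x - c)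
      = 1 / δ * ((Ioc (c - δ) c).indicator 1 x - (Ioc c (c + δ)).indicator 1 x) := by
  rw [tentDeriv]
  simp only [indicator_apply, mem_Ioi, mem_Ioc, Pi.one_apply]
  have : ∀ p q : ℝ, p = q → p / δ = 1 / δ * q := fun p q h => by rw [h]; ring
  apply this
  split_ifs <;> first | (exfalso; grind) | norm_num

end ViscoString

namespace ViscoString

/-! ### The contact force on a curve -/

lemma integral_deriv_stepApprox_sub (n : ℕ) (c : ℝ) :
    Integrable (fun t => deriv (stepApprox n) (t - c)) ∧
      ∫ t, deriv (stepApprox n) (t - c) = 1 := by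
  have hN : 0 < 1 / ((n : ℝ) + 1) := by positivity
  have h0 : ∀ t, t ∉ Icc (0 : ℝ) (1 / ((n : ℝ) + 1)) → deriv (stepApprox n) t = 0 := fun t ht => by
    rcases lt_or_ge t 0 with h | h
    · exact deriv_stepApprox_of_neg n h
    · exact deriv_stepApprox_of_gt n (lt_of_not_ge fun h' => ht ⟨h, h'⟩)
  have hi : Integrable (deriv (stepApprox n)) :=
    (deriv_stepApprox_continuous n).integrable_of_hasCompactSupport
      (HasCompactSupport.intro isCompact_Icc h0)
  refine ⟨hi.comp_sub_right c, ?_⟩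
  rw [integral_sub_right_eq_self (fun t => deriv (stepApprox n) t),
    ← setIntegral_eq_integral_of_forall_compl_eq_zero (s := Icc 0 (1 / ((n : ℝ) + 1))) h0,
    integral_Icc_eq_integral_Ioc, ← intervalIntegral.integral_of_le hN.le, integral_deriv_stepApprox,
    stepApprox_of_le n le_rfl, stepApprox_of_nonpos n le_rfl, sub_zero]

/-- Each of the two edges has total variation 1, independently of `n`; this uniformity allows the
limit in the smoothing. -/
lemma integral_abs_deriv_windowApprox_le (n : ℕ) (a b : ℝ) :
    ∫ t, |deriv (windowApprox n a b) t| ≤ 2 := by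
  obtain ⟨i1, e1⟩ := integral_deriv_stepApprox_sub n (a - 1 / ((n : ℝ) + 1))
  obtain ⟨i2, e2⟩ := integral_deriv_stepApprox_sub n b
  calc _ ≤ ∫ t, (deriv (stepApprox n) (t - (a - 1 / ((n : ℝ) + 1)))
        + deriv (stepApprox n) (t - b)) := by
        refine integral_mono_of_nonneg (Eventually.of_forall fun t => abs_nonneg _) (i1.add i2)
          (Eventually.of_forall fun t => ?_)
        beta_reduce
        rw [(windowApprox_hasDerivAt n a b t).deriv]
        have h1 := deriv_stepApprox_nonneg n (t - (a - 1 / ((n : ℝ) + 1)))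
        have h2 := deriv_stepApprox_nonneg n (t - b)
        rw [abs_le]; constructor <;> linarith
    _ = 2 := by rw [integral_add i1 i2, e1, e2]; norm_num

/-- Translates of the graph of `g` are Lebesgue null, so the corner lines of a tent along a curve
can be ignored in integrals of the stress. -/
lemma ae_sub_ne {g : ℝ → ℝ} (hg : Measurable g) (c : ℝ) :
    ∀ᵐ p : ℝ × ℝ, p.2 - g p.1 ≠ c := by
  have hs : MeasurableSet {p : ℝ × ℝ | p.2 - g p.1 = c} :=
    measurableSet_eq_fun (measurable_snd.sub (hg.comp measurable_fst)) measurable_const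
  have h0 : volume {p : ℝ × ℝ | p.2 - g p.1 = c} = 0 := by
    rw [Measure.volume_eq_prod, Measure.measure_prod_null hs]
    refine Eventually.of_forall fun t => ?_
    have : Prod.mk t ⁻¹' {p : ℝ × ℝ | p.2 - g p.1 = c} = {c + g t} := by
      ext x
      simp only [mem_preimage, mem_ofPred_eq, mem_singleton_iff]
      exact sub_eq_iff_eq_add
    simp [this]
  exact measure_eq_zero_iff_ae_notMem.1 h0

/-- Compactness of the graph gives the margin. Four units are reserved: the tent's half-width, its
smoothing layer, the error of the approximating curve, and a remaining distance to the boundary. -/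
lemma exists_room {l a b : ℝ} {f : ℝ → ℝ} (hab : a ≤ b) (hf : ContinuousOn f (Icc a b))
    (hΓ : ∀ t ∈ Icc a b, (t, f t) ∈ domain l) :
    ∃ ρ > 0, ρ ≤ 1 ∧ 4 * ρ < a ∧ ∀ t ∈ Icc a b, f t ∈ Ioo (4 * ρ) (l - 4 * ρ) := by
  have hne : (Icc a b).Nonempty := nonempty_Icc.2 hab
  obtain ⟨t₁, h₁, hmin⟩ := isCompact_Icc.exists_isMinOn hne hf
  obtain ⟨t₂, h₂, hmax⟩ := isCompact_Icc.exists_isMaxOn hne hf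
  have ha : 0 < a := (hΓ a ⟨le_rfl, hab⟩).1
  have hm : 0 < f t₁ := (hΓ t₁ h₁).2.1
  have hM : f t₂ < l := (hΓ t₂ h₂).2.2
  set ρ := min (min 1 (a / 8)) (min (f t₁ / 8) ((l - f t₂) / 8)) with hρ
  have e1 : ρ ≤ 1 := (min_le_left _ _).trans (min_le_left _ _)
  have e2 : ρ ≤ a / 8 := (min_le_left _ _).trans (min_le_right _ _)
  have e3 : ρ ≤ f t₁ / 8 := (min_le_right _ _).trans (min_le_left _ _)
  have e4 : ρ ≤ (l - f t₂) / 8 := (min_le_right _ _).trans (min_le_right _ _)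
  have e0 : 0 < ρ := lt_min (lt_min one_pos (by linarith)) (lt_min (by linarith) (by linarith))
  refine ⟨ρ, e0, e1, by linarith, fun t ht => ⟨?_, ?_⟩⟩
  · have : f t₁ ≤ f t := hmin ht
    linarith
  · have : f t ≤ f t₂ := hmax ht
    linarith

variable {l h : ℝ} {ζ : ℝ × ℝ → ℝ} {η₀ η₀x v₀ : ℝ → ℝ} {η ηt ηx ηtx : ℝ × ℝ → ℝ}
  {F D : Measure (ℝ × ℝ)}

namespace IsWeakSolution

/-- The limit `n → ∞` of `exists_force_estimate` at fixed `δ`. The constant survives because the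
variation of the windows and the `L²` norms of the slopes are bounded uniformly in `n`. -/
lemma exists_tent_estimate (hsol : IsWeakSolution l h ζ η₀ η₀x v₀ η ηt ηx ηtx F D)
    {a b ρ : ℝ} {f f' : ℝ → ℝ} (hab : a < b) (hf : IsSobolevH1 a b f f') (hρ : 0 < ρ) (hρ1 : ρ ≤ 1)
    (hρa : 4 * ρ < a) (hρf : ∀ t ∈ Icc a b, f t ∈ Ioo (4 * ρ) (l - 4 * ρ)) :
    ∃ C, ∀ δ, 0 < δ → δ ≤ ρ →
      |(∫ p, (Icc a b).indicator 1 p.1 * tent δ (p.2 - constExtension a b f p.1) ∂F)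
        - ∫ p in domain l, (ηtx p + ηx p) *
          ((Icc a b).indicator 1 p.1 * tentDeriv δ (p.2 - constExtension a b f p.1))| ≤ C * √δ := by
  have := hsol.force_locallyFinite
  obtain ⟨C, hC0, hC⟩ := hsol.exists_force_estimate
  obtain ⟨G, hG0, g, hg⟩ := hf.exists_smooth_approx hab
  set fc := constExtension a b f with hfc
  have hfcc : Continuous fc := constExtension_continuous hab.le hf.continuousOn
  have hfcm : ∀ t, fc t ∈ Ioo (4 * ρ) (l - 4 * ρ) := constExtension_mem hab.le hρf
  -- For large `n` the smoothed tent is supported in `[-δ, δ + 1/(n+1)] ⊆ [-2δ, 2δ]`, so the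
  -- estimate is used with `d = 2δ`.
  refine ⟨(C + G) * √2, fun δ hδ hδρ => ?_⟩
  set K : Set (ℝ × ℝ) := Icc (a - ρ) (b + ρ) ×ˢ Icc ρ (l - ρ) with hK
  have hKc : IsCompact K := isCompact_Icc.prod isCompact_Icc
  have hKd : K ⊆ domain l := Set.prod_mono (fun t ht => by have := ht.1; simp only [mem_Ioi]; linarith)
    fun x hx => ⟨by linarith [hx.1], by linarith [hx.2]⟩
  have hgt : ∀ t ∈ Icc (a - 1) (b + 1), Tendsto (fun n => g n t) atTop (𝓝 (fc t)) := by
    intro t ht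
    rw [tendsto_iff_norm_sub_tendsto_zero]
    refine squeeze_zero (fun n => norm_nonneg _) (fun n => (hg n).2.1 t ht) ?_
    simpa using tendsto_one_div_succ.const_mul √(b - a + 2)
  have hev : ∀ᶠ n : ℕ in atTop, 1 / ((n : ℝ) + 1) < δ ∧
      √(b - a + 2) * (1 / ((n : ℝ) + 1)) < ρ := by
    refine (tendsto_one_div_succ.eventually (Iio_mem_nhds hδ)).and ?_
    have : Tendsto (fun n : ℕ => √(b - a + 2) * (1 / ((n : ℝ) + 1))) atTop (𝓝 0) := by
      simpa using tendsto_one_div_succ.const_mul √(b - a + 2)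
    exact this.eventually (Iio_mem_nhds hρ)
  have hN1 : ∀ n : ℕ, 1 / ((n : ℝ) + 1) ≤ 1 := fun n => by
    rw [div_le_one (by positivity)]; linarith [n.cast_nonneg (α := ℝ)]
  have hw0 : ∀ n t, t ∉ Icc (a - 1) (b + 1) → windowApprox n a b t = 0 := fun n t ht =>
    windowApprox_eq_zero n hab.le fun h' => ht ⟨by linarith [h'.1, hN1 n], by linarith [h'.2, hN1 n]⟩
  have hw1 : ∀ n t, |windowApprox n a b t| ≤ 1 := fun n t => by
    have := windowApprox_mem n hab.le t
    rw [abs_of_nonneg this.1]; exact this.2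
  -- supports
  have hsupp : ∀ᶠ n : ℕ in atTop, ∀ ψ : ℝ → ℝ, (∀ y ≤ -δ, ψ y = 0) →
      (∀ y, δ + 1 / ((n : ℝ) + 1) ≤ y → ψ y = 0) → ∀ p : ℝ × ℝ, p ∉ K →
      windowApprox n a b p.1 * ψ (p.2 - g n p.1) = 0 := by
    filter_upwards [hev] with n hn ψ hψ1 hψ2 p hp
    by_cases ht : p.1 ∈ Icc (a - 1 / ((n : ℝ) + 1)) (b + 1 / ((n : ℝ) + 1))
    · have ht1 : p.1 ∈ Icc (a - 1) (b + 1) := ⟨by linarith [ht.1, hN1 n], by linarith [ht.2, hN1 n]⟩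
      have hgp := abs_le.1 ((hg n).2.1 p.1 ht1)
      have hfp := hfcm p.1
      rcases le_or_gt (p.2 - g n p.1) (-δ) with h1 | h1
      · rw [hψ1 _ h1, mul_zero]
      · rcases le_or_gt (δ + 1 / ((n : ℝ) + 1)) (p.2 - g n p.1) with h2 | h2
        · rw [hψ2 _ h2, mul_zero]
        · exfalso
          refine hp (mk_mem_prod ⟨by linarith [ht.1], by linarith [ht.2]⟩ ⟨?_, ?_⟩)
          · linarith [hgp.1, hgp.2, hfp.1, hfp.2]
          · linarith [hgp.1, hgp.2, hfp.1, hfp.2]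
    · rw [windowApprox_eq_zero n hab.le ht, zero_mul]
  have hL : Tendsto (fun n => ∫ p, windowApprox n a b p.1 * tentApprox n δ (p.2 - g n p.1) ∂F) atTop
      (𝓝 (∫ p, (Icc a b).indicator 1 p.1 * tent δ (p.2 - fc p.1) ∂F)) := by
    have h1 := tendsto_integral_mul (μ := F) (u := fun _ => 1) (K := K) (M := 1) (l := atTop)
      (C := fun n p => windowApprox n a b p.1 * tentApprox n δ (p.2 - g n p.1))
      (c := fun p => (Icc a b).indicator 1 p.1 * tent δ (p.2 - fc p.1)) hKc.measurableSet
      (continuousOn_const.integrableOn_compact hKc) ?_ ?_ ?_ ?_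
    · simpa using h1
    · refine Eventually.of_forall fun n => ?_
      have c1 := (windowApprox_contDiff n a b).continuous
      have c2 := (tentApprox_contDiff n δ).continuous
      have c3 := (hg n).1.continuous
      exact Continuous.measurable (by fun_prop)
    · refine Eventually.of_forall fun n p => ?_
      rw [abs_mul]
      refine mul_le_one₀ (hw1 _ _) (abs_nonneg _) ?_
      rw [abs_of_nonneg (tentApprox_nonneg n hδ _)]
      exact tentApprox_le_one n hδ _
    · filter_upwards [hsupp] with n hn
      exact hn _ (fun y hy => tentApprox_of_lt n hδ hy) fun y hy => tentApprox_of_gt n hδ hy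
    · refine Eventually.of_forall fun p => ?_
      by_cases ht : p.1 ∈ Icc (a - 1) (b + 1)
      · exact (windowApprox_tendsto hab.le p.1).mul (tentApprox_tendsto ((hgt p.1 ht).const_sub p.2))
      · rw [indicator_of_notMem (fun h' => ht ⟨by linarith [h'.1], by linarith [h'.2]⟩), zero_mul]
        refine tendsto_const_nhds.congr fun n => ?_
        rw [hw0 n _ ht, zero_mul]
  have hR : Tendsto (fun n => ∫ p in domain l, (ηtx p + ηx p) *
        (windowApprox n a b p.1 * deriv (tentApprox n δ) (p.2 - g n p.1))) atTop
      (𝓝 (∫ p in domain l, (ηtx p + ηx p) *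
        ((Icc a b).indicator 1 p.1 * tentDeriv δ (p.2 - fc p.1)))) := by
    have hdt : ∀ n y, deriv (tentApprox n δ) y = tentApproxDeriv n δ y := fun n y =>
      (tentApprox_hasDerivAt n δ y).deriv
    simp only [hdt]
    refine tendsto_setIntegral_mul (M := 1 * (2 / δ)) hKc.measurableSet
      (hsol.locallyIntegrableOn_stress.integrableOn_compact_subset hKd hKc) ?_ ?_ ?_ ?_
    · refine Eventually.of_forall fun n => ?_
      have c1 := (windowApprox_contDiff n a b).continuous
      have c2 := tentApproxDeriv_continuous n δ
      have c3 := (hg n).1.continuous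
      exact Continuous.measurable (by fun_prop)
    · refine Eventually.of_forall fun n p => ?_
      rw [abs_mul]
      exact mul_le_mul (hw1 _ _) (abs_tentApproxDeriv_le n hδ _) (abs_nonneg _) zero_le_one
    · filter_upwards [hsupp] with n hn
      exact hn _ (fun y hy => tentApproxDeriv_of_lt n hδ hy) fun y hy => tentApproxDeriv_of_gt n hδ hy
    -- Since the curve varies with `n`, the derivatives of the tents may fail to converge on the
    -- three corner lines, which are null for Lebesgue measure.
    · filter_upwards [ae_sub_ne hfcc.measurable 0, ae_sub_ne hfcc.measurable δ,
        ae_sub_ne hfcc.measurable (-δ)] with p h0 h1 h2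
      by_cases ht : p.1 ∈ Icc (a - 1) (b + 1)
      · exact (windowApprox_tendsto hab.le p.1).mul
          (tentApproxDeriv_tendsto_of_ne h0 h1 h2 ((hgt p.1 ht).const_sub p.2))
      · rw [indicator_of_notMem (fun h' => ht ⟨by linarith [h'.1], by linarith [h'.2]⟩), zero_mul]
        refine tendsto_const_nhds.congr fun n => ?_
        rw [hw0 n _ ht, zero_mul]
  refine le_of_tendsto (hL.sub hR).abs ?_
  filter_upwards [hev, hsupp] with n hn hs
  have hsmooth : ContDiff ℝ ∞ fun p : ℝ × ℝ =>
      windowApprox n a b p.1 * tentApprox n δ (p.2 - g n p.1) :=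
    (windowApprox_contDiff n a b).fst'.mul
      ((tentApprox_contDiff n δ).comp (contDiff_snd.sub (hg n).1.fst'))
  have := hC (windowApprox n a b) (tentApprox n δ) (g n) (2 * δ) G (a - 1) (b + 1)
    (windowApprox_contDiff n a b) (tentApprox_contDiff n δ) (hg n).1 (by positivity) (hw1 n) (hw0 n)
    (integral_abs_deriv_windowApprox_le n a b)
    (fun y => by
      rw [abs_of_nonneg (tentApprox_nonneg n hδ _)]
      exact tentApprox_le_one n hδ _)
    (fun y hy => by
      rcases le_or_gt y (-δ) with h1 | h1
      · exact tentApprox_of_lt n hδ h1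
      · refine tentApprox_of_gt n hδ (le_of_not_gt fun h2 => hy ⟨by linarith, by linarith [hn.1]⟩))
    (hg n).2.2
    (isTestFunction_of_support hsmooth hKc hKd
      (hs _ (fun y hy => tentApprox_of_lt n hδ hy) fun y hy => tentApprox_of_gt n hδ hy))
  refine this.trans (le_of_eq ?_)
  rw [Real.sqrt_mul (by norm_num), mul_assoc]

/-- The tent has slope `1/δ` below the curve and `-1/δ` above it; this is the origin of the two
strips and of the leading minus sign. -/
lemma tentDeriv_stress_integral (hsol : IsWeakSolution l h ζ η₀ η₀x v₀ η ηt ηx ηtx F D)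
    {a b ρ δ : ℝ} {f : ℝ → ℝ} (hab : a < b) (hf : ContinuousOn f (Icc a b)) (hρ : 0 < ρ)
    (hρa : 4 * ρ < a) (hρf : ∀ t ∈ Icc a b, f t ∈ Ioo (4 * ρ) (l - 4 * ρ)) (hδ : 0 < δ) (hδρ : δ ≤ ρ) :
    ∫ p in domain l, (ηtx p + ηx p) *
          ((Icc a b).indicator 1 p.1 * tentDeriv δ (p.2 - constExtension a b f p.1))
      = -(1 / δ * ((∫ t in a..b, ∫ x in (f t)..(f t + δ), ηx (t, x))
            - (∫ t in a..b, ∫ x in (f t - δ)..(f t), ηx (t, x))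
            + (∫ t in a..b, ∫ x in (f t)..(f t + δ), ηtx (t, x))
            - (∫ t in a..b, ∫ x in (f t - δ)..(f t), ηtx (t, x)))) := by
  set fc := constExtension a b f with hfc
  have hfcc : Continuous fc := constExtension_continuous hab.le hf
  have hfcm : ∀ t, fc t ∈ Ioo (4 * ρ) (l - 4 * ρ) := constExtension_mem hab.le hρf
  set S₁ := strip a b (fun t => fc t - δ) fc with hS₁
  set S₂ := strip a b fc (fun t => fc t + δ) with hS₂
  have m₁ : MeasurableSet S₁ := measurableSet_strip (hfcc.sub continuous_const).measurable hfcc.measurable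
  have m₂ : MeasurableSet S₂ := measurableSet_strip hfcc.measurable (hfcc.add continuous_const).measurable
  have b₁ : S₁ ⊆ domain l := (strip_subset (c := ρ) (d := l - ρ)
    (fun t _ => by linarith [(hfcm t).1]) (fun t _ => by linarith [(hfcm t).2])).trans
    (Set.prod_mono (fun t ht => by have := ht.1; simp only [mem_Ioi]; linarith)
      fun x hx => ⟨by linarith [hx.1], by linarith [hx.2]⟩)
  have b₂ : S₂ ⊆ domain l := (strip_subset (c := ρ) (d := l - ρ)
    (fun t _ => by linarith [(hfcm t).1]) (fun t _ => by linarith [(hfcm t).2])).trans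
    (Set.prod_mono (fun t ht => by have := ht.1; simp only [mem_Ioi]; linarith)
      fun x hx => ⟨by linarith [hx.1], by linarith [hx.2]⟩)
  have s₁ : ∀ {u : ℝ × ℝ → ℝ}, LocallyIntegrableOn u (domain l) → IntegrableOn u S₁ ∧
      ∫ z in S₁, u z = ∫ t in a..b, ∫ x in (f t - δ)..(f t), u (t, x) := by
    intro u hu
    obtain ⟨h1, h2⟩ := setIntegral_strip (a := a) (b := b) (c := ρ) (d := l - ρ)
      (p := fun t => fc t - δ) (q := fc) hu (by linarith) hab.le hρ (by linarith)
      (hfcc.sub continuous_const).measurable hfcc.measurable (fun t _ => by linarith)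
      (fun t _ => by linarith [(hfcm t).1]) (fun t _ => by linarith [(hfcm t).2])
    refine ⟨h1, h2.trans (intervalIntegral.integral_congr fun t ht => ?_)⟩
    rw [uIcc_of_le hab.le] at ht
    simp only [hfc, constExtension_eq ht]
  have s₂ : ∀ {u : ℝ × ℝ → ℝ}, LocallyIntegrableOn u (domain l) → IntegrableOn u S₂ ∧
      ∫ z in S₂, u z = ∫ t in a..b, ∫ x in (f t)..(f t + δ), u (t, x) := by
    intro u hu
    obtain ⟨h1, h2⟩ := setIntegral_strip (a := a) (b := b) (c := ρ) (d := l - ρ)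
      (p := fc) (q := fun t => fc t + δ) hu (by linarith) hab.le hρ (by linarith)
      hfcc.measurable (hfcc.add continuous_const).measurable (fun t _ => by linarith)
      (fun t _ => by linarith [(hfcm t).1]) (fun t _ => by linarith [(hfcm t).2])
    refine ⟨h1, h2.trans (intervalIntegral.integral_congr fun t ht => ?_)⟩
    rw [uIcc_of_le hab.le] at ht
    simp only [hfc, constExtension_eq ht]
  obtain ⟨ix₁, ex₁⟩ := s₁ hsol.weakDeriv_x.2.1
  obtain ⟨ix₂, ex₂⟩ := s₂ hsol.weakDeriv_x.2.1
  obtain ⟨it₁, et₁⟩ := s₁ hsol.weakDeriv_tx.2.1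
  obtain ⟨it₂, et₂⟩ := s₂ hsol.weakDeriv_tx.2.1
  have hpt : ∀ p : ℝ × ℝ, (ηtx p + ηx p) * ((Icc a b).indicator 1 p.1 * tentDeriv δ (p.2 - fc p.1))
      = 1 / δ * (S₁.indicator (fun p => ηtx p + ηx p) p - S₂.indicator (fun p => ηtx p + ηx p) p) := by
    intro p
    rw [tentDeriv_eq_indicator hδ]
    have e1 : S₁.indicator (fun p => ηtx p + ηx p) p = (ηtx p + ηx p) *
        ((Icc a b).indicator 1 p.1 * (Ioc (fc p.1 - δ) (fc p.1)).indicator 1 p.2) := by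
      by_cases h1 : p.1 ∈ Icc a b
      · by_cases h2 : p.2 ∈ Ioc (fc p.1 - δ) (fc p.1)
        · rw [indicator_of_mem (show p ∈ S₁ from ⟨h1, h2⟩), indicator_of_mem h1, indicator_of_mem h2]
          simp
        · rw [indicator_of_notMem (show p ∉ S₁ from fun h => h2 h.2), indicator_of_notMem h2]
          simp
      · rw [indicator_of_notMem (show p ∉ S₁ from fun h => h1 h.1), indicator_of_notMem h1]
        simp
    have e2 : S₂.indicator (fun p => ηtx p + ηx p) p = (ηtx p + ηx p) *
        ((Icc a b).indicator 1 p.1 * (Ioc (fc p.1) (fc p.1 + δ)).indicator 1 p.2) := by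
      by_cases h1 : p.1 ∈ Icc a b
      · by_cases h2 : p.2 ∈ Ioc (fc p.1) (fc p.1 + δ)
        · rw [indicator_of_mem (show p ∈ S₂ from ⟨h1, h2⟩), indicator_of_mem h1, indicator_of_mem h2]
          simp
        · rw [indicator_of_notMem (show p ∉ S₂ from fun h => h2 h.2), indicator_of_notMem h2]
          simp
      · rw [indicator_of_notMem (show p ∉ S₂ from fun h => h1 h.1), indicator_of_notMem h1]
        simp
    rw [e1, e2]
    ring
  have I₁ : Integrable (S₁.indicator fun p => ηtx p + ηx p) :=
    (integrable_indicator_iff m₁).2 (it₁.add ix₁)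
  have I₂ : Integrable (S₂.indicator fun p => ηtx p + ηx p) :=
    (integrable_indicator_iff m₂).2 (it₂.add ix₂)
  simp_rw [hpt]
  rw [integral_const_mul, integral_sub I₁.integrableOn I₂.integrableOn, setIntegral_indicator m₁,
    setIntegral_indicator m₂, inter_eq_self_of_subset_right b₁, inter_eq_self_of_subset_right b₂,
    integral_add it₁ ix₁, integral_add it₂ ix₂, ex₁, ex₂, et₁, et₂]
  ring

/-- A tent equals 1 on the curve and 0 at distance at least `δ` from it, so the weights tend at
every point to the indicator of the graph. For `δ < 1` they are dominated on one compact set, of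
finite mass. -/
lemma tendsto_tent_force (hsol : IsWeakSolution l h ζ η₀ η₀x v₀ η ηt ηx ηtx F D)
    {a b : ℝ} {f : ℝ → ℝ} (hab : a < b) (hf : ContinuousOn f (Icc a b)) :
    Tendsto (fun δ => ∫ p, (Icc a b).indicator 1 p.1 * tent δ (p.2 - constExtension a b f p.1) ∂F)
      (𝓝[>] 0) (𝓝 (F ((fun t => (t, f t)) '' Icc a b)).toReal) := by
  have := hsol.force_locallyFinite
  set fc := constExtension a b f with hfc
  have hfcc : Continuous fc := constExtension_continuous hab.le hf
  set Γ := (fun t => (t, f t)) '' Icc a b with hΓ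
  have hΓ' : ∀ p : ℝ × ℝ, p ∈ Γ ↔ p.1 ∈ Icc a b ∧ p.2 - fc p.1 = 0 := by
    intro p
    constructor
    · rintro ⟨t, ht, rfl⟩
      exact ⟨ht, by simp [hfc, constExtension_eq ht]⟩
    · rintro ⟨h1, h2⟩
      refine ⟨p.1, h1, Prod.ext rfl ?_⟩
      rw [hfc, constExtension_eq h1] at h2
      simp only
      linarith
  have hΓm : MeasurableSet Γ := by
    have : Γ = {p : ℝ × ℝ | p.1 ∈ Icc a b ∧ p.2 - fc p.1 = 0} := Set.ext hΓ'
    rw [this]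
    exact (measurable_fst measurableSet_Icc).inter (measurableSet_eq_fun
      (measurable_snd.sub (hfcc.measurable.comp measurable_fst)) measurable_const)
  obtain ⟨m, hm⟩ := (isCompact_Icc.image_of_continuousOn hf).bddBelow
  obtain ⟨M, hM⟩ := (isCompact_Icc.image_of_continuousOn hf).bddAbove
  set K : Set (ℝ × ℝ) := Icc a b ×ˢ Icc (m - 1) (M + 1) with hK
  have hKc : IsCompact K := isCompact_Icc.prod isCompact_Icc
  have h1 := tendsto_integral_mul (μ := F) (u := fun _ => 1) (K := K) (M := 1) (l := 𝓝[>] (0 : ℝ))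
    (C := fun δ p => (Icc a b).indicator 1 p.1 * tent δ (p.2 - fc p.1))
    (c := fun p => Γ.indicator 1 p) hKc.measurableSet
    (continuousOn_const.integrableOn_compact hKc) ?_ ?_ ?_ ?_
  · simp only [one_mul] at h1
    rwa [show (fun p => Γ.indicator (1 : ℝ × ℝ → ℝ) p) = Γ.indicator 1 from rfl,
      integral_indicator_one hΓm] at h1
  · refine Eventually.of_forall fun δ => ?_
    exact ((measurable_one.indicator measurableSet_Icc).comp measurable_fst).mul
      ((tent_continuous δ).measurable.comp (measurable_snd.sub (hfcc.measurable.comp measurable_fst)))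
  · filter_upwards [self_mem_nhdsWithin] with δ hδ p
    rw [abs_mul, abs_of_nonneg (tent_nonneg hδ _)]
    refine mul_le_one₀ ?_ (tent_nonneg hδ _) (tent_le_one hδ _)
    by_cases hp : p.1 ∈ Icc a b <;> simp [hp]
  · filter_upwards [Ioo_mem_nhdsGT one_pos] with δ hδ p hp
    by_cases h1 : p.1 ∈ Icc a b
    · have e1 : m ≤ fc p.1 := by
        rw [hfc, constExtension_eq h1]; exact hm (mem_image_of_mem f h1)
      have e2 : fc p.1 ≤ M := by
        rw [hfc, constExtension_eq h1]; exact hM (mem_image_of_mem f h1)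
      rw [tent_of_le_abs hδ.1, mul_zero]
      by_contra h2
      have h3 := abs_lt.1 (not_le.1 h2)
      exact hp (mk_mem_prod h1 ⟨by linarith [h3.1, hδ.2], by linarith [h3.2, hδ.2]⟩)
    · rw [indicator_of_notMem h1, zero_mul]
  · refine Eventually.of_forall fun p => tendsto_const_nhds.congr' ?_
    by_cases h1 : p.1 ∈ Icc a b
    · by_cases h2 : p.2 - fc p.1 = 0
      · filter_upwards [self_mem_nhdsWithin] with δ hδ
        rw [indicator_of_mem ((hΓ' p).2 ⟨h1, h2⟩), indicator_of_mem h1, h2, tent_zero hδ]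
        simp
      · filter_upwards [Ioo_mem_nhdsGT (abs_pos.2 h2)] with δ hδ
        rw [indicator_of_notMem (fun h' => h2 ((hΓ' p).1 h').2), tent_of_le_abs hδ.1 hδ.2.le,
          mul_zero]
    · filter_upwards with δ
      rw [indicator_of_notMem (fun h' => h1 ((hΓ' p).1 h').1), indicator_of_notMem h1, zero_mul]

/-- The contact force on the graph of a Sobolev curve is the jump of the stress across it. -/
lemma force_curve_tendsto (hsol : IsWeakSolution l h ζ η₀ η₀x v₀ η ηt ηx ηtx F D)
    {a b : ℝ} {f f' : ℝ → ℝ} (hab : a < b) (hf : IsSobolevH1 a b f f')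
    (hΓ : ∀ t ∈ Icc a b, (t, f t) ∈ domain l) :
    Tendsto (fun δ : ℝ =>
          -(1 / δ * ((∫ t in a..b, ∫ x in (f t)..(f t + δ), ηx (t, x))
            - (∫ t in a..b, ∫ x in (f t - δ)..(f t), ηx (t, x))
            + (∫ t in a..b, ∫ x in (f t)..(f t + δ), ηtx (t, x))
            - (∫ t in a..b, ∫ x in (f t - δ)..(f t), ηtx (t, x)))))
        (𝓝[>] 0) (𝓝 (F ((fun t => (t, f t)) '' Icc a b)).toReal) := by
  obtain ⟨ρ, hρ, hρ1, hρa, hρf⟩ := exists_room hab.le hf.continuousOn hΓ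
  obtain ⟨C, hC⟩ := hsol.exists_tent_estimate hab hf hρ hρ1 hρa hρf
  have h1 := hsol.tendsto_tent_force hab hf.continuousOn
  have h2 : Tendsto (fun δ => (∫ p, (Icc a b).indicator 1 p.1 *
      tent δ (p.2 - constExtension a b f p.1) ∂F) - ∫ p in domain l, (ηtx p + ηx p) *
          ((Icc a b).indicator 1 p.1 * tentDeriv δ (p.2 - constExtension a b f p.1)))
      (𝓝[>] 0) (𝓝 0) := by
    refine squeeze_zero_norm' (a := fun δ => C * √δ) ?_ ?_
    · filter_upwards [Ioo_mem_nhdsGT hρ] with δ hδ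
      exact hC δ hδ.1 hδ.2.le
    · have : Tendsto (fun δ => C * √δ) (𝓝 0) (𝓝 (C * √0)) :=
        (Real.continuous_sqrt.const_mul C).tendsto 0
      rw [Real.sqrt_zero, mul_zero] at this
      exact this.mono_left nhdsWithin_le_nhds
  have h3 := h1.sub h2
  rw [sub_zero] at h3
  refine h3.congr' ?_
  filter_upwards [Ioo_mem_nhdsGT hρ] with δ hδ
  rw [sub_sub_cancel, hsol.tentDeriv_stress_integral hab hf.continuousOn hρ hρa hρf hδ.1 hδ.2.le]

end IsWeakSolution

end ViscoString

namespace ViscoString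

/-! ### Strips are limits of finite unions of rectangles -/

/-- The union of rectangles over an equidistant partition of `[a,b]` into `n` intervals that
approximates `strip a b p q`. -/
def stepStrip (a b : ℝ) (p q : ℝ → ℝ) (n : ℕ) : Set (ℝ × ℝ) :=
  ⋃ i ∈ Finset.range n, Ioc (a + i * ((b - a) / n)) (a + (i + 1) * ((b - a) / n)) ×ˢ
    Ioc (p (a + (i + 1) * ((b - a) / n))) (q (a + (i + 1) * ((b - a) / n)))

/-- The ceiling selects the right endpoint of the partition interval that contains `z.1`. -/
lemma mem_stepStrip_iff {a b : ℝ} (hab : a < b) {p q : ℝ → ℝ} {n : ℕ} (hn : 0 < n) {z : ℝ × ℝ} :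
    z ∈ stepStrip a b p q n ↔ z.1 ∈ Ioc a b ∧
      z.2 ∈ Ioc (p (a + ⌈(z.1 - a) / ((b - a) / n)⌉₊ * ((b - a) / n)))
        (q (a + ⌈(z.1 - a) / ((b - a) / n)⌉₊ * ((b - a) / n))) := by
  have hn' : (0 : ℝ) < n := by exact_mod_cast hn
  set d := (b - a) / n with hd
  have hd0 : 0 < d := div_pos (by linarith) hn'
  have hnd : n * d = b - a := by rw [hd]; field_simp
  have hceil : ∀ i : ℕ, z.1 ∈ Ioc (a + i * d) (a + (i + 1) * d) ↔ ⌈(z.1 - a) / d⌉₊ = i + 1 := by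
    intro i
    rw [Nat.ceil_eq_iff (by omega), mem_Ioc, lt_div_iff₀ hd0, div_le_iff₀ hd0]
    push_cast
    constructor
    · rintro ⟨h1, h2⟩; constructor <;> linarith
    · rintro ⟨h1, h2⟩; constructor <;> linarith
  simp only [stepStrip, mem_iUnion, Finset.mem_range, mem_prod, exists_prop, ← hd]
  constructor
  · rintro ⟨i, hi, h1, h2⟩
    have hi' : ((i : ℝ) + 1) ≤ n := by exact_mod_cast hi
    have e := (hceil i).1 h1
    rw [e]
    push_cast
    refine ⟨⟨?_, ?_⟩, h2⟩
    · have : 0 ≤ (i : ℝ) * d := by positivity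
      linarith [h1.1]
    · have : ((i : ℝ) + 1) * d ≤ n * d := mul_le_mul_of_nonneg_right hi' hd0.le
      linarith [h1.2]
  · rintro ⟨h1, h2⟩
    have hpos : 0 < (z.1 - a) / d := div_pos (by linarith [h1.1]) hd0
    have hc : 0 < ⌈(z.1 - a) / d⌉₊ := Nat.ceil_pos.2 hpos
    obtain ⟨i, hi⟩ : ∃ i, ⌈(z.1 - a) / d⌉₊ = i + 1 := ⟨⌈(z.1 - a) / d⌉₊ - 1, by omega⟩
    refine ⟨i, ?_, (hceil i).2 hi, ?_⟩
    · have : ⌈(z.1 - a) / d⌉₊ ≤ n := by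
        rw [Nat.ceil_le, div_le_iff₀ hd0, hnd]
        linarith [h1.2]
      omega
    · rw [hi] at h2
      push_cast at h2
      exact h2

lemma measurableSet_stepStrip (a b : ℝ) (p q : ℝ → ℝ) (n : ℕ) :
    MeasurableSet (stepStrip a b p q n) :=
  Finset.measurableSet_biUnion _ fun _ _ => measurableSet_Ioc.prod measurableSet_Ioc

/-- Reduces the sign of an integral over a curved strip to rectangles whose space interval is taken
at the final time `t`. That choice fits the application, where contact at time `t` implies contact
at the same place at earlier times. -/
lemma setIntegral_strip_nonneg {a b c d : ℝ} (hab : a < b) {p q : ℝ → ℝ} (hp : Continuous p)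
    (hq : Continuous q) (hc : ∀ t ∈ Icc a b, c ≤ p t) (hd : ∀ t ∈ Icc a b, q t ≤ d)
    {u : ℝ × ℝ → ℝ} (hu : IntegrableOn u (Icc a b ×ˢ Icc c d))
    (h : ∀ s t, a ≤ s → s < t → t ≤ b → 0 ≤ ∫ z in Ioc s t ×ˢ Ioc (p t) (q t), u z) :
    0 ≤ ∫ z in strip a b p q, u z := by
  have hsub : ∀ i n : ℕ, i < n → a ≤ a + i * ((b - a) / n) ∧
      a + i * ((b - a) / n) < a + (i + 1) * ((b - a) / n) ∧ a + (i + 1) * ((b - a) / n) ≤ b := by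
    intro i n hi
    have hn' : (0 : ℝ) < n := by exact_mod_cast (Nat.zero_le i).trans_lt hi
    have hd0 : 0 < (b - a) / n := div_pos (by linarith) hn'
    have hnd : n * ((b - a) / n) = b - a := by field_simp
    have hi' : ((i : ℝ) + 1) ≤ n := by exact_mod_cast hi
    have h1 : ((i : ℝ) + 1) * ((b - a) / n) ≤ n * ((b - a) / n) :=
      mul_le_mul_of_nonneg_right hi' hd0.le
    have h2 : 0 ≤ (i : ℝ) * ((b - a) / n) := by positivity
    exact ⟨by linarith, by linarith, by linarith⟩
  have hbox : ∀ i n : ℕ, i < n →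
      Ioc (a + i * ((b - a) / n)) (a + (i + 1) * ((b - a) / n)) ×ˢ
        Ioc (p (a + (i + 1) * ((b - a) / n))) (q (a + (i + 1) * ((b - a) / n)))
        ⊆ Icc a b ×ˢ Icc c d := by
    intro i n hi
    obtain ⟨h1, h2, h3⟩ := hsub i n hi
    have hm : a + (i + 1) * ((b - a) / n) ∈ Icc a b := ⟨by linarith, h3⟩
    exact Set.prod_mono (fun y hy => ⟨h1.trans hy.1.le, hy.2.trans h3⟩)
      fun y hy => ⟨(hc _ hm).trans hy.1.le, hy.2.trans (hd _ hm)⟩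
  have hnn : ∀ n : ℕ, 0 ≤ ∫ z in stepStrip a b p q n, u z := by
    intro n
    rw [stepStrip, integral_biUnion_finset _ (fun i _ => measurableSet_Ioc.prod measurableSet_Ioc)]
    · refine Finset.sum_nonneg fun i hi => ?_
      obtain ⟨h1, h2, h3⟩ := hsub i n (Finset.mem_range.1 hi)
      exact h _ _ h1 h2 h3
    · have key : ∀ i j : ℕ, i < j → i < n → Disjoint
          (Ioc (a + i * ((b - a) / n)) (a + (i + 1) * ((b - a) / n)) ×ˢ
            Ioc (p (a + (i + 1) * ((b - a) / n))) (q (a + (i + 1) * ((b - a) / n))))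
          (Ioc (a + j * ((b - a) / n)) (a + (j + 1) * ((b - a) / n)) ×ˢ
            Ioc (p (a + (j + 1) * ((b - a) / n))) (q (a + (j + 1) * ((b - a) / n)))) := by
        intro i j hij hin
        refine Set.disjoint_left.2 fun z hz hz' => ?_
        have hn' : (0 : ℝ) < n := by exact_mod_cast (Nat.zero_le i).trans_lt hin
        have hd0 : 0 < (b - a) / n := div_pos (by linarith) hn'
        have hij' : ((i : ℝ) + 1) ≤ j := by exact_mod_cast hij
        have h1 := mul_le_mul_of_nonneg_right hij' hd0.le
        linarith [hz.1.2, hz'.1.1]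
      intro i hi j hj hij
      rcases lt_or_gt_of_ne hij with hlt | hlt
      · exact key i j hlt (Finset.mem_range.1 hi)
      · exact (key j i hlt (Finset.mem_range.1 hj)).symm
    · intro i hi
      exact hu.mono_set (hbox i n (Finset.mem_range.1 hi))
  have hK : MeasurableSet (Icc a b ×ˢ Icc c d) := measurableSet_Icc.prod measurableSet_Icc
  have hS := measurableSet_strip (a := a) (b := b) hp.measurable hq.measurable
  have ind : ∀ S : Set (ℝ × ℝ), MeasurableSet S → ∫ z, u z * S.indicator 1 z = ∫ z in S, u z := by
    intro S hS
    rw [← integral_indicator hS]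
    refine integral_congr_ae (Eventually.of_forall fun z => ?_)
    by_cases hz : z ∈ S <;> simp [hz]
  have lim : Tendsto (fun n => ∫ z, u z * (stepStrip a b p q n).indicator 1 z) atTop
      (𝓝 (∫ z, u z * (strip a b p q).indicator 1 z)) := by
    refine tendsto_integral_mul (M := 1) hK hu
      (Eventually.of_forall fun n => measurable_one.indicator (measurableSet_stepStrip a b p q n))
      (Eventually.of_forall fun n z => ?_) (Eventually.of_forall fun n z hz => ?_) ?_
    · by_cases hz : z ∈ stepStrip a b p q n <;> simp [hz]
    · refine indicator_of_notMem (fun hz' => hz ?_) _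
      simp only [stepStrip, mem_iUnion, Finset.mem_range] at hz'
      obtain ⟨i, hi, hz'⟩ := hz'
      exact hbox i n hi hz'
    -- The half-open partition misses the line `t = a`, and on the two bounding graphs the
    -- indicators need not converge; all three sets are null.
    · have ha : ∀ᵐ z : ℝ × ℝ, z.1 ≠ a := by
        have h0 : volume ((Prod.fst : ℝ × ℝ → ℝ) ⁻¹' {a}) = 0 := by
          rw [Measure.volume_eq_prod]
          exact Measure.quasiMeasurePreserving_fst.preimage_null (by simp)
        exact measure_eq_zero_iff_ae_notMem.1 h0
      filter_upwards [ae_sub_ne hp.measurable 0, ae_sub_ne hq.measurable 0, ha] with z h1 h2 h3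
      have hτ : z.1 ∈ Ioc a b → Tendsto (fun n : ℕ => a + ⌈(z.1 - a) / ((b - a) / n)⌉₊ * ((b - a) / n))
          atTop (𝓝 z.1) := by
        intro hz
        have e1 : Tendsto (fun n : ℕ => z.1 + (b - a) / n) atTop (𝓝 z.1) := by
          simpa using (tendsto_const_div_atTop_nhds_zero_nat (b - a)).const_add z.1
        refine tendsto_of_tendsto_of_tendsto_of_le_of_le' tendsto_const_nhds e1 ?_ ?_
        · filter_upwards [eventually_gt_atTop 0] with n hn
          have hn' : (0 : ℝ) < n := by exact_mod_cast hn
          have hd0 : 0 < (b - a) / n := div_pos (by linarith) hn'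
          have := Nat.le_ceil ((z.1 - a) / ((b - a) / n))
          rw [div_le_iff₀ hd0] at this
          linarith
        · filter_upwards [eventually_gt_atTop 0] with n hn
          have hn' : (0 : ℝ) < n := by exact_mod_cast hn
          have hd0 : 0 < (b - a) / n := div_pos (by linarith) hn'
          have hnn : 0 ≤ (z.1 - a) / ((b - a) / n) := div_nonneg (by linarith [hz.1]) hd0.le
          have := (Nat.ceil_lt_add_one hnn).le
          rw [← sub_le_iff_le_add, le_div_iff₀ hd0] at this
          linarith
      refine tendsto_const_nhds.congr' ?_
      by_cases hz : z.1 ∈ Ioc a b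
      · have hpt := (hp.tendsto z.1).comp (hτ hz)
        have hqt := (hq.tendsto z.1).comp (hτ hz)
        have hzI : z.1 ∈ Icc a b := Ioc_subset_Icc_self hz
        by_cases hin : z ∈ strip a b p q
        · have hlt : p z.1 < z.2 := hin.2.1
          have hlt' : z.2 < q z.1 := lt_of_le_of_ne hin.2.2 fun h' => h2 (by linarith)
          filter_upwards [hpt.eventually (Iio_mem_nhds hlt), hqt.eventually (Ioi_mem_nhds hlt'),
            eventually_gt_atTop 0] with n e1 e2 hn
          rw [indicator_of_mem hin, indicator_of_mem ((mem_stepStrip_iff hab hn).2 ⟨hz, e1, le_of_lt e2⟩)]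
        · have hor : z.2 < p z.1 ∨ q z.1 < z.2 := by
            by_contra hcon
            push Not at hcon
            exact hin ⟨hzI, lt_of_le_of_ne hcon.1 fun h' => h1 (by linarith), hcon.2⟩
          rcases hor with hlt | hlt
          · filter_upwards [hpt.eventually (Ioi_mem_nhds hlt), eventually_gt_atTop 0] with n e1 hn
            rw [indicator_of_notMem hin, indicator_of_notMem fun h' =>
              lt_asymm ((mem_stepStrip_iff hab hn).1 h').2.1 e1]
          · filter_upwards [hqt.eventually (Iio_mem_nhds hlt), eventually_gt_atTop 0] with n e1 hn
            rw [indicator_of_notMem hin, indicator_of_notMem fun h' =>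
              not_lt_of_ge ((mem_stepStrip_iff hab hn).1 h').2.2 e1]
      · filter_upwards [eventually_gt_atTop 0] with n hn
        rw [indicator_of_notMem fun h' => hz ⟨lt_of_le_of_ne h'.1.1 (Ne.symm h3), h'.1.2⟩,
          indicator_of_notMem fun h' => hz ((mem_stepStrip_iff hab hn).1 h').1]
  rw [ind _ hS] at lim
  refine ge_of_tendsto' lim fun n => ?_
  rw [ind _ (measurableSet_stepStrip a b p q n)]
  exact hnn n

/-! ### Absence of contact force where the velocity is non-negative -/

lemma setIntegral_rectangle {l s t x y : ℝ} {u : ℝ × ℝ → ℝ} (hu : LocallyIntegrableOn u (domain l))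
    (hs : 0 < s) (hst : s ≤ t) (hx : 0 < x) (hxy : x ≤ y) (hy : y < l) :
    ∫ z in Ioc s t ×ˢ Ioc x y, u z = ∫ z in x..y, ∫ τ in s..t, u (τ, z) := by
  have hi : IntegrableOn u (Ioc s t ×ˢ Ioc x y) :=
    (hu.integrableOn_compact_subset (Set.prod_mono (fun t ht => hs.trans_le ht.1)
      fun z hz => ⟨hx.trans_le hz.1, hz.2.trans_lt hy⟩) (isCompact_Icc.prod isCompact_Icc)).mono_set
      (Set.prod_mono Ioc_subset_Icc_self Ioc_subset_Icc_self)
  rw [IntegrableOn, Measure.volume_eq_prod, ← Measure.prod_restrict] at hi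
  rw [Measure.volume_eq_prod, ← Measure.prod_restrict, integral_prod_symm _ hi,
    intervalIntegral.integral_of_le hxy]
  simp_rw [intervalIntegral.integral_of_le hst]

lemma exists_rectangle_of_mem_intNonneg {l : ℝ} {v : ℝ × ℝ → ℝ} {p : ℝ × ℝ}
    (hp : p ∈ intNonneg l v) : ∃ r > 0,
      Ioo (p.1 - r) (p.1 + r) ×ˢ Ioo (p.2 - r) (p.2 + r) ⊆ domain l ∧
      ∀ᵐ z ∂(volume.restrict (Ioo (p.1 - r) (p.1 + r) ×ˢ Ioo (p.2 - r) (p.2 + r))), 0 ≤ v z := by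
  obtain ⟨hpd, hp2⟩ := hp
  have : p ∈ ⋃₀ {O | IsOpen O ∧ O ⊆ domain l ∧ ∀ᵐ p ∂(volume.restrict O), max 0 (-v p) = 0} := by
    by_contra h'
    exact hp2 ⟨hpd, h'⟩
  obtain ⟨O, ⟨hO, hOd, hOv⟩, hpO⟩ := this
  obtain ⟨r, hr, hrO⟩ := Metric.isOpen_iff.1 hO p hpO
  have hball : Ioo (p.1 - r) (p.1 + r) ×ˢ Ioo (p.2 - r) (p.2 + r) = Metric.ball p r := by
    rw [← Real.ball_eq_Ioo, ← Real.ball_eq_Ioo, ball_prod_same]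
  refine ⟨r, hr, hball ▸ hrO.trans hOd, ?_⟩
  rw [hball]
  filter_upwards [ae_restrict_of_ae_restrict_of_subset hrO hOv] with z hz
  have := le_max_right 0 (-v z)
  linarith

variable {l h : ℝ} {ζ : ℝ × ℝ → ℝ} {η₀ η₀x v₀ : ℝ → ℝ} {η ηt ηx ηtx : ℝ × ℝ → ℝ}
  {F D : Measure (ℝ × ℝ)}

namespace IsWeakSolution

lemma eq_zero_of_mem_contactBoundary (hsol : IsWeakSolution l h ζ η₀ η₀x v₀ η ηt ηx ηtx F D)
    {p : ℝ × ℝ} (hp : p ∈ contactBoundary l η) : η p = 0 := by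
  have hc : ContinuousAt η p := hsol.continuousOn_domain.continuousAt ((isOpen_domain l).mem_nhds hp.2)
  by_contra hne
  have hev : ∀ᶠ z in 𝓝 p, η z ≠ 0 := hc.eventually_ne hne
  have hcl : p ∈ closure {p | p ∈ domain l ∧ η p = 0} := frontier_subset_closure hp.1
  obtain ⟨z, hz, hz'⟩ := (mem_closure_iff_frequently.1 hcl).and_eventually hev |>.exists
  exact hz' hz.2

/-- The points `x` where the inequality fails form a set that is open by continuity and null by the
almost everywhere formula for increments, hence empty. -/
lemma monotone_of_velocity_nonneg (hsol : IsWeakSolution l h ζ η₀ η₀x v₀ η ηt ηx ηtx F D)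
    (hl : 0 < l) {t₁ t₂ x₁ x₂ : ℝ} (hd : Ioo t₁ t₂ ×ˢ Ioo x₁ x₂ ⊆ domain l)
    (hv : ∀ᵐ z ∂(volume.restrict (Ioo t₁ t₂ ×ˢ Ioo x₁ x₂)), 0 ≤ ηt z)
    {s t x : ℝ} (hs : s ∈ Ioo t₁ t₂) (ht : t ∈ Ioo t₁ t₂) (hst : s ≤ t) (hx : x ∈ Ioo x₁ x₂) :
    η (s, x) ≤ η (t, x) := by
  have hs0 : 0 < s := (hd (mk_mem_prod hs hx)).1
  have hsub : Ioo x₁ x₂ ⊆ Ioo 0 l := fun y hy => (hd (mk_mem_prod hs hy)).2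
  have hcont : ContinuousOn (fun y => η (t, y) - η (s, y)) (Ioo x₁ x₂) :=
    (hsol.continuousOn_domain.comp (by fun_prop) fun y hy => hd (mk_mem_prod ht hy)).sub
      (hsol.continuousOn_domain.comp (by fun_prop) fun y hy => hd (mk_mem_prod hs hy))
  set B := Ioo x₁ x₂ ∩ (fun y => η (t, y) - η (s, y)) ⁻¹' Iio 0 with hB
  have hBo : IsOpen B := hcont.isOpen_inter_preimage isOpen_Ioo isOpen_Iio
  have hBn : volume B = 0 := by
    rw [Measure.volume_eq_prod, ← Measure.prod_restrict] at hv
    have hv' : ∀ᵐ y ∂(volume.restrict (Ioo x₁ x₂)), ∀ᵐ τ ∂(volume.restrict (Ioo t₁ t₂)),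
        0 ≤ ηt (τ, y) := by
      exact Measure.ae_ae_of_ae_prod ((Measure.measurePreserving_swap
        (μ := (volume : Measure ℝ).restrict (Ioo x₁ x₂))
        (ν := (volume : Measure ℝ).restrict (Ioo t₁ t₂))).quasiMeasurePreserving.ae hv)
    have h1 := ae_restrict_of_ae_restrict_of_subset hsub (hsol.sub_ae_eq_integral_of_lt hl hs0 hst)
    have h2 : ∀ᵐ y ∂(volume.restrict (Ioo x₁ x₂)), ¬ (y ∈ B) := by
      filter_upwards [hv', h1] with y hy1 hy2 hyB
      have : η (t, y) - η (s, y) < 0 := hyB.2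
      rw [hy2, intervalIntegral.integral_of_le hst] at this
      refine absurd this (not_lt.2 (integral_nonneg_of_ae ?_))
      have hsub' : Ioc s t ⊆ Ioo t₁ t₂ := fun τ hτ => ⟨hs.1.trans hτ.1, hτ.2.trans_lt ht.2⟩
      exact ae_restrict_of_ae_restrict_of_subset hsub' hy1
    rw [ae_restrict_iff' measurableSet_Ioo] at h2
    rw [measure_eq_zero_iff_ae_notMem]
    filter_upwards [h2] with y hy hyB
    exact hy hyB.1 hyB
  by_contra hlt
  have hxB : x ∈ B := ⟨hx, by simp only [mem_preimage, mem_Iio]; linarith [not_le.1 hlt]⟩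
  rw [hBo.measure_eq_zero_iff volume] at hBn
  rw [hBn] at hxB
  exact hxB

/-- A Sobolev curve of contact carries no force on a time interval near which the velocity is
non-negative. -/
lemma force_curve_eq_zero (hsol : IsWeakSolution l h ζ η₀ η₀x v₀ η ηt ηx ηtx F D) (hl : 0 < l)
    {a b t₁ t₂ y r : ℝ} {f f' : ℝ → ℝ} (hab : a < b) (hf : IsSobolevH1 a b f f') (hr : 0 < r)
    (hd : Ioo t₁ t₂ ×ˢ Ioo (y - r) (y + r) ⊆ domain l)
    (hv : ∀ᵐ z ∂(volume.restrict (Ioo t₁ t₂ ×ˢ Ioo (y - r) (y + r))), 0 ≤ ηt z)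
    (hI : Icc a b ⊆ Ioo t₁ t₂) (hfI : ∀ t ∈ Icc a b, f t ∈ Ioo (y - r / 2) (y + r / 2))
    (h0 : ∀ t ∈ Icc a b, η (t, f t) = 0) : F ((fun t => (t, f t)) '' Icc a b) = 0 := by
  have hlf := hsol.force_locallyFinite
  have ha := hI (left_mem_Icc.2 hab.le)
  have hbd := hI (right_mem_Icc.2 hab.le)
  have hy : ∀ x ∈ Ioo (y - r) (y + r), x ∈ Ioo 0 l := fun x hx => (hd (mk_mem_prod ha hx)).2
  have ha0 : 0 < a := (hd (mk_mem_prod ha (show y ∈ Ioo (y - r) (y + r) from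
    ⟨by linarith, by linarith⟩))).1
  have hfI' : ∀ t ∈ Icc a b, f t ∈ Ioo (y - r) (y + r) := fun t ht =>
    ⟨by linarith [(hfI t ht).1], by linarith [(hfI t ht).2]⟩
  have hlim := hsol.force_curve_tendsto hab hf fun t ht => hd (mk_mem_prod (hI ht) (hfI' t ht))
  set fc := constExtension a b f with hfc
  have hfcc : Continuous fc := constExtension_continuous hab.le hf.continuousOn
  have hfcm : ∀ t, fc t ∈ Ioo (y - r / 2) (y + r / 2) := constExtension_mem hab.le hfI
  -- Backward propagation of contact: `η` is non-negative and increasing in time, and vanishes at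
  -- `(t, f t)`.
  have hfc0 : ∀ s t, a ≤ s → s ≤ t → t ≤ b → η (s, fc t) = 0 := by
    intro s t hs hst ht
    have htI : t ∈ Icc a b := ⟨hs.trans hst, ht⟩
    have hsI : s ∈ Icc a b := ⟨hs, hst.trans ht⟩
    rw [hfc, constExtension_eq htI]
    refine le_antisymm ?_ (hsol.nonneg _ (hd (mk_mem_prod (hI hsI) (hfI' t htI))))
    rw [← h0 t htI]
    exact hsol.monotone_of_velocity_nonneg hl hd hv (hI hsI) (hI htI) hst (hfI' t htI)
  have hmono : ∀ s t x, a ≤ s → s ≤ t → t ≤ b → x ∈ Ioo (y - r) (y + r) → η (s, x) ≤ η (t, x) :=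
    fun s t x hs hst ht hx => hsol.monotone_of_velocity_nonneg hl hd hv (hI ⟨hs, hst.trans ht⟩)
      (hI ⟨hs.trans hst, ht⟩) hst hx
  have hηnn : ∀ t x, t ∈ Icc a b → x ∈ Ioo (y - r) (y + r) → 0 ≤ η (t, x) := fun t x ht hx =>
    hsol.nonneg _ (hd (mk_mem_prod (hI ht) hx))
  -- sign of the four strip integrals
  have main : ∀ δ, 0 < δ → δ < r / 2 →
      0 ≤ (∫ t in a..b, ∫ x in (f t)..(f t + δ), ηx (t, x)) ∧
      (∫ t in a..b, ∫ x in (f t - δ)..(f t), ηx (t, x)) ≤ 0 ∧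
      0 ≤ (∫ t in a..b, ∫ x in (f t)..(f t + δ), ηtx (t, x)) ∧
      (∫ t in a..b, ∫ x in (f t - δ)..(f t), ηtx (t, x)) ≤ 0 := by
    intro δ hδ hδr
    obtain ⟨c, hc⟩ : ∃ c, c = y - r / 2 - δ := ⟨_, rfl⟩
    obtain ⟨d, hd'⟩ : ∃ d, d = y + r / 2 + δ := ⟨_, rfl⟩
    have hcm : c ∈ Ioo (y - r) (y + r) := ⟨by linarith, by linarith⟩
    have hdm : d ∈ Ioo (y - r) (y + r) := ⟨by linarith, by linarith⟩
    have hc0 : 0 < c := (hy c hcm).1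
    have hdl : d < l := (hy d hdm).2
    have box : ∀ {u : ℝ × ℝ → ℝ}, LocallyIntegrableOn u (domain l) →
        IntegrableOn u (Icc a b ×ˢ Icc c d) := fun hu =>
      hu.integrableOn_compact_subset (Set.prod_mono (fun t ht => ha0.trans_le ht.1)
        fun x hx => ⟨hc0.trans_le hx.1, hx.2.trans_lt hdl⟩) (isCompact_Icc.prod isCompact_Icc)
    have up : ∀ {u : ℝ × ℝ → ℝ}, LocallyIntegrableOn u (domain l) →
        (∀ s t, a ≤ s → s < t → t ≤ b → 0 ≤ ∫ z in (fc t)..(fc t + δ), ∫ τ in s..t, u (τ, z)) →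
        0 ≤ ∫ t in a..b, ∫ x in (f t)..(f t + δ), u (t, x) := by
      intro u hu hpos
      have e1 := (setIntegral_strip (a := a) (b := b) (p := fc) (q := fun t => fc t + δ) hu ha0 hab.le
        hc0 hdl hfcc.measurable (hfcc.add continuous_const).measurable (fun t _ => by linarith)
        (fun t _ => by linarith [(hfcm t).1]) (fun t _ => by linarith [(hfcm t).2])).2
      have e2 : ∫ t in a..b, ∫ x in (f t)..(f t + δ), u (t, x)
          = ∫ t in a..b, ∫ x in (fc t)..(fc t + δ), u (t, x) := by
        refine intervalIntegral.integral_congr fun t ht => ?_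
        rw [uIcc_of_le hab.le] at ht
        simp only [hfc, constExtension_eq ht]
      rw [e2, ← e1]
      refine setIntegral_strip_nonneg (p := fc) (q := fun t => fc t + δ) hab hfcc
        (hfcc.add continuous_const)
        (fun t _ => by linarith [(hfcm t).1]) (fun t _ => by linarith [(hfcm t).2]) (box hu) ?_
      intro s t hs hst ht
      rw [setIntegral_rectangle hu (ha0.trans_le hs) hst.le (by linarith [(hfcm t).1]) (by linarith)
        (by linarith [(hfcm t).2])]
      exact hpos s t hs hst ht
    have down : ∀ {u : ℝ × ℝ → ℝ}, LocallyIntegrableOn u (domain l) →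
        (∀ s t, a ≤ s → s < t → t ≤ b → ∫ z in (fc t - δ)..(fc t), ∫ τ in s..t, u (τ, z) ≤ 0) →
        ∫ t in a..b, ∫ x in (f t - δ)..(f t), u (t, x) ≤ 0 := by
      intro u hu hpos
      have e1 := (setIntegral_strip (a := a) (b := b) (p := fun t => fc t - δ) (q := fc) hu ha0 hab.le
        hc0 hdl (hfcc.sub continuous_const).measurable hfcc.measurable (fun t _ => by linarith)
        (fun t _ => by linarith [(hfcm t).1]) (fun t _ => by linarith [(hfcm t).2])).2
      have e2 : ∫ t in a..b, ∫ x in (f t - δ)..(f t), u (t, x)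
          = ∫ t in a..b, ∫ x in (fc t - δ)..(fc t), u (t, x) := by
        refine intervalIntegral.integral_congr fun t ht => ?_
        rw [uIcc_of_le hab.le] at ht
        simp only [hfc, constExtension_eq ht]
      rw [e2, ← e1, ← neg_nonneg, ← integral_neg]
      refine setIntegral_strip_nonneg (u := fun z => -u z) (p := fun t => fc t - δ)
        (q := fc) hab (hfcc.sub continuous_const) hfcc
        (fun t _ => by linarith [(hfcm t).1]) (fun t _ => by linarith [(hfcm t).2]) (box hu).neg ?_
      intro s t hs hst ht
      rw [integral_neg, setIntegral_rectangle hu (ha0.trans_le hs) hst.le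
        (by linarith [(hfcm t).1]) (by linarith) (by linarith [(hfcm t).2]), neg_nonneg]
      exact hpos s t hs hst ht
    have m0 : ∀ t, fc t ∈ Ioo (y - r) (y + r) := fun t =>
      ⟨by linarith [(hfcm t).1], by linarith [(hfcm t).2]⟩
    have m1 : ∀ t, fc t + δ ∈ Ioo (y - r) (y + r) := fun t =>
      ⟨by linarith [(hfcm t).1], by linarith [(hfcm t).2]⟩
    have m2 : ∀ t, fc t - δ ∈ Ioo (y - r) (y + r) := fun t =>
      ⟨by linarith [(hfcm t).1], by linarith [(hfcm t).2]⟩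
    have hz : ∀ s t, a ≤ s → s < t → t ≤ b → ∫ τ in s..t, η (τ, fc t) = 0 := by
      intro s t hs hst ht
      rw [intervalIntegral.integral_congr (g := fun _ => (0 : ℝ)) fun τ hτ => ?_]
      · simp
      · rw [uIcc_of_le hst.le] at hτ
        exact hfc0 τ t (hs.trans hτ.1) hτ.2 ht
    have hnn : ∀ s t x, a ≤ s → s < t → t ≤ b → x ∈ Ioo (y - r) (y + r) →
        0 ≤ ∫ τ in s..t, η (τ, x) := fun s t x hs hst ht hx =>
      intervalIntegral.integral_nonneg hst.le fun τ hτ =>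
        hηnn τ x ⟨hs.trans hτ.1, hτ.2.trans ht⟩ hx
    refine ⟨up hsol.weakDeriv_x.2.1 ?_, down hsol.weakDeriv_x.2.1 ?_,
      up hsol.weakDeriv_tx.2.1 ?_, down hsol.weakDeriv_tx.2.1 ?_⟩
    · intro s t hs hst ht
      rw [← hsol.space_difference hl (ha0.trans_le hs) hst.le (hy _ (m0 t)) (hy _ (m1 t)),
        hz s t hs hst ht, sub_zero]
      exact hnn s t _ hs hst ht (m1 t)
    · intro s t hs hst ht
      rw [← hsol.space_difference hl (ha0.trans_le hs) hst.le (hy _ (m2 t)) (hy _ (m0 t)),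
        hz s t hs hst ht, zero_sub, neg_nonpos]
      exact hnn s t _ hs hst ht (m2 t)
    -- In the mixed difference the two values on the line `x = f t` vanish, leaving a time increment
    -- of `η` away from the curve, of known sign.
    · intro s t hs hst ht
      rw [← hsol.mixed_difference hl (ha0.trans_le hs) hst.le (hy _ (m0 t)) (hy _ (m1 t)),
        hfc0 t t (hs.trans hst.le) le_rfl ht, hfc0 s t hs hst.le ht]
      linarith [hmono s t _ hs hst.le ht (m1 t)]
    · intro s t hs hst ht
      rw [← hsol.mixed_difference hl (ha0.trans_le hs) hst.le (hy _ (m2 t)) (hy _ (m0 t)),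
        hfc0 t t (hs.trans hst.le) le_rfl ht, hfc0 s t hs hst.le ht]
      linarith [hmono s t _ hs hst.le ht (m2 t)]
  have hle : (F ((fun t => (t, f t)) '' Icc a b)).toReal ≤ 0 := by
    refine le_of_tendsto hlim ?_
    filter_upwards [Ioo_mem_nhdsGT (half_pos hr)] with δ hδ
    obtain ⟨e1, e2, e3, e4⟩ := main δ hδ.1 hδ.2
    rw [neg_nonpos]
    exact mul_nonneg (one_div_nonneg.2 hδ.1.le) (by linarith)
  -- The graph is compact and `F` locally finite; this excludes the value `⊤`, which `toReal` would
  -- also send to 0.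
  have hfin : F ((fun t => (t, f t)) '' Icc a b) ≠ ⊤ :=
    (isCompact_Icc.image_of_continuousOn (continuousOn_id.prodMk hf.continuousOn)).measure_ne_top
  exact (ENNReal.toReal_eq_zero_iff _).1 (le_antisymm hle ENNReal.toReal_nonneg) |>.resolve_right hfin

/-- Nullity is local: near each of its points in `int{v ≥ 0}` the graph has a short sub-arc inside a
square of non-negative velocity, to which `force_curve_eq_zero` applies. -/
lemma force_curve_inter_intNonneg (hsol : IsWeakSolution l h ζ η₀ η₀x v₀ η ηt ηx ηtx F D) (hl : 0 < l)
    {a b : ℝ} {f f' : ℝ → ℝ} (hab : a < b) (hf : IsSobolevH1 a b f f')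
    (hΓ : (fun t => (t, f t)) '' Icc a b ⊆ contactBoundary l η) :
    F ((fun t => (t, f t)) '' Icc a b ∩ intNonneg l ηt) = 0 := by
  refine measure_null_of_locally_null _ ?_
  rintro _ ⟨⟨t₀, ht₀, rfl⟩, hU⟩
  obtain ⟨r, hr, hd, hv⟩ := exists_rectangle_of_mem_intNonneg hU
  simp only at hd hv
  obtain ⟨σ, hσ, hσf⟩ := Metric.continuousWithinAt_iff.1 (hf.continuousOn t₀ ht₀) (r / 2) (half_pos hr)
  -- Small enough for continuity to keep the arc in the middle half of the square, and for its times
  -- to stay in the square. Clipping to `[a,b]` leaves a nondegenerate interval even if `t₀` is an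
  -- endpoint.
  set κ := min σ r / 2 with hκ
  have hκ0 : 0 < κ := half_pos (lt_min hσ hr)
  have hκσ : κ < σ := (half_lt_self (lt_min hσ hr)).trans_le (min_le_left _ _)
  have hκr : κ < r := (half_lt_self (lt_min hσ hr)).trans_le (min_le_right _ _)
  have hsub : Icc (max a (t₀ - κ)) (min b (t₀ + κ)) ⊆ Icc a b :=
    Icc_subset_Icc (le_max_left _ _) (min_le_left _ _)
  have hnear : ∀ t ∈ Icc (max a (t₀ - κ)) (min b (t₀ + κ)), t₀ - κ ≤ t ∧ t ≤ t₀ + κ := fun t ht =>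
    ⟨(le_max_right _ _).trans ht.1, ht.2.trans (min_le_right _ _)⟩
  have hzero := hsol.force_curve_eq_zero hl (a := max a (t₀ - κ)) (b := min b (t₀ + κ)) (f := f)
    (max_lt (lt_min hab (by linarith [ht₀.1])) (lt_min (by linarith [ht₀.2]) (by linarith)))
    (hf.mono (le_max_left _ _) (min_le_left _ _)) hr hd hv
    (fun t ht => ⟨by linarith [(hnear t ht).1], by linarith [(hnear t ht).2]⟩)
    (fun t ht => by
      have h1 : dist t t₀ < σ := by
        rw [Real.dist_eq, abs_lt]; constructor <;> linarith [(hnear t ht).1, (hnear t ht).2]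
      have h2 := hσf (hsub ht) h1
      rw [Real.dist_eq, abs_lt] at h2
      exact ⟨by linarith [h2.1], by linarith [h2.2]⟩)
    (fun t ht => hsol.eq_zero_of_mem_contactBoundary (hΓ ⟨t, hsub ht, rfl⟩))
  refine ⟨((fun t => (t, f t)) '' Icc a b ∩ intNonneg l ηt) ∩ (Ioo (t₀ - κ) (t₀ + κ) ×ˢ univ),
    inter_mem self_mem_nhdsWithin (mem_nhdsWithin_of_mem_nhds
      ((isOpen_Ioo.prod isOpen_univ).mem_nhds ⟨⟨by simp only; linarith, by simp only; linarith⟩,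
        mem_univ _⟩)), measure_mono_null ?_ hzero⟩
  rintro _ ⟨⟨⟨t, ht, rfl⟩, -⟩, ht', -⟩
  exact ⟨t, ⟨max_le ht.1 ht'.1.le, le_min ht.2 ht'.2.le⟩, rfl⟩

end IsWeakSolution

end ViscoString

namespace ViscoString

/-! ### The momentum equation near a fixed time -/

section TimeTent

variable {l t₁ δ : ℝ} {u : ℝ × ℝ → ℝ} {θ : ℝ → ℝ}

/-- The slopes `±1/δ` of a tent in time produce the time mean before `t₁` minus the time mean after
it. -/
lemma tendsto_setIntegral_tentApproxDeriv (hu : LocallyIntegrableOn u (domain l)) (hδ : 0 < δ)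
    (hδt : δ < t₁) (hθ : Continuous θ) (hc : HasCompactSupport θ) (hθs : tsupport θ ⊆ Ioo 0 l) :
    Tendsto (fun n => ∫ p in domain l, u p * (tentApproxDeriv n δ (p.1 - t₁) * θ p.2)) atTop
      (𝓝 (1 / δ * ((∫ x in Ioo 0 l, (∫ τ in (t₁ - δ)..t₁, u (τ, x)) * θ x)
        - ∫ x in Ioo 0 l, (∫ τ in t₁..(t₁ + δ), u (τ, x)) * θ x))) := by
  have hs : 0 < t₁ - δ := by linarith
  have e : ∫ p in domain l, u p * (tentDeriv δ (p.1 - t₁) * θ p.2)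
      = 1 / δ * ((∫ x in Ioo 0 l, (∫ τ in (t₁ - δ)..t₁, u (τ, x)) * θ x)
        - ∫ x in Ioo 0 l, (∫ τ in t₁..(t₁ + δ), u (τ, x)) * θ x) := by
    rw [← setIntegral_slab hu hs (by linarith) hθ hc hθs,
      ← setIntegral_slab hu (by linarith) (by linarith) hθ hc hθs,
      ← integral_sub (integrable_slab hu hs hθ hc hθs).integrableOn
        (integrable_slab hu (by linarith) hθ hc hθs).integrableOn, ← integral_const_mul]
    refine integral_congr_ae (Eventually.of_forall fun p => ?_)
    simp only [tentDeriv_eq_indicator hδ]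
    ring
  rw [← e]
  obtain ⟨N, hN⟩ := exists_abs_le_of_hasCompactSupport hθ hc
  have hK : Icc (t₁ - δ) (t₁ + δ + 1) ×ˢ tsupport θ ⊆ domain l :=
    Set.prod_mono (fun t ht => hs.trans_le ht.1) hθs
  refine tendsto_setIntegral_mul (K := Icc (t₁ - δ) (t₁ + δ + 1) ×ˢ tsupport θ)
    (M := 2 / δ * N) (isCompact_Icc.prod hc).measurableSet
    (hu.integrableOn_compact_subset hK (isCompact_Icc.prod hc)) ?_ ?_ ?_ ?_
  · refine Eventually.of_forall fun n => ?_
    exact (((tentApproxDeriv_continuous n δ).comp (by fun_prop)).mul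
      (hθ.comp continuous_snd)).measurable
  · refine Eventually.of_forall fun n p => ?_
    rw [abs_mul]
    exact mul_le_mul (abs_tentApproxDeriv_le n hδ _) (hN _) (abs_nonneg _) (by positivity)
  · refine Eventually.of_forall fun n p hp => ?_
    rw [mem_prod, not_and_or] at hp
    rcases hp with h | h
    · have hn : 1 / ((n : ℝ) + 1) ≤ 1 := by
        rw [div_le_one (by positivity)]; linarith [n.cast_nonneg (α := ℝ)]
      rw [mem_Icc, not_and_or, not_le, not_le] at h
      rcases h with h | h
      · rw [tentApproxDeriv_of_lt n hδ (by linarith), zero_mul]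
      · rw [tentApproxDeriv_of_gt n hδ (by linarith), zero_mul]
    · rw [image_eq_zero_of_notMem_tsupport h, mul_zero]
  · exact Eventually.of_forall fun p => (tentApproxDeriv_tendsto δ _).mul_const _

lemma tendsto_integral_tentApprox {μ : Measure (ℝ × ℝ)} {U : Set (ℝ × ℝ)}
    (hu : ∀ s t, 0 < s → IntegrableOn u (Icc s t ×ˢ tsupport θ) μ) (hδ : 0 < δ)
    (hδt : δ < t₁) (hθ : Continuous θ) (hc : HasCompactSupport θ) :
    Tendsto (fun n => ∫ p in U, u p * (tentApprox n δ (p.1 - t₁) * θ p.2) ∂μ) atTop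
      (𝓝 (∫ p in U, u p * (tent δ (p.1 - t₁) * θ p.2) ∂μ)) := by
  have hs : 0 < t₁ - δ := by linarith
  obtain ⟨N, hN⟩ := exists_abs_le_of_hasCompactSupport hθ hc
  refine tendsto_setIntegral_mul (K := Icc (t₁ - δ) (t₁ + δ + 1) ×ˢ tsupport θ)
    (M := 1 * N) (isCompact_Icc.prod hc).measurableSet (hu _ _ hs) ?_ ?_ ?_ ?_
  · refine Eventually.of_forall fun n => ?_
    exact (((tentApprox_contDiff n δ).continuous.comp (by fun_prop)).mul
      (hθ.comp continuous_snd)).measurable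
  · refine Eventually.of_forall fun n p => ?_
    rw [abs_mul, abs_of_nonneg (tentApprox_nonneg n hδ _)]
    exact mul_le_mul (tentApprox_le_one n hδ _) (hN _) (abs_nonneg _) zero_le_one
  · refine Eventually.of_forall fun n p hp => ?_
    rw [mem_prod, not_and_or] at hp
    rcases hp with h | h
    · have hn : 1 / ((n : ℝ) + 1) ≤ 1 := by
        rw [div_le_one (by positivity)]; linarith [n.cast_nonneg (α := ℝ)]
      rw [mem_Icc, not_and_or, not_le, not_le] at h
      rcases h with h | h
      · rw [tentApprox_of_lt n hδ (by linarith), zero_mul]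
      · rw [tentApprox_of_gt n hδ (by linarith), zero_mul]
    · rw [image_eq_zero_of_notMem_tsupport h, mul_zero]
  · exact Eventually.of_forall fun p => (tentApprox_tendsto tendsto_const_nhds).mul_const _

lemma isTestFunction_tentApprox (hδ : 0 < δ) (hδt : δ < t₁) (hθ : IsTestFunction (Ioo 0 l) θ)
    (n : ℕ) : IsTestFunction (domain l) (fun p => tentApprox n δ (p.1 - t₁) * θ p.2) := by
  refine isTestFunction_of_support (K := Icc (t₁ - δ) (t₁ + δ + 1) ×ˢ tsupport θ)
    (((tentApprox_contDiff n δ).comp (contDiff_fst.sub contDiff_const)).mul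
      (hθ.1.comp contDiff_snd)) (isCompact_Icc.prod hθ.2.1)
    (Set.prod_mono (fun t ht => lt_of_lt_of_le (by linarith) ht.1) hθ.2.2) fun p hp => ?_
  rw [mem_prod, not_and_or] at hp
  rcases hp with h | h
  · have hn : 1 / ((n : ℝ) + 1) ≤ 1 := by
      rw [div_le_one (by positivity)]; linarith [n.cast_nonneg (α := ℝ)]
    rw [mem_Icc, not_and_or, not_le, not_le] at h
    rcases h with h | h
    · rw [tentApprox_of_lt n hδ (by linarith), zero_mul]
    · rw [tentApprox_of_gt n hδ (by linarith), zero_mul]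
  · rw [image_eq_zero_of_notMem_tsupport h, mul_zero]

lemma tent_tendsto_indicator (y : ℝ) :
    Tendsto (fun δ => tent δ y) (𝓝[>] 0) (𝓝 (({0} : Set ℝ).indicator 1 y)) := by
  refine tendsto_const_nhds.congr' ?_
  rcases eq_or_ne y 0 with rfl | h
  · filter_upwards [self_mem_nhdsWithin] with δ hδ
    rw [tent_zero hδ]; simp
  · filter_upwards [Ioo_mem_nhdsGT (abs_pos.2 h)] with δ hδ
    rw [tent_of_le_abs hδ.1 hδ.2.le]; simp [h]

/-- Weights `tent δ (t - t₁)` concentrate on the line `t = t₁`. -/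
lemma tendsto_integral_tent {μ : Measure (ℝ × ℝ)} (ht₁ : 0 < t₁) {U : Set (ℝ × ℝ)}
    (hu : ∀ s t, 0 < s → IntegrableOn u (Icc s t ×ˢ tsupport θ) μ)
    (hθ : Continuous θ) (hc : HasCompactSupport θ) :
    Tendsto (fun δ => ∫ p in U, u p * (tent δ (p.1 - t₁) * θ p.2) ∂μ) (𝓝[>] 0)
      (𝓝 (∫ p in U, u p * (({0} : Set ℝ).indicator 1 (p.1 - t₁) * θ p.2) ∂μ)) := by
  obtain ⟨N, hN⟩ := exists_abs_le_of_hasCompactSupport hθ hc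
  have hev : ∀ᶠ δ in 𝓝[>] (0 : ℝ), 0 < δ ∧ δ < t₁ / 2 := Ioo_mem_nhdsGT (half_pos ht₁)
  refine tendsto_setIntegral_mul (K := Icc (t₁ / 2) (2 * t₁) ×ˢ tsupport θ)
    (M := 1 * N) (isCompact_Icc.prod hc).measurableSet (hu _ _ (half_pos ht₁)) ?_ ?_ ?_ ?_
  · refine Eventually.of_forall fun δ => ?_
    exact (((tent_continuous δ).comp (by fun_prop)).mul (hθ.comp continuous_snd)).measurable
  · filter_upwards [hev] with δ hδ p
    rw [abs_mul, abs_of_nonneg (tent_nonneg hδ.1 _)]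
    exact mul_le_mul (tent_le_one hδ.1 _) (hN _) (abs_nonneg _) zero_le_one
  · filter_upwards [hev] with δ hδ p hp
    rw [mem_prod, not_and_or] at hp
    rcases hp with h | h
    · rw [tent_of_le_abs hδ.1, zero_mul]
      rw [mem_Icc, not_and_or, not_le, not_le] at h
      rw [le_abs]
      rcases h with h | h
      · right; linarith
      · left; linarith
    · rw [image_eq_zero_of_notMem_tsupport h, mul_zero]
  · exact Eventually.of_forall fun p => (tent_tendsto_indicator _).mul_const _

lemma volume_line (t : ℝ) : volume (({t} : Set ℝ) ×ˢ (univ : Set ℝ)) = 0 := by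
  rw [Measure.volume_eq_prod, Measure.prod_prod]; simp

/-- The line `t = t₁`, onto which the weights shrink, is Lebesgue null. All stress terms of the
time-localized equations disappear this way. -/
lemma tendsto_setIntegral_tent_zero (ht₁ : 0 < t₁) {U : Set (ℝ × ℝ)}
    (hu : ∀ s t, 0 < s → IntegrableOn u (Icc s t ×ˢ tsupport θ))
    (hθ : Continuous θ) (hc : HasCompactSupport θ) :
    Tendsto (fun δ => ∫ p in U, u p * (tent δ (p.1 - t₁) * θ p.2)) (𝓝[>] 0) (𝓝 0) := by
  have h := tendsto_integral_tent (U := U) ht₁ hu hθ hc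
  have e : ∫ p in U, u p * (({0} : Set ℝ).indicator 1 (p.1 - t₁) * θ p.2) = 0 := by
    refine integral_eq_zero_of_ae (ae_restrict_of_ae ?_)
    filter_upwards [measure_eq_zero_iff_ae_notMem.1 (volume_line t₁)] with p hp
    rw [indicator_of_notMem (by simpa [sub_eq_zero] using hp)]
    simp
  rwa [e] at h

end TimeTent

/-- The difference of the mean velocities after and before the time `t`. -/
noncomputable def velocityJump (η : ℝ × ℝ → ℝ) (t δ x : ℝ) : ℝ :=
  1 / δ * (η (t + δ, x) - η (t, x) - (η (t, x) - η (t - δ, x)))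

variable {l h : ℝ} {ζ : ℝ × ℝ → ℝ} {η₀ η₀x v₀ : ℝ → ℝ} {η ηt ηx ηtx : ℝ × ℝ → ℝ}
  {F D : Measure (ℝ × ℝ)}

lemma integrableOn_of_locallyIntegrableOn_domain {u : ℝ × ℝ → ℝ} {θ : ℝ → ℝ}
    (hu : LocallyIntegrableOn u (domain l)) (hθ : IsTestFunction (Ioo 0 l) θ) (s t : ℝ) (hs : 0 < s) :
    IntegrableOn u (Icc s t ×ˢ tsupport θ) :=
  hu.integrableOn_compact_subset (Set.prod_mono (fun _ ht => hs.trans_le ht.1) hθ.2.2)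
    (isCompact_Icc.prod hθ.2.1)

namespace IsWeakSolution

/-- Written with increments of `η` instead of integrals of `ηt`, the jump is continuous and
meaningful at every `x`, so its oscillation can be bounded pointwise. -/
lemma velocityJump_continuousOn (hsol : IsWeakSolution l h ζ η₀ η₀x v₀ η ηt ηx ηtx F D)
    {t₁ δ : ℝ} (hδ : 0 < δ) (hδt : δ < t₁) : ContinuousOn (velocityJump η t₁ δ) (Ioo 0 l) := by
  have hline : ∀ r, 0 < r → ContinuousOn (fun x => η (r, x)) (Ioo 0 l) := fun r hr =>
    hsol.continuousOn_domain.comp (by fun_prop) fun x hx => ⟨hr, hx⟩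
  exact continuousOn_const.mul (((hline _ (by linarith)).sub (hline _ (by linarith))).sub
    ((hline _ (by linarith)).sub (hline _ (by linarith))))

lemma ae_velocityJump_eq (hsol : IsWeakSolution l h ζ η₀ η₀x v₀ η ηt ηx ηtx F D) (hl : 0 < l)
    {t₁ : ℝ} : ∀ᵐ x ∂(volume.restrict (Ioo 0 l)), ∀ δ, 0 < δ → δ < t₁ → velocityJump η t₁ δ x
      = 1 / δ * ((∫ t in t₁..(t₁ + δ), ηt (t, x)) - ∫ t in (t₁ - δ)..t₁, ηt (t, x)) := by
  filter_upwards [hsol.ae_sub_eq_integral hl] with x hx δ hδ hδt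
  rw [← hx _ _ (by linarith) (by linarith), ← hx _ _ (by linarith) (by linarith), velocityJump]

/-- The momentum balance over a small time interval around `t₁`. -/
lemma setIntegral_velocityJump_mul (hsol : IsWeakSolution l h ζ η₀ η₀x v₀ η ηt ηx ηtx F D)
    (hl : 0 < l) {t₁ δ : ℝ} {θ : ℝ → ℝ} (hδ : 0 < δ) (hδt : δ < t₁)
    (hθ : IsTestFunction (Ioo 0 l) θ) :
    ∫ x in Ioo 0 l, velocityJump η t₁ δ x * θ x
      = (∫ p, tent δ (p.1 - t₁) * θ p.2 ∂F)
        - ∫ p in domain l, (ηtx p + ηx p) * (tent δ (p.1 - t₁) * deriv θ p.2) := by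
  have hlf := hsol.force_locallyFinite
  have hdc : Continuous (deriv θ) := hθ.1.continuous_deriv (by simp)
  have hdt : tsupport (deriv θ) ⊆ Ioo 0 l := (tsupport_deriv_subset).trans hθ.2.2
  have hF : Tendsto (fun n => ∫ p, tentApprox n δ (p.1 - t₁) * θ p.2 ∂F) atTop
      (𝓝 (∫ p, tent δ (p.1 - t₁) * θ p.2 ∂F)) := by
    have := tendsto_integral_tentApprox (U := univ) (u := fun _ => 1) (μ := F)
      (fun s t _ => integrableOn_const (isCompact_Icc.prod hθ.2.1).measure_ne_top)
      hδ hδt hθ.1.continuous hθ.2.1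
    simpa using this
  have hw := tendsto_integral_tentApprox (U := domain l) (u := fun p => ηtx p + ηx p)
    (fun s t hs => (integrableOn_of_locallyIntegrableOn_domain hsol.locallyIntegrableOn_stress hθ s t
      hs).mono_set (Set.prod_mono le_rfl tsupport_deriv_subset)) hδ hδt hdc hθ.2.1.deriv
  have ht := tendsto_setIntegral_tentApproxDeriv hsol.weakDeriv_t.2.1 hδ hδt hθ.1.continuous hθ.2.1
    hθ.2.2
  have key : ∀ n, ∫ p, tentApprox n δ (p.1 - t₁) * θ p.2 ∂F
      = (∫ p in domain l, (ηtx p + ηx p) * (tentApprox n δ (p.1 - t₁) * deriv θ p.2))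
        - ∫ p in domain l, ηt p * (tentApproxDeriv n δ (p.1 - t₁) * θ p.2) := fun n => by
    have hd : ∀ t, deriv (fun t => tentApprox n δ (t - t₁)) t = tentApproxDeriv n δ (t - t₁) :=
      fun t => ((tentApprox_hasDerivAt n δ (t - t₁)).comp_sub_const t t₁).deriv
    -- With the constant curve `g = 0` the slope term is zero, and the tent plays the role of the
    -- time cutoff.
    have := hsol.force_eq_of_smooth_curve (χ := fun t => tentApprox n δ (t - t₁)) (ψ := θ)
      (g := fun _ => 0) ((tentApprox_contDiff n δ).comp (contDiff_id.sub contDiff_const)) hθ.1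
      contDiff_const (by simpa using isTestFunction_tentApprox hδ hδt hθ n)
    simpa [hd] using this
  have hlim := tendsto_nhds_unique (hF.congr key) (hw.sub ht)
  have hJ : ∫ x in Ioo 0 l, velocityJump η t₁ δ x * θ x
      = 1 / δ * ((∫ x in Ioo 0 l, (∫ τ in t₁..(t₁ + δ), ηt (τ, x)) * θ x)
        - ∫ x in Ioo 0 l, (∫ τ in (t₁ - δ)..t₁, ηt (τ, x)) * θ x) := by
    have hi : ∀ {s t : ℝ}, 0 < s → s ≤ t →
        IntegrableOn (fun x => (∫ τ in s..t, ηt (τ, x)) * θ x) (Ioo 0 l) := fun hs hst => by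
      obtain ⟨N, hN⟩ := exists_abs_le_of_hasCompactSupport hθ.1.continuous hθ.2.1
      exact (integrable_mul_of_bounded hθ.2.1.measurableSet
        ((locallyIntegrableOn_slice hsol.weakDeriv_t.2.1 hs hst).integrableOn_compact_subset hθ.2.2
          hθ.2.1) hθ.1.continuous.measurable hN
        fun x hx => image_eq_zero_of_notMem_tsupport hx).integrableOn
    rw [← integral_sub (hi (by linarith) (by linarith)) (hi (by linarith) (by linarith)),
      ← integral_const_mul]
    refine integral_congr_ae ?_
    filter_upwards [hsol.ae_velocityJump_eq hl (t₁ := t₁)] with x hx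
    rw [hx δ hδ hδt]
    ring
  rw [hJ]
  linarith

/-- In the momentum balance the tents select the part of `F` on the line, while the stress term
tends to zero. -/
lemma tendsto_setIntegral_velocityJump (hsol : IsWeakSolution l h ζ η₀ η₀x v₀ η ηt ηx ηtx F D)
    (hl : 0 < l) {t₁ : ℝ} {θ : ℝ → ℝ} (ht₁ : 0 < t₁) (hθ : IsTestFunction (Ioo 0 l) θ) :
    Tendsto (fun δ => ∫ x in Ioo 0 l, velocityJump η t₁ δ x * θ x) (𝓝[>] 0)
      (𝓝 (∫ p in ({t₁} : Set ℝ) ×ˢ univ, θ p.2 ∂F)) := by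
  have hlf := hsol.force_locallyFinite
  have hdc : Continuous (deriv θ) := hθ.1.continuous_deriv (by simp)
  have h1 := tendsto_integral_tent (U := univ) (u := fun _ => 1) (μ := F) (θ := θ) ht₁
    (fun s t _ => integrableOn_const (isCompact_Icc.prod hθ.2.1).measure_ne_top)
    hθ.1.continuous hθ.2.1
  have h2 := tendsto_setIntegral_tent_zero (U := domain l) (u := fun p => ηtx p + ηx p) ht₁
    (fun s t hs => (integrableOn_of_locallyIntegrableOn_domain hsol.locallyIntegrableOn_stress hθ s t
      hs).mono_set (Set.prod_mono le_rfl tsupport_deriv_subset)) hdc hθ.2.1.deriv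
  have e1 : ∫ p, 1 * (({0} : Set ℝ).indicator 1 (p.1 - t₁) * θ p.2) ∂F
      = ∫ p in ({t₁} : Set ℝ) ×ˢ univ, θ p.2 ∂F := by
    rw [← integral_indicator ((measurableSet_singleton _).prod MeasurableSet.univ)]
    refine integral_congr_ae (Eventually.of_forall fun p => ?_)
    by_cases hp : p.1 = t₁
    · simp [hp]
    · simp [hp, sub_eq_zero]
  rw [setIntegral_univ, e1] at h1
  have h3 := h1.sub h2
  rw [sub_zero] at h3
  refine h3.congr' ?_
  filter_upwards [Ioo_mem_nhdsGT ht₁] with δ hδ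
  rw [hsol.setIntegral_velocityJump_mul hl hδ.1 hδ.2 hθ]
  simp

end IsWeakSolution

end ViscoString

namespace ViscoString

/-! ### The contact force at a fixed time -/

lemma exists_smooth_cutoff {K O : Set ℝ} (hK : IsCompact K) (hO : IsOpen O) (hKO : K ⊆ O) :
    ∃ θ : ℝ → ℝ, IsTestFunction O θ ∧ (∀ x, θ x ∈ Icc 0 1) ∧ ∀ x ∈ K, θ x = 1 := by
  obtain ⟨K', hK', hKK', hK'O⟩ := exists_compact_between hK hO hKO
  obtain ⟨f, h1, h0, h01⟩ := exists_contMDiffMap_one_nhds_of_subset_interior (n := ⊤)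
    (modelWithCornersSelf ℝ ℝ) hK.isClosed hKK'
  exact ⟨f, isTestFunction_of_support f.contMDiff.contDiff hK' hK'O h0, h01,
    fun x hx => h1.self_of_nhdsSet x hx⟩

/-- The projection to the space variable of the part of `F` at time `t` in `(0, l)`. -/
noncomputable def sliceForce (F : Measure (ℝ × ℝ)) (l t : ℝ) : Measure ℝ :=
  (F.restrict (({t} : Set ℝ) ×ˢ Ioo 0 l)).map Prod.snd

section SliceForce

variable {F : Measure (ℝ × ℝ)} {l t : ℝ}

lemma isFiniteMeasure_sliceForce [IsLocallyFiniteMeasure F] : IsFiniteMeasure (sliceForce F l t) := by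
  have : IsFiniteMeasure (F.restrict (({t} : Set ℝ) ×ˢ Ioo 0 l)) := by
    refine isFiniteMeasure_restrict.2 (ne_top_of_le_ne_top ?_
      (measure_mono (Set.prod_mono le_rfl Ioo_subset_Icc_self)))
    exact (isCompact_singleton.prod isCompact_Icc).measure_ne_top
  unfold sliceForce
  infer_instance

lemma sliceForce_apply {s : Set ℝ} (hs : MeasurableSet s) :
    sliceForce F l t s = F (({t} : Set ℝ) ×ˢ (s ∩ Ioo 0 l)) := by
  rw [sliceForce, Measure.map_apply measurable_snd hs,
    Measure.restrict_apply (measurable_snd hs)]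
  congr 1
  ext p
  simp only [mem_inter_iff, mem_preimage, mem_prod, mem_singleton_iff]
  tauto

lemma sliceForce_compl : sliceForce F l t (Ioo 0 l)ᶜ = 0 := by
  rw [sliceForce_apply measurableSet_Ioo.compl]; simp

lemma setIntegral_line_eq {θ : ℝ → ℝ} (hθ : IsTestFunction (Ioo 0 l) θ) :
    ∫ p in ({t} : Set ℝ) ×ˢ univ, θ p.2 ∂F = ∫ x, θ x ∂(sliceForce F l t) := by
  rw [sliceForce, integral_map measurable_snd.aemeasurable
    hθ.1.continuous.aestronglyMeasurable]
  refine setIntegral_eq_of_subset_of_forall_sdiff_eq_zero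
    ((measurableSet_singleton _).prod MeasurableSet.univ) (Set.prod_mono le_rfl (subset_univ _)) ?_
  rintro p ⟨hp, hp'⟩
  refine image_eq_zero_of_notMem_tsupport fun h => hp' ⟨hp.1, hθ.2.2 h⟩

/-- `F` at time `t` is recovered from its projection. -/
lemma restrict_line_eq_dirac_prod {s : Set ℝ} (hs : MeasurableSet s) (hsl : s ⊆ Ioo 0 l) :
    F.restrict (({t} : Set ℝ) ×ˢ s) = ((sliceForce F l t).restrict s).map (Prod.mk t) := by
  ext A hA
  have hm : MeasurableSet (Prod.mk t ⁻¹' A) := measurable_prodMk_left hA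
  rw [Measure.map_apply measurable_prodMk_left hA, Measure.restrict_apply hm,
    sliceForce_apply (hm.inter hs), Measure.restrict_apply hA]
  congr 1
  ext ⟨p, x⟩
  simp only [mem_inter_iff, mem_preimage, mem_prod, mem_singleton_iff]
  constructor
  · rintro ⟨h1, rfl, h2⟩
    exact ⟨rfl, ⟨h1, h2⟩, hsl h2⟩
  · rintro ⟨rfl, ⟨h1, h2⟩, -⟩
    exact ⟨h1, rfl, h2⟩

end SliceForce

variable {l h : ℝ} {ζ : ℝ × ℝ → ℝ} {η₀ η₀x v₀ : ℝ → ℝ} {η ηt ηx ηtx : ℝ × ℝ → ℝ}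
  {F D : Measure (ℝ × ℝ)}

namespace IsWeakSolution

/-- Cauchy–Schwarz in time bounds the squared jump at `x` by `2/δ` times the integral of `ηt²` over
a time interval of length `2δ`. Integrating in `x` and using the `L^∞ L²` bound gives `4C`. -/
lemma exists_velocityJump_bound (hsol : IsWeakSolution l h ζ η₀ η₀x v₀ η ηt ηx ηtx F D)
    (hl : 0 < l) (t₁ : ℝ) : ∃ C, 0 ≤ C ∧ ∀ δ, 0 < δ → δ < t₁ →
      MemLp (velocityJump η t₁ δ) 2 (volume.restrict (Ioo 0 l)) ∧
      ∫ x in Ioo 0 l, velocityJump η t₁ δ x ^ 2 ≤ C := by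
  obtain ⟨C, hC0, hC⟩ := hsol.bound_t.exists_integral_sq_le
  refine ⟨4 * C, by positivity, fun δ hδ hδt => ?_⟩
  have hs : 0 < t₁ - δ := by linarith
  have hsub : Ioc (t₁ - δ) (t₁ + δ) ⊆ Ioi 0 := fun t ht => hs.trans ht.1
  have hsq : Integrable (fun p => ηt p ^ 2)
      ((volume.restrict (Ioc (t₁ - δ) (t₁ + δ))).prod (volume.restrict (Ioo 0 l))) := by
    rw [Measure.prod_restrict, ← Measure.volume_eq_prod]
    exact (hsol.memLp_t.mono_measure
      (Measure.restrict_mono (Set.prod_mono hsub le_rfl) le_rfl)).integrable_sq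
  have hm : AEStronglyMeasurable ηt
      ((volume.restrict (Ioc (t₁ - δ) (t₁ + δ))).prod (volume.restrict (Ioo 0 l))) := by
    rw [Measure.prod_restrict, ← Measure.volume_eq_prod]
    exact hsol.memLp_t.1.mono_measure (Measure.restrict_mono (Set.prod_mono hsub le_rfl) le_rfl)
  have hpt : ∀ᵐ x ∂(volume.restrict (Ioo 0 l)), velocityJump η t₁ δ x ^ 2
      ≤ 2 / δ * ∫ t in Ioc (t₁ - δ) (t₁ + δ), ηt (t, x) ^ 2 := by
    filter_upwards [hsol.ae_velocityJump_eq hl (t₁ := t₁), hsq.prod_left_ae,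
      hm.prod_swap.prodMk_left] with x hx hx2 hx3
    have hL : MemLp (fun t => ηt (t, x)) 2 (volume.restrict (Ioc (t₁ - δ) (t₁ + δ))) :=
      (memLp_two_iff_integrable_sq hx3).2 hx2
    have hi : IntegrableOn (fun t => ηt (t, x)) (Ioc (t₁ - δ) (t₁ + δ)) :=
      hL.integrable one_le_two
    have hcs := integral_abs_sq_le hL
    simp only [measureReal_restrict_apply_univ, Real.volume_real_Ioc] at hcs
    rw [max_eq_left (by linarith)] at hcs
    set I := ∫ t in Ioc (t₁ - δ) (t₁ + δ), |ηt (t, x)| with hI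
    have hsplit : I = (∫ t in Ioc (t₁ - δ) t₁, |ηt (t, x)|) + ∫ t in Ioc t₁ (t₁ + δ), |ηt (t, x)| := by
      rw [hI, ← Ioc_union_Ioc_eq_Ioc (show t₁ - δ ≤ t₁ by linarith) (show t₁ ≤ t₁ + δ by linarith)]
      refine setIntegral_union (Ioc_disjoint_Ioc_of_le le_rfl) measurableSet_Ioc
        (IntegrableOn.mono_set (f := fun t => |ηt (t, x)|) hi.abs (Ioc_subset_Ioc_right (by linarith)))
        (IntegrableOn.mono_set (f := fun t => |ηt (t, x)|) hi.abs (Ioc_subset_Ioc_left (by linarith)))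
    have habs : |velocityJump η t₁ δ x| ≤ 1 / δ * I := by
      rw [hx δ hδ hδt, abs_mul, abs_of_pos (one_div_pos.2 hδ)]
      refine mul_le_mul_of_nonneg_left ?_ (one_div_pos.2 hδ).le
      rw [intervalIntegral.integral_of_le (by linarith), intervalIntegral.integral_of_le (by linarith)]
      refine (abs_sub _ _).trans ?_
      rw [hsplit, add_comm]
      exact add_le_add (abs_integral_le_integral_abs) (abs_integral_le_integral_abs)
    calc velocityJump η t₁ δ x ^ 2 = |velocityJump η t₁ δ x| ^ 2 := (sq_abs _).symm
      _ ≤ (1 / δ * I) ^ 2 := by gcongr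
      _ = 1 / δ ^ 2 * I ^ 2 := by ring
      _ ≤ 1 / δ ^ 2 * ((t₁ + δ - (t₁ - δ)) * ∫ t in Ioc (t₁ - δ) (t₁ + δ), ηt (t, x) ^ 2) := by gcongr
      _ = _ := by field_simp; ring
  have hmJ : AEStronglyMeasurable (velocityJump η t₁ δ) (volume.restrict (Ioo 0 l)) :=
    (hsol.velocityJump_continuousOn hδ hδt).aestronglyMeasurable measurableSet_Ioo
  have hdom : Integrable (fun x => 2 / δ * ∫ t in Ioc (t₁ - δ) (t₁ + δ), ηt (t, x) ^ 2)
      (volume.restrict (Ioo 0 l)) := hsq.integral_prod_right.const_mul _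
  have hint : Integrable (fun x => velocityJump η t₁ δ x ^ 2) (volume.restrict (Ioo 0 l)) := by
    refine hdom.mono' (hmJ.pow 2) (hpt.mono fun x hx => ?_)
    rwa [Real.norm_eq_abs, abs_of_nonneg (sq_nonneg _)]
  refine ⟨(memLp_two_iff_integrable_sq hmJ).2 hint, ?_⟩
  calc _ ≤ ∫ x in Ioo 0 l, 2 / δ * ∫ t in Ioc (t₁ - δ) (t₁ + δ), ηt (t, x) ^ 2 :=
        integral_mono_ae hint hdom hpt
    _ = 2 / δ * ∫ t in Ioc (t₁ - δ) (t₁ + δ), ∫ x in Ioo 0 l, ηt (t, x) ^ 2 := by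
        rw [integral_const_mul, ← integral_prod_symm _ hsq, integral_prod _ hsq]
    _ ≤ 2 / δ * ∫ t in Ioc (t₁ - δ) (t₁ + δ), C := by
        refine mul_le_mul_of_nonneg_left ?_ (by positivity)
        refine integral_mono_ae hsq.integral_prod_left (integrable_const _) ?_
        filter_upwards [ae_restrict_of_ae_restrict_of_subset hsub hC] with t ht using ht.2
    _ = 4 * C := by
        rw [setIntegral_const, Real.volume_real_Ioc, max_eq_left (by linarith), smul_eq_mul]
        field_simp
        ring

/-- The slice of the contact force is absolutely continuous. -/
lemma sliceForce_absolutelyContinuous (hsol : IsWeakSolution l h ζ η₀ η₀x v₀ η ηt ηx ηtx F D)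
    (hl : 0 < l) {t₁ : ℝ} (ht₁ : 0 < t₁) : sliceForce F l t₁ ≪ volume := by
  have hlf := hsol.force_locallyFinite
  have hfin : IsFiniteMeasure (sliceForce F l t₁) := isFiniteMeasure_sliceForce
  obtain ⟨C, hC0, hC⟩ := hsol.exists_velocityJump_bound hl t₁
  -- Young's inequality with a free parameter, `Jθ ≤ λJ² + θ²/(4λ)`, passed to the limit `δ → 0`.
  have est : ∀ θ, IsTestFunction (Ioo 0 l) θ → ∀ lam > 0,
      ∫ x, θ x ∂(sliceForce F l t₁) ≤ lam * C + 1 / (4 * lam) * ∫ x in Ioo 0 l, θ x ^ 2 := by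
    intro θ hθ lam hlam
    rw [← setIntegral_line_eq hθ]
    refine le_of_tendsto (hsol.tendsto_setIntegral_velocityJump hl ht₁ hθ) ?_
    filter_upwards [Ioo_mem_nhdsGT ht₁] with δ hδ
    obtain ⟨hL, hb⟩ := hC δ hδ.1 hδ.2
    have hθL : MemLp θ 2 (volume.restrict (Ioo 0 l)) :=
      (hθ.1.continuous.memLp_of_hasCompactSupport hθ.2.1).restrict _
    calc ∫ x in Ioo 0 l, velocityJump η t₁ δ x * θ x
        ≤ ∫ x in Ioo 0 l, (lam * velocityJump η t₁ δ x ^ 2 + 1 / (4 * lam) * θ x ^ 2) := by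
          refine integral_mono (hL.integrable_mul hθL) ((hL.integrable_sq.const_mul _).add
            (hθL.integrable_sq.const_mul _)) fun x => ?_
          have : lam * velocityJump η t₁ δ x ^ 2 + 1 / (4 * lam) * θ x ^ 2
              - velocityJump η t₁ δ x * θ x
              = 1 / (4 * lam) * (2 * lam * velocityJump η t₁ δ x - θ x) ^ 2 := by
            field_simp; ring
          have h2 : 0 ≤ 1 / (4 * lam) * (2 * lam * velocityJump η t₁ δ x - θ x) ^ 2 := by positivity
          simp only
          linarith
      _ = lam * (∫ x in Ioo 0 l, velocityJump η t₁ δ x ^ 2)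
          + 1 / (4 * lam) * ∫ x in Ioo 0 l, θ x ^ 2 := by
          rw [integral_add (hL.integrable_sq.const_mul _) (hθL.integrable_sq.const_mul _),
            integral_const_mul, integral_const_mul]
      _ ≤ _ := by gcongr
  have hKnull : ∀ K, IsCompact K → K ⊆ Ioo 0 l → volume K = 0 → sliceForce F l t₁ K = 0 := by
    intro K hK hKl hK0
    have hle : ∀ lam > 0, (sliceForce F l t₁).real K ≤ lam * C + lam := by
      intro lam hlam
      -- The measure `4λ²` of the neighbourhood is chosen so that the second Young term is at most
      -- `λ`.
      obtain ⟨O, hKO, hO, hOv⟩ := K.exists_isOpen_lt_add (μ := volume) (by simp [hK0])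
        (ε := ENNReal.ofReal (4 * lam ^ 2)) (by simp; positivity)
      rw [hK0, zero_add] at hOv
      obtain ⟨θ, hθ, h01, h1⟩ := exists_smooth_cutoff hK (hO.inter isOpen_Ioo)
        (subset_inter hKO hKl)
      have hθ' : IsTestFunction (Ioo 0 l) θ := ⟨hθ.1, hθ.2.1, hθ.2.2.trans inter_subset_right⟩
      have e1 : (sliceForce F l t₁).real K ≤ ∫ x, θ x ∂(sliceForce F l t₁) := by
        rw [← integral_indicator_one hK.measurableSet]
        refine integral_mono ((integrable_indicator_iff hK.measurableSet).2 (integrable_const _))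
          (hθ.1.continuous.integrable_of_hasCompactSupport hθ.2.1) fun x => ?_
        by_cases hx : x ∈ K
        · simp [hx, h1 x hx]
        · simpa [hx] using (h01 x).1
      have e2 : ∫ x in Ioo 0 l, θ x ^ 2 ≤ 4 * lam ^ 2 := by
        have hb : ∀ x, θ x ^ 2 ≤ O.indicator 1 x := fun x => by
          by_cases hx : x ∈ O
          · rw [indicator_of_mem hx]
            exact pow_le_one₀ (h01 x).1 (h01 x).2
          · rw [indicator_of_notMem hx, image_eq_zero_of_notMem_tsupport
              fun h' => hx (hθ.2.2 h').1]
            norm_num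
        have hOi : Integrable (O.indicator (1 : ℝ → ℝ)) :=
          (integrable_indicator_iff hO.measurableSet).2
            (integrableOn_const (hOv.trans ENNReal.ofReal_lt_top).ne)
        have hθi : Integrable (fun x => θ x ^ 2) :=
          (hθ.1.continuous.memLp_of_hasCompactSupport hθ.2.1).integrable_sq
        calc _ ≤ ∫ x, θ x ^ 2 := setIntegral_le_integral hθi (Eventually.of_forall fun x => sq_nonneg _)
          _ ≤ ∫ x, O.indicator 1 x := integral_mono hθi hOi hb
          _ = volume.real O := integral_indicator_one hO.measurableSet
          _ ≤ _ := ENNReal.toReal_le_of_le_ofReal (by positivity) hOv.le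
      calc _ ≤ _ := e1
        _ ≤ _ := est θ hθ' lam hlam
        _ ≤ lam * C + 1 / (4 * lam) * (4 * lam ^ 2) := by gcongr
        _ = _ := by field_simp
    have hlim : Tendsto (fun lam : ℝ => lam * C + lam) (𝓝[>] 0) (𝓝 0) := by
      have : Tendsto (fun lam : ℝ => lam * C + lam) (𝓝 0) (𝓝 (0 * C + 0)) :=
        Continuous.tendsto (by fun_prop) 0
      rw [zero_mul, zero_add] at this
      exact this.mono_left nhdsWithin_le_nhds
    have h0 : (sliceForce F l t₁).real K ≤ 0 :=
      ge_of_tendsto hlim (eventually_of_mem self_mem_nhdsWithin fun lam hlam => hle lam hlam)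
    exact (measureReal_eq_zero_iff).1 (le_antisymm h0 measureReal_nonneg)
  refine Measure.AbsolutelyContinuous.mk fun s hs hs0 => ?_
  have h1 : sliceForce F l t₁ s = sliceForce F l t₁ (s ∩ Ioo 0 l) :=
    (measure_inter_conull' (measure_mono_null (sdiff_subset_compl _ _) sliceForce_compl)).symm
  by_contra hne
  rw [h1] at hne
  -- Inner regularity: a null set of positive slice mass would contain a compact one.
  obtain ⟨K, hKs, hK, hpos⟩ := (hs.inter measurableSet_Ioo).exists_lt_isCompact
    (pos_iff_ne_zero.2 hne)
  exact hpos.ne' (hKnull K hK (hKs.trans inter_subset_right)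
    (measure_mono_null (hKs.trans inter_subset_left) hs0))

end IsWeakSolution

end ViscoString

namespace ViscoString

/-! ### Parabolic boxes -/

/-- The box around `(t, x)` with half-width `δ` in time and `√δ` in space. -/
def parabolicBox (t x δ : ℝ) : Set (ℝ × ℝ) := Metric.closedBall t δ ×ˢ Metric.closedBall x √δ

lemma isCompact_parabolicBox (t x δ : ℝ) : IsCompact (parabolicBox t x δ) :=
  (isCompact_closedBall t δ).prod (isCompact_closedBall x √δ)

lemma tendsto_sqrt_nhdsGT_zero : Tendsto (fun δ : ℝ => √δ) (𝓝[>] 0) (𝓝[>] 0) := by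
  refine tendsto_nhdsWithin_iff.2 ⟨?_, ?_⟩
  · have : Tendsto (fun δ : ℝ => √δ) (𝓝 0) (𝓝 √0) := Real.continuous_sqrt.tendsto 0
    rw [Real.sqrt_zero] at this
    exact this.mono_left nhdsWithin_le_nhds
  · exact eventually_of_mem self_mem_nhdsWithin fun δ hδ => Real.sqrt_pos.2 hδ

lemma eventually_parabolicBox_subset {t x : ℝ} {U : Set (ℝ × ℝ)} (hU : IsOpen U) (hx : (t, x) ∈ U) :
    ∀ᶠ δ in 𝓝[>] (0 : ℝ), parabolicBox t x δ ⊆ U := by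
  obtain ⟨r, hr, hrU⟩ := Metric.isOpen_iff.1 hU _ hx
  have h1 : ∀ᶠ δ in 𝓝[>] (0 : ℝ), √δ < r :=
    (tendsto_sqrt_nhdsGT_zero.mono_right nhdsWithin_le_nhds).eventually (Iio_mem_nhds hr)
  filter_upwards [h1, Ioo_mem_nhdsGT hr] with δ h1 h2
  refine Subset.trans ?_ hrU
  rw [← ball_prod_same]
  exact Set.prod_mono (Metric.closedBall_subset_ball h2.2) (Metric.closedBall_subset_ball h1)

/-- A finite measure that does not charge the line `{t} × ℝ` has zero density with respect to
the parabolic boxes around almost every point of this line. -/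
lemma ae_eventually_measureReal_parabolicBox_le {m : Measure (ℝ × ℝ)} [IsFiniteMeasure m] {t : ℝ}
    (h0 : m (({t} : Set ℝ) ×ˢ univ) = 0) :
    ∀ᵐ x : ℝ, ∀ ε > 0, ∀ᶠ δ in 𝓝[>] (0 : ℝ), m.real (parabolicBox t x δ) ≤ ε * √δ := by
  -- Slabs shrinking to the line, so that their mass tends to `m({t} × ℝ) = 0`. Small parabolic
  -- boxes lie in any given slab, which reduces the claim to differentiating the slab's projection
  -- to the space axis.
  let S : ℕ → Set (ℝ × ℝ) := fun n => Metric.closedBall t (1 / ((n : ℝ) + 1)) ×ˢ univ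
  have hSm : ∀ n, MeasurableSet (S n) := fun n =>
    Metric.isClosed_closedBall.measurableSet.prod MeasurableSet.univ
  let ρ : ℕ → Measure ℝ := fun n => (m.restrict (S n)).map Prod.snd
  have hρ : ∀ n, ρ n univ = m (S n) := fun n => by
    rw [Measure.map_apply measurable_snd MeasurableSet.univ]; simp
  have hlim : Tendsto (fun n => m (S n)) atTop (𝓝 0) := by
    have hanti : Antitone S := fun i j hij => Set.prod_mono
      (Metric.closedBall_subset_closedBall (one_div_le_one_div_of_le (by positivity) (by gcongr))) le_rfl
    have hI : ⋂ n, S n = ({t} : Set ℝ) ×ˢ univ := by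
      ext p
      simp only [S, mem_iInter, mem_prod, Metric.mem_closedBall, mem_univ, and_true,
        mem_singleton_iff]
      constructor
      · intro h
        exact dist_le_zero.1 (ge_of_tendsto' tendsto_one_div_succ h)
      · intro h n
        rw [h, dist_self]
        positivity
    have := tendsto_measure_iInter_atTop (μ := m) (fun n => (hSm n).nullMeasurableSet) hanti
      ⟨0, measure_ne_top _ _⟩
    rwa [hI, h0] at this
  -- The integral of the infimum is at most the mass of each slab, hence zero.
  have hinf : ∀ᵐ x : ℝ, ⨅ n, (ρ n).rnDeriv volume x = 0 := by
    have hmeas : Measurable fun x => ⨅ n, (ρ n).rnDeriv volume x :=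
      Measurable.iInf fun n => Measure.measurable_rnDeriv _ _
    refine (lintegral_eq_zero_iff hmeas).1 (le_antisymm (ge_of_tendsto' hlim fun n => ?_) bot_le)
    calc _ ≤ ∫⁻ x, (ρ n).rnDeriv volume x := lintegral_mono fun x => iInf_le _ n
      _ ≤ ρ n univ := Measure.lintegral_rnDeriv_le
      _ = _ := hρ n
  have hder : ∀ᵐ x : ℝ, ∀ n, Tendsto
      (fun r => ρ n (Metric.closedBall x r) / volume (Metric.closedBall x r)) (𝓝[>] 0)
      (𝓝 ((ρ n).rnDeriv volume x)) :=
    ae_all_iff.2 fun n => Besicovitch.ae_tendsto_rnDeriv (ρ n) volume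
  filter_upwards [hinf, hder] with x hx hxd ε hε
  -- The factor `1/2` compensates the length `2√δ` of the ball of radius `√δ`.
  obtain ⟨n, hn⟩ := iInf_lt_iff.1 (show ⨅ n, (ρ n).rnDeriv volume x < ENNReal.ofReal (ε / 2) by
    rw [hx]; exact ENNReal.ofReal_pos.2 (half_pos hε))
  have hev := tendsto_sqrt_nhdsGT_zero.eventually ((hxd n).eventually (Iio_mem_nhds hn))
  have hn0 : 0 < 1 / ((n : ℝ) + 1) := by positivity
  filter_upwards [hev, Ioo_mem_nhdsGT hn0] with δ h1 h2
  have hr : 0 < √δ := Real.sqrt_pos.2 h2.1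
  rw [Real.volume_closedBall] at h1
  have h3 : ρ n (Metric.closedBall x √δ) ≤ ENNReal.ofReal (ε / 2) * ENNReal.ofReal (2 * √δ) :=
    (ENNReal.div_le_iff (by simpa using hr) ENNReal.ofReal_ne_top).1 h1.le
  rw [← ENNReal.ofReal_mul (half_pos hε).le, show ε / 2 * (2 * √δ) = ε * √δ by ring] at h3
  refine ENNReal.toReal_le_of_le_ofReal (by positivity) (le_trans ?_ h3)
  rw [Measure.map_apply measurable_snd Metric.isClosed_closedBall.measurableSet,
    Measure.restrict_apply (measurable_snd Metric.isClosed_closedBall.measurableSet)]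
  refine measure_mono fun p hp => ⟨hp.2, ?_, mem_univ _⟩
  exact Metric.closedBall_subset_closedBall h2.2.le hp.1

lemma volume_real_parabolicBox {t x δ : ℝ} (hδ : 0 ≤ δ) :
    volume.real (parabolicBox t x δ) = 4 * δ * √δ := by
  rw [parabolicBox, measureReal_def, Measure.volume_eq_prod, Measure.prod_prod,
    Real.volume_closedBall, Real.volume_closedBall, ENNReal.toReal_mul,
    ENNReal.toReal_ofReal (by positivity), ENNReal.toReal_ofReal (by positivity)]
  ring

/-- The mass of a square integrable function in parabolic boxes is small. -/
lemma ae_eventually_setIntegral_parabolicBox_le {u : ℝ × ℝ → ℝ} (hu : MemLp u 2) (t : ℝ) :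
    ∀ᵐ x : ℝ, ∀ ε > 0, ∀ᶠ δ in 𝓝[>] (0 : ℝ), ∫ p in parabolicBox t x δ, |u p| ≤ ε * δ := by
  -- The measure with density `u²` is finite and does not charge the Lebesgue null line, so its mass
  -- in the boxes is `o(√δ)`.
  set m : Measure (ℝ × ℝ) := volume.withDensity fun p => ENNReal.ofReal (u p ^ 2) with hm
  have hfin : IsFiniteMeasure m := isFiniteMeasure_withDensity_ofReal hu.integrable_sq.2
  have h0 : m (({t} : Set ℝ) ×ˢ univ) = 0 :=
    withDensity_absolutelyContinuous _ _ (volume_line t)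
  filter_upwards [ae_eventually_measureReal_parabolicBox_le h0] with x hx ε hε
  -- The box has area `4δ√δ`; by Cauchy–Schwarz the squared integral is at most `4δ√δ · (ε²/4)√δ =
  -- (εδ)²`.
  filter_upwards [hx (ε ^ 2 / 4) (by positivity), self_mem_nhdsWithin] with δ h1 hδ
  have hδ0 : 0 < δ := hδ
  have hB : MeasurableSet (parabolicBox t x δ) := (isCompact_parabolicBox t x δ).measurableSet
  have : IsFiniteMeasure (volume.restrict (parabolicBox t x δ)) :=
    isFiniteMeasure_restrict.2 (isCompact_parabolicBox t x δ).measure_ne_top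
  have hcs := integral_abs_sq_le (hu.restrict (parabolicBox t x δ))
  rw [measureReal_restrict_apply_univ, volume_real_parabolicBox hδ0.le] at hcs
  have h2 : ∫ p in parabolicBox t x δ, u p ^ 2 = m.real (parabolicBox t x δ) := by
    rw [measureReal_def, hm, withDensity_apply _ hB,
      integral_eq_lintegral_of_nonneg_ae (Eventually.of_forall fun p => sq_nonneg _)
      (hu.1.restrict.pow 2)]
  have hsq : √δ * √δ = δ := Real.mul_self_sqrt hδ0.le
  rw [h2] at hcs
  refine le_of_sq_le_sq ?_ (by positivity)
  calc _ ≤ 4 * δ * √δ * m.real (parabolicBox t x δ) := hcs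
    _ ≤ 4 * δ * √δ * (ε ^ 2 / 4 * √δ) := by gcongr
    _ = ε ^ 2 * δ * (√δ * √δ) := by ring
    _ = _ := by rw [hsq]; ring

/-- The mass of a locally finite measure in parabolic boxes, away from their central line. -/
lemma ae_eventually_measureReal_parabolicBox_sdiff_le {m : Measure (ℝ × ℝ)}
    [IsLocallyFiniteMeasure m] (t a b : ℝ) :
    ∀ᵐ x ∂(volume.restrict (Ioo a b)), ∀ ε > 0, ∀ᶠ δ in 𝓝[>] (0 : ℝ),
      m.real (parabolicBox t x δ \ ({t} : Set ℝ) ×ˢ univ) ≤ ε * √δ := by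
  -- Restricting `m` to a compact set with the line removed gives a finite measure that does not
  -- charge the line and agrees with `m` on small boxes off the line.
  set K : Set (ℝ × ℝ) := Metric.closedBall t 1 ×ˢ Icc a b with hK
  have hKc : IsCompact K := (isCompact_closedBall _ _).prod isCompact_Icc
  have hL : MeasurableSet (({t} : Set ℝ) ×ˢ (univ : Set ℝ)) :=
    (measurableSet_singleton t).prod MeasurableSet.univ
  have : IsFiniteMeasure (m.restrict (K \ ({t} : Set ℝ) ×ˢ univ)) :=
    isFiniteMeasure_restrict.2 (ne_top_of_le_ne_top hKc.measure_ne_top (measure_mono sdiff_subset))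
  have h0 : m.restrict (K \ ({t} : Set ℝ) ×ˢ univ) (({t} : Set ℝ) ×ˢ univ) = 0 := by
    rw [Measure.restrict_apply hL, inter_sdiff_self]; simp
  filter_upwards [ae_restrict_of_ae (ae_eventually_measureReal_parabolicBox_le h0),
    ae_restrict_mem measurableSet_Ioo] with x hx hxm ε hε
  have hsub := eventually_parabolicBox_subset (t := t) (x := x)
    (Metric.isOpen_ball (x := t) (ε := 1) |>.prod (isOpen_Ioo (a := a) (b := b)))
    (mk_mem_prod (Metric.mem_ball_self one_pos) hxm)
  filter_upwards [hx ε hε, hsub] with δ h1 h2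
  refine le_trans (le_of_eq ?_) h1
  rw [measureReal_def, measureReal_def,
    Measure.restrict_apply (isCompact_parabolicBox t x δ).measurableSet]
  congr 2
  ext p
  simp only [Set.mem_sdiff, mem_inter_iff]
  refine ⟨fun hp => ⟨hp.1, ?_, hp.2⟩, fun hp => ⟨hp.1, hp.2.2⟩⟩
  exact Set.prod_mono Metric.ball_subset_closedBall Ioo_subset_Icc_self (h2 hp.1)

/-! ### Rescaled bump functions -/

/-- One profile rescaled, so `C` is universal. At `r = √δ` the height is `C/√δ` and the slope `C/δ`,
matching the bounds `o(√δ)` and `o(δ)` for force and stress in parabolic boxes. -/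
lemma exists_rescaled_bump : ∃ C, 0 ≤ C ∧ ∀ x r : ℝ, 0 < r → ∃ θ : ℝ → ℝ, ContDiff ℝ ∞ θ ∧
    tsupport θ ⊆ Metric.closedBall x r ∧ (∀ y, 0 ≤ θ y) ∧ (∀ y, θ y ≤ C / r) ∧
    (∀ y, |deriv θ y| ≤ C / r ^ 2) ∧ ∫ y, θ y = 1 := by
  let f : ContDiffBump (0 : ℝ) := ⟨1 / 2, 1, by norm_num, by norm_num⟩
  set ψ : ℝ → ℝ := f.normed volume with hψ
  have hψc : ContDiff ℝ ∞ ψ := f.contDiff_normed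
  have hψs : HasCompactSupport ψ := f.hasCompactSupport_normed
  obtain ⟨M, hM⟩ := exists_abs_le_of_hasCompactSupport hψc.continuous hψs
  obtain ⟨N, hN⟩ := exists_abs_le_of_hasCompactSupport (hψc.continuous_deriv (by simp)) hψs.deriv
  have hM0 : 0 ≤ M := (abs_nonneg _).trans (hM 0)
  refine ⟨max M N, le_max_of_le_left hM0, fun x r hr => ?_⟩
  refine ⟨fun y => 1 / r * ψ ((y - x) / r), ?_, ?_, ?_, ?_, ?_, ?_⟩
  · exact contDiff_const.mul (hψc.comp ((contDiff_id.sub contDiff_const).div_const r))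
  · refine closure_minimal (fun y hy => ?_) Metric.isClosed_closedBall
    have h1 : ψ ((y - x) / r) ≠ 0 := fun h => hy (by simp only [h, mul_zero])
    have h2 : (y - x) / r ∈ Metric.ball (0 : ℝ) 1 := by
      rw [← show Function.support ψ = Metric.ball (0 : ℝ) 1 from f.support_normed_eq]
      exact h1
    rw [mem_ball_zero_iff, Real.norm_eq_abs, abs_div, abs_of_pos hr, div_lt_one hr] at h2
    rw [Metric.mem_closedBall, Real.dist_eq]
    exact h2.le
  · exact fun y => mul_nonneg (one_div_pos.2 hr).le (f.nonneg_normed _)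
  · intro y
    have h1 : ψ ((y - x) / r) ≤ max M N := ((le_abs_self _).trans (hM _)).trans (le_max_left _ _)
    calc _ ≤ 1 / r * max M N := mul_le_mul_of_nonneg_left h1 (one_div_pos.2 hr).le
      _ = _ := by ring
  · intro y
    have hd : HasDerivAt (fun y => 1 / r * ψ ((y - x) / r)) (1 / r * (deriv ψ ((y - x) / r) * (1 / r)))
        y := by
      refine HasDerivAt.const_mul _ ?_
      refine HasDerivAt.comp y (hψc.differentiable (by simp) _).hasDerivAt ?_
      exact ((hasDerivAt_id y).sub_const x).div_const r
    rw [hd.deriv, abs_mul, abs_mul, abs_of_pos (one_div_pos.2 hr)]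
    calc _ ≤ 1 / r * (max M N * (1 / r)) := by
          gcongr
          exact (hN _).trans (le_max_right _ _)
      _ = _ := by ring
  · rw [integral_const_mul, integral_sub_right_eq_self (fun y => ψ (y / r)) x,
      Measure.integral_comp_div, show ∫ y, ψ y = 1 from f.integral_normed, abs_of_pos hr]
    simp [hr.ne']

end ViscoString

namespace ViscoString

/-! ### Pointwise convergence of the velocity jump -/

lemma ae_eventually_setIntegral_parabolicBox_le_of_isOpen {u : ℝ × ℝ → ℝ} {U : Set (ℝ × ℝ)}
    (hU : IsOpen U) (hu : MemLp u 2 (volume.restrict U)) {t a b : ℝ}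
    (hUt : ∀ x ∈ Ioo a b, (t, x) ∈ U) :
    ∀ᵐ x ∂(volume.restrict (Ioo a b)), ∀ ε > 0, ∀ᶠ δ in 𝓝[>] (0 : ℝ),
      ∫ p in parabolicBox t x δ, |u p| ≤ ε * δ := by
  have h1 := ae_eventually_setIntegral_parabolicBox_le
    ((memLp_indicator_iff_restrict hU.measurableSet).2 hu) t
  filter_upwards [ae_restrict_of_ae h1, ae_restrict_mem measurableSet_Ioo] with x hx hxm ε hε
  filter_upwards [hx ε hε, eventually_parabolicBox_subset hU (hUt x hxm)] with δ h2 h3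
  rwa [setIntegral_congr_fun (g := fun p => |u p|) (isCompact_parabolicBox t x δ).measurableSet
    fun p hp => by simp only [indicator_of_mem (h3 hp)]] at h2

lemma abs_sub_setIntegral_mul_le {s : Set ℝ} {θ g : ℝ → ℝ} (c : ℝ) (hθ : IsTestFunction s θ)
    (h0 : ∀ y, 0 ≤ θ y) (h1 : ∫ y, θ y = 1) (hg : LocallyIntegrableOn g s) :
    IntegrableOn (fun y => |g y - c| * θ y) s ∧
    |c - ∫ y in s, g y * θ y| ≤ ∫ y in s, |g y - c| * θ y := by
  have hθi : Integrable θ := hθ.1.continuous.integrable_of_hasCompactSupport hθ.2.1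
  obtain ⟨N, hN⟩ := exists_abs_le_of_hasCompactSupport hθ.1.continuous hθ.2.1
  have hgi : Integrable (fun y => g y * θ y) := integrable_mul_of_bounded hθ.2.1.measurableSet
    (hg.integrableOn_compact_subset hθ.2.2 hθ.2.1) hθ.1.continuous.measurable hN
    fun x hx => image_eq_zero_of_notMem_tsupport hx
  have hone : ∫ y in s, θ y = 1 := by
    rw [← h1]
    exact setIntegral_eq_integral_of_forall_compl_eq_zero fun y hy =>
      image_eq_zero_of_notMem_tsupport fun h => hy (hθ.2.2 h)
  have hd : Integrable (fun y => c * θ y - g y * θ y) := (hθi.const_mul c).sub hgi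
  have habs : ∀ y, |c * θ y - g y * θ y| = |g y - c| * θ y := fun y => by
    rw [← sub_mul, abs_mul, abs_of_nonneg (h0 y), abs_sub_comm]
  refine ⟨(hd.abs.congr (Eventually.of_forall habs)).integrableOn, ?_⟩
  have : c - ∫ y in s, g y * θ y = ∫ y in s, (c * θ y - g y * θ y) := by
    rw [integral_sub (hθi.const_mul c).integrableOn hgi.integrableOn, integral_const_mul, hone, mul_one]
  rw [this]
  refine abs_integral_le_integral_abs.trans (le_of_eq ?_)
  simp_rw [habs]

/-- A smooth average of a function near a Lebesgue point. -/
lemma abs_sub_setIntegral_mul_le_average {s : Set ℝ} {θ g : ℝ → ℝ} {x r C : ℝ} (hr : 0 < r)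
    (hθ : IsTestFunction s θ) (h0 : ∀ y, 0 ≤ θ y) (h1 : ∫ y, θ y = 1) (hC : ∀ y, θ y ≤ C / r)
    (hsupp : tsupport θ ⊆ Metric.closedBall x r) (hg : Integrable g) :
    |g x - ∫ y in s, g y * θ y| ≤ 2 * C * ⨍ y in Metric.closedBall x r, ‖g y - g x‖ := by
  obtain ⟨i1, h2⟩ := abs_sub_setIntegral_mul_le (g x) hθ h0 h1
    (hg.locallyIntegrable.locallyIntegrableOn s)
  have hB : MeasurableSet (Metric.closedBall x r) := Metric.isClosed_closedBall.measurableSet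
  have hi : IntegrableOn (fun y => |g y - g x|) (Metric.closedBall x r) :=
    (hg.integrableOn.sub (integrableOn_const (isCompact_closedBall x r).measure_ne_top)).abs
  refine h2.trans ?_
  -- The average divides by `2r` and the kernel is at most `C/r`; their ratio is the factor `2C`.
  rw [setAverage_eq, Real.volume_real_closedBall hr.le, smul_eq_mul]
  calc ∫ y in s, |g y - g x| * θ y
      ≤ ∫ y in s, (Metric.closedBall x r).indicator (fun y => C / r * |g y - g x|) y := by
        refine integral_mono i1
          ((integrable_indicator_iff hB).2 (hi.const_mul _)).integrableOn fun y => ?_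
        by_cases hy : y ∈ Metric.closedBall x r
        · simp only [hy, indicator_of_mem]
          rw [mul_comm]
          exact mul_le_mul_of_nonneg_right (hC y) (abs_nonneg _)
        · simp only [hy, not_false_eq_true, indicator_of_notMem]
          rw [image_eq_zero_of_notMem_tsupport fun h => hy (hsupp h), mul_zero]
    _ ≤ ∫ y, (Metric.closedBall x r).indicator (fun y => C / r * |g y - g x|) y := by
        refine setIntegral_le_integral ((integrable_indicator_iff hB).2 (hi.const_mul _))
          (Eventually.of_forall fun y => indicator_nonneg (fun y _ => ?_) y)
        have := (h0 x).trans (hC x)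
        positivity
    _ = C / r * ∫ y in Metric.closedBall x r, |g y - g x| := by
        rw [integral_indicator hB, integral_const_mul]
    _ = _ := by
        simp only [Real.norm_eq_abs]
        field_simp

variable {l h : ℝ} {ζ : ℝ × ℝ → ℝ} {η₀ η₀x v₀ : ℝ → ℝ} {η ηt ηx ηtx : ℝ × ℝ → ℝ}
  {F D : Measure (ℝ × ℝ)}

namespace IsWeakSolution

/-- The difference of the jumps at two places is `1/δ` times the difference of two mixed differences
of `η`, over adjacent rectangles after and before `t₁`. Each is an integral of `ηtx`. -/
lemma abs_velocityJump_sub_le_of_le (hsol : IsWeakSolution l h ζ η₀ η₀x v₀ η ηt ηx ηtx F D)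
    (hl : 0 < l) {t₁ δ a b : ℝ} {B : Set (ℝ × ℝ)} (hδ : 0 < δ) (hδt : δ < t₁) (hab : a ≤ b)
    (ha : 0 < a) (hb : b < l) (hB : IsCompact B) (hBd : B ⊆ domain l)
    (hsub : Ioc (t₁ - δ) (t₁ + δ) ×ˢ Ioc a b ⊆ B) :
    |velocityJump η t₁ δ b - velocityJump η t₁ δ a| ≤ 1 / δ * ∫ p in B, |ηtx p| := by
  have ha' : a ∈ Ioo 0 l := ⟨ha, hab.trans_lt hb⟩
  have hb' : b ∈ Ioo 0 l := ⟨ha.trans_le hab, hb⟩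
  have hloc := hsol.weakDeriv_tx.2.1
  have e1 := hsol.mixed_difference hl (s := t₁) (t := t₁ + δ) (by linarith) (by linarith) ha' hb'
  have e2 := hsol.mixed_difference hl (s := t₁ - δ) (t := t₁) (by linarith) (by linarith) ha' hb'
  rw [← setIntegral_rectangle hloc (by linarith) (by linarith) ha hab hb] at e1 e2
  have hi : IntegrableOn (fun p => |ηtx p|) B := (hloc.integrableOn_compact_subset hBd hB).abs
  have hd : Disjoint (Ioc t₁ (t₁ + δ) ×ˢ Ioc a b) (Ioc (t₁ - δ) t₁ ×ˢ Ioc a b) :=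
    Disjoint.set_prod_left (Ioc_disjoint_Ioc_of_le le_rfl).symm _ _
  have hu : Ioc t₁ (t₁ + δ) ×ˢ Ioc a b ∪ Ioc (t₁ - δ) t₁ ×ˢ Ioc a b ⊆ B := by
    refine Subset.trans (union_subset ?_ ?_) hsub
    · exact Set.prod_mono (Ioc_subset_Ioc_left (by linarith)) le_rfl
    · exact Set.prod_mono (Ioc_subset_Ioc_right (by linarith)) le_rfl
  have key : velocityJump η t₁ δ b - velocityJump η t₁ δ a
      = 1 / δ * ((∫ z in Ioc t₁ (t₁ + δ) ×ˢ Ioc a b, ηtx z)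
        - ∫ z in Ioc (t₁ - δ) t₁ ×ˢ Ioc a b, ηtx z) := by
    rw [← e1, ← e2, velocityJump, velocityJump]; ring
  rw [key, abs_mul, abs_of_pos (one_div_pos.2 hδ)]
  refine mul_le_mul_of_nonneg_left ?_ (one_div_pos.2 hδ).le
  calc _ ≤ (∫ z in Ioc t₁ (t₁ + δ) ×ˢ Ioc a b, |ηtx z|)
        + ∫ z in Ioc (t₁ - δ) t₁ ×ˢ Ioc a b, |ηtx z| :=
        (abs_sub _ _).trans (add_le_add abs_integral_le_integral_abs abs_integral_le_integral_abs)
    _ = ∫ z in Ioc t₁ (t₁ + δ) ×ˢ Ioc a b ∪ Ioc (t₁ - δ) t₁ ×ˢ Ioc a b, |ηtx z| :=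
        (setIntegral_union hd (measurableSet_Ioc.prod measurableSet_Ioc)
          (hi.mono_set (subset_union_left.trans hu)) (hi.mono_set (subset_union_right.trans hu))).symm
    _ ≤ _ := setIntegral_mono_set hi (Eventually.of_forall fun p => abs_nonneg _)
        (LE.le.eventuallyLE hu)

lemma abs_velocityJump_sub_le (hsol : IsWeakSolution l h ζ η₀ η₀x v₀ η ηt ηx ηtx F D)
    (hl : 0 < l) {t₁ δ x y : ℝ} (hδ : 0 < δ) (hδt : δ < t₁)
    (hBd : parabolicBox t₁ x δ ⊆ domain l) (hy : y ∈ Metric.closedBall x √δ) :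
    |velocityJump η t₁ δ y - velocityJump η t₁ δ x|
      ≤ 1 / δ * ∫ p in parabolicBox t₁ x δ, |ηtx p| := by
  have hdom : ∀ z ∈ Metric.closedBall x √δ, z ∈ Ioo 0 l := fun z hz =>
    (hBd (mk_mem_prod (Metric.mem_closedBall_self hδ.le) hz)).2
  have hx : x ∈ Metric.closedBall x √δ := Metric.mem_closedBall_self (Real.sqrt_nonneg _)
  have hsub : ∀ a b, a ∈ Metric.closedBall x √δ → b ∈ Metric.closedBall x √δ →
      Ioc (t₁ - δ) (t₁ + δ) ×ˢ Ioc a b ⊆ parabolicBox t₁ x δ := by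
    intro a b ha hb
    rw [Real.closedBall_eq_Icc] at ha hb
    rw [parabolicBox, Real.closedBall_eq_Icc, Real.closedBall_eq_Icc]
    exact Set.prod_mono Ioc_subset_Icc_self (Ioc_subset_Icc_self.trans (Icc_subset_Icc ha.1 hb.2))
  rcases le_total x y with hxy | hxy
  · exact hsol.abs_velocityJump_sub_le_of_le hl hδ hδt hxy (hdom x hx).1 (hdom y hy).2
      (isCompact_parabolicBox _ _ _) hBd (hsub x y hx hy)
  · rw [abs_sub_comm]
    exact hsol.abs_velocityJump_sub_le_of_le hl hδ hδt hxy (hdom y hy).1 (hdom x hx).2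
      (isCompact_parabolicBox _ _ _) hBd (hsub y x hy hx)

/-- The error made when a mean of the velocity jump is replaced by the force. -/
lemma abs_setIntegral_velocityJump_sub_le (hsol : IsWeakSolution l h ζ η₀ η₀x v₀ η ηt ηx ηtx F D)
    (hl : 0 < l) {t₁ δ x A B : ℝ} {θ : ℝ → ℝ} (hδ : 0 < δ) (hδt : δ < t₁)
    (hBd : parabolicBox t₁ x δ ⊆ domain l) (hθ : IsTestFunction (Ioo 0 l) θ)
    (hsupp : tsupport θ ⊆ Metric.closedBall x √δ) (hA : ∀ y, |θ y| ≤ A)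
    (hB : ∀ y, |deriv θ y| ≤ B) :
    |(∫ y in Ioo 0 l, velocityJump η t₁ δ y * θ y) - ∫ y, θ y ∂(sliceForce F l t₁)|
      ≤ A * F.real (parabolicBox t₁ x δ \ ({t₁} : Set ℝ) ×ˢ univ)
        + B * ∫ p in parabolicBox t₁ x δ, |ηtx p + ηx p| := by
  have hlf := hsol.force_locallyFinite
  have hbm : MeasurableSet (parabolicBox t₁ x δ) := (isCompact_parabolicBox _ _ _).measurableSet
  have hL : MeasurableSet (({t₁} : Set ℝ) ×ˢ (univ : Set ℝ)) :=
    (measurableSet_singleton _).prod MeasurableSet.univ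
  have hoff : ∀ p, p ∉ parabolicBox t₁ x δ → tent δ (p.1 - t₁) * θ p.2 = 0 ∧
      tent δ (p.1 - t₁) * deriv θ p.2 = 0 := by
    intro p hp
    rw [parabolicBox, mem_prod, not_and_or] at hp
    rcases hp with hp | hp
    · rw [Metric.mem_closedBall, Real.dist_eq, not_le] at hp
      simp [tent_of_le_abs hδ hp.le]
    · have h1 : p.2 ∉ tsupport θ := fun h' => hp (hsupp h')
      have h2 : p.2 ∉ tsupport (deriv θ) := fun h' => h1 (tsupport_deriv_subset h')
      simp [image_eq_zero_of_notMem_tsupport h1, image_eq_zero_of_notMem_tsupport h2]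
  have htb : ∀ y c M : ℝ, |c| ≤ M → |tent δ y * c| ≤ M := fun y c M hc => by
    rw [abs_mul, abs_of_nonneg (tent_nonneg hδ _)]
    exact (mul_le_of_le_one_left (abs_nonneg _) (tent_le_one hδ _)).trans hc
  have hcont : Continuous fun p : ℝ × ℝ => tent δ (p.1 - t₁) * θ p.2 :=
    ((tent_continuous δ).comp (by fun_prop)).mul (hθ.1.continuous.comp continuous_snd)
  have hint : Integrable (fun p : ℝ × ℝ => tent δ (p.1 - t₁) * θ p.2) F :=
    hcont.integrable_of_hasCompactSupport
      (HasCompactSupport.intro (isCompact_parabolicBox t₁ x δ) fun p hp => (hoff p hp).1)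
  -- The tent equals 1 on the line, so this part of the force integral is already the slice, with no
  -- error; only the force off the line must be estimated.
  have e1 : ∫ p in ({t₁} : Set ℝ) ×ˢ univ, tent δ (p.1 - t₁) * θ p.2 ∂F
      = ∫ y, θ y ∂(sliceForce F l t₁) := by
    rw [← setIntegral_line_eq hθ]
    refine setIntegral_congr_fun hL fun p hp => ?_
    have : p.1 = t₁ := hp.1
    simp [this, tent_zero hδ]
  have e2 : ∫ p in (({t₁} : Set ℝ) ×ˢ univ)ᶜ, tent δ (p.1 - t₁) * θ p.2 ∂F
      = ∫ p in parabolicBox t₁ x δ \ ({t₁} : Set ℝ) ×ˢ univ, tent δ (p.1 - t₁) * θ p.2 ∂F := by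
    refine setIntegral_eq_of_subset_of_forall_sdiff_eq_zero hL.compl (sdiff_subset_compl _ _) ?_
    rintro p ⟨hp, hp'⟩
    exact (hoff p fun h' => hp' ⟨h', hp⟩).1
  have b1 : |∫ p in parabolicBox t₁ x δ \ ({t₁} : Set ℝ) ×ˢ univ, tent δ (p.1 - t₁) * θ p.2 ∂F|
      ≤ A * F.real (parabolicBox t₁ x δ \ ({t₁} : Set ℝ) ×ˢ univ) := by
    rw [← Real.norm_eq_abs]
    refine norm_setIntegral_le_of_norm_le_const ?_ fun p _ => htb _ _ _ (hA _)
    exact (measure_mono sdiff_subset).trans_lt (isCompact_parabolicBox _ _ _).measure_lt_top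
  have hw : IntegrableOn (fun p => ηtx p + ηx p) (parabolicBox t₁ x δ) :=
    hsol.locallyIntegrableOn_stress.integrableOn_compact_subset hBd (isCompact_parabolicBox _ _ _)
  have b2 : |∫ p in domain l, (ηtx p + ηx p) * (tent δ (p.1 - t₁) * deriv θ p.2)|
      ≤ B * ∫ p in parabolicBox t₁ x δ, |ηtx p + ηx p| := by
    rw [setIntegral_eq_of_subset_of_forall_sdiff_eq_zero (measurableSet_domain l) hBd
      fun p hp => by rw [(hoff p hp.2).2, mul_zero], ← Real.norm_eq_abs, ← integral_const_mul]
    refine norm_integral_le_of_norm_le (hw.abs.const_mul B) (Eventually.of_forall fun p => ?_)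
    rw [norm_mul, mul_comm, Real.norm_eq_abs, Real.norm_eq_abs]
    exact mul_le_mul_of_nonneg_right (htb _ _ _ (hB _)) (abs_nonneg _)
  rw [hsol.setIntegral_velocityJump_mul hl hδ hδt hθ, ← integral_add_compl hL hint, e1, e2]
  rw [abs_le] at b1 b2 ⊢
  constructor <;> linarith [b1.1, b1.2, b2.1, b2.2]

/-- The density of the contact force at time `t₁`. -/
lemma ae_tendsto_velocityJump (hsol : IsWeakSolution l h ζ η₀ η₀x v₀ η ηt ηx ηtx F D) (hl : 0 < l)
    {t₁ : ℝ} (ht₁ : 0 < t₁) :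
    ∀ᵐ x ∂(volume.restrict (Ioo 0 l)), Tendsto (fun δ => velocityJump η t₁ δ x) (𝓝[>] 0)
      (𝓝 ((sliceForce F l t₁).rnDeriv volume x).toReal) := by
  have hlf := hsol.force_locallyFinite
  have hfin : IsFiniteMeasure (sliceForce F l t₁) := isFiniteMeasure_sliceForce
  have hac := hsol.sliceForce_absolutelyContinuous hl ht₁
  set f : ℝ → ℝ := fun x => ((sliceForce F l t₁).rnDeriv volume x).toReal with hf
  have hfi : Integrable f := Measure.integrable_toReal_rnDeriv
  obtain ⟨C, hC0, hC⟩ := exists_rescaled_bump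
  have hUo : IsOpen (Ioo 0 (t₁ + 1) ×ˢ Ioo 0 l) := isOpen_Ioo.prod isOpen_Ioo
  have hUd : Ioo 0 (t₁ + 1) ×ˢ Ioo 0 l ⊆ domain l := Set.prod_mono Ioo_subset_Ioi_self le_rfl
  have htx : MemLp ηtx 2 (volume.restrict (Ioo 0 (t₁ + 1) ×ˢ Ioo 0 l)) :=
    hsol.memLp_tx.mono_measure (Measure.restrict_mono hUd le_rfl)
  have hUt : ∀ x ∈ Ioo 0 l, (t₁, x) ∈ Ioo 0 (t₁ + 1) ×ˢ Ioo 0 l := fun x hx =>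
    mk_mem_prod ⟨ht₁, by linarith⟩ hx
  have a1 := ae_eventually_setIntegral_parabolicBox_le_of_isOpen hUo htx hUt
  have a2 := ae_eventually_setIntegral_parabolicBox_le_of_isOpen hUo
    (htx.add (hsol.bound_x.memLp (t₁ + 1))) hUt
  have a3 := ae_eventually_measureReal_parabolicBox_sdiff_le (m := F) t₁ 0 l
  have a4 := (Besicovitch.vitaliFamily (volume : Measure ℝ)).ae_tendsto_average_norm_sub
    hfi.locallyIntegrable
  filter_upwards [a1, a2, a3, ae_restrict_of_ae a4, ae_restrict_mem measurableSet_Ioo]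
    with x b1 b2 b3 b4 hx
  have b4' := (b4.comp (Besicovitch.tendsto_filterAt volume x)).comp tendsto_sqrt_nhdsGT_zero
  -- Three errors add up: `ε` from the oscillation of the jump over the box, `2Cε` from replacing
  -- its average by the force, and `2Cε` from the Lebesgue point property of the density.
  have main : ∀ ε > 0, ∀ᶠ δ in 𝓝[>] (0 : ℝ), |velocityJump η t₁ δ x - f x| ≤ ε * (1 + 4 * C) := by
    intro ε hε
    filter_upwards [b1 ε hε, b2 ε hε, b3 ε hε, b4'.eventually (Iio_mem_nhds hε), Ioo_mem_nhdsGT ht₁,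
      eventually_parabolicBox_subset (isOpen_domain l) (mk_mem_prod (mem_Ioi.2 ht₁) hx)]
      with δ c1 c2 c3 c4 hδ hBd
    have hδ0 := hδ.1
    have hr : 0 < √δ := Real.sqrt_pos.2 hδ0
    have hrr : √δ ^ 2 = δ := Real.sq_sqrt hδ0.le
    obtain ⟨θ, hθc, hθs, hθ0, hθC, hθd, hθ1⟩ := hC x √δ hr
    have hsub : Metric.closedBall x √δ ⊆ Ioo 0 l := fun z hz =>
      (hBd (mk_mem_prod (Metric.mem_closedBall_self hδ0.le) hz)).2
    have hθ : IsTestFunction (Ioo 0 l) θ := isTestFunction_of_support hθc (isCompact_closedBall x √δ)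
      hsub fun y hy => image_eq_zero_of_notMem_tsupport fun h' => hy (hθs h')
    have hJ := (hsol.velocityJump_continuousOn hδ0 hδ.2).locallyIntegrableOn (μ := volume)
      measurableSet_Ioo
    have d1 : |velocityJump η t₁ δ x - ∫ y in Ioo 0 l, velocityJump η t₁ δ y * θ y| ≤ ε := by
      obtain ⟨i1, i2⟩ := abs_sub_setIntegral_mul_le (velocityJump η t₁ δ x) hθ hθ0 hθ1 hJ
      refine i2.trans ?_
      have hθi : Integrable θ := hθ.1.continuous.integrable_of_hasCompactSupport hθ.2.1
      calc _ ≤ ∫ y in Ioo 0 l, ε * θ y := by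
            refine integral_mono i1 (hθi.const_mul ε).integrableOn fun y => ?_
            by_cases hy : y ∈ Metric.closedBall x √δ
            · refine mul_le_mul_of_nonneg_right ?_ (hθ0 y)
              refine (hsol.abs_velocityJump_sub_le hl hδ0 hδ.2 hBd hy).trans ?_
              calc _ ≤ 1 / δ * (ε * δ) := by gcongr
                _ = ε := by field_simp
            · simp only [image_eq_zero_of_notMem_tsupport fun h' => hy (hθs h'), mul_zero, le_refl]
        _ ≤ ∫ y, ε * θ y := setIntegral_le_integral (hθi.const_mul ε)
            (Eventually.of_forall fun y => mul_nonneg hε.le (hθ0 y))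
        _ = ε := by rw [integral_const_mul, hθ1, mul_one]
    have d2 := hsol.abs_setIntegral_velocityJump_sub_le hl hδ0 hδ.2 hBd hθ hθs
      (fun y => by rw [abs_of_nonneg (hθ0 y)]; exact hθC y) hθd
    have d2' : C / √δ * F.real (parabolicBox t₁ x δ \ ({t₁} : Set ℝ) ×ˢ univ)
        + C / √δ ^ 2 * ∫ p in parabolicBox t₁ x δ, |ηtx p + ηx p| ≤ 2 * C * ε := by
      calc _ ≤ C / √δ * (ε * √δ) + C / √δ ^ 2 * (ε * δ) := by gcongr; exact c2
        _ = 2 * C * ε := by rw [hrr]; field_simp; ring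
    have d3 : |f x - ∫ y, θ y ∂(sliceForce F l t₁)| ≤ 2 * C * ε := by
      have e := integral_rnDeriv_smul (f := θ) hac
      have e' : ∫ y in Ioo 0 l, f y * θ y = ∫ y, θ y ∂(sliceForce F l t₁) := by
        rw [← e]
        exact setIntegral_eq_integral_of_forall_compl_eq_zero fun y hy => by
          rw [image_eq_zero_of_notMem_tsupport fun h' => hy (hθ.2.2 h'), mul_zero]
      rw [← e']
      refine (abs_sub_setIntegral_mul_le_average hr hθ hθ0 hθ1 hθC hθs hfi).trans ?_
      refine mul_le_mul_of_nonneg_left (le_of_lt c4) (by positivity)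
    have d4 := d2.trans d2'
    rw [abs_le] at d1 d3 d4 ⊢
    constructor <;> linarith [d1.1, d1.2, d3.1, d3.2, d4.1, d4.2]
  rw [Metric.tendsto_nhds]
  intro ε hε
  filter_upwards [main (ε / (2 * (1 + 4 * C))) (by positivity)] with δ hδ
  rw [Real.dist_eq]
  refine hδ.trans_lt ?_
  rw [show ε / (2 * (1 + 4 * C)) * (1 + 4 * C) = ε / 2 by field_simp]
  exact half_lt_self hε

end IsWeakSolution

end ViscoString

namespace ViscoString

/-! ### The density of the contact force at a fixed time -/

variable {l h : ℝ} {ζ : ℝ × ℝ → ℝ} {η₀ η₀x v₀ : ℝ → ℝ} {η ηt ηx ηtx : ℝ × ℝ → ℝ}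
  {F D : Measure (ℝ × ℝ)}

namespace IsWeakSolution

/-- Fatou's lemma along a sequence `δ → 0`, with the uniform `L²` bound of the jumps. -/
lemma memLp_sliceForce_rnDeriv (hsol : IsWeakSolution l h ζ η₀ η₀x v₀ η ηt ηx ηtx F D) (hl : 0 < l)
    {t₁ : ℝ} (ht₁ : 0 < t₁) :
    MemLp (fun x => ((sliceForce F l t₁).rnDeriv volume x).toReal) 2 (volume.restrict (Ioo 0 l)) := by
  obtain ⟨C, hC0, hC⟩ := hsol.exists_velocityJump_bound hl t₁
  set f : ℝ → ℝ := fun x => ((sliceForce F l t₁).rnDeriv volume x).toReal with hf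
  have hfm : Measurable f := (Measure.measurable_rnDeriv _ _).ennreal_toReal
  let d : ℕ → ℝ := fun n => t₁ / 2 * (1 / ((n : ℝ) + 1))
  have hd : ∀ n, 0 < d n ∧ d n < t₁ := fun n => by
    have h1 : 1 / ((n : ℝ) + 1) ≤ 1 := by
      rw [div_le_one (by positivity)]; linarith [n.cast_nonneg (α := ℝ)]
    refine ⟨by positivity, ?_⟩
    calc d n ≤ t₁ / 2 * 1 := mul_le_mul_of_nonneg_left h1 (by positivity)
      _ < t₁ := by linarith
  have hd0 : Tendsto d atTop (𝓝[>] 0) := by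
    refine tendsto_nhdsWithin_iff.2 ⟨?_, Eventually.of_forall fun n => (hd n).1⟩
    have := tendsto_one_div_succ.const_mul (t₁ / 2)
    rwa [mul_zero] at this
  refine (memLp_two_iff_integrable_sq hfm.aestronglyMeasurable).2
    ⟨(hfm.pow_const 2).aestronglyMeasurable, ?_⟩
  rw [hasFiniteIntegral_iff_ofReal (Eventually.of_forall fun x => sq_nonneg _)]
  refine lt_of_le_of_lt ?_ (ENNReal.ofReal_lt_top (r := C))
  have hJm : ∀ n, AEMeasurable (fun x => ENNReal.ofReal (velocityJump η t₁ (d n) x ^ 2))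
      (volume.restrict (Ioo 0 l)) := fun n =>
    ((hC _ (hd n).1 (hd n).2).1.1.aemeasurable.pow_const 2).ennreal_ofReal
  calc ∫⁻ x in Ioo 0 l, ENNReal.ofReal (f x ^ 2)
      ≤ ∫⁻ x in Ioo 0 l, liminf (fun n => ENNReal.ofReal (velocityJump η t₁ (d n) x ^ 2)) atTop := by
        refine lintegral_mono_ae ?_
        filter_upwards [hsol.ae_tendsto_velocityJump hl ht₁] with x hx
        refine le_of_eq (Tendsto.liminf_eq ?_).symm
        exact ENNReal.tendsto_ofReal ((hx.comp hd0).pow 2)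
    _ ≤ liminf (fun n => ∫⁻ x in Ioo 0 l, ENNReal.ofReal (velocityJump η t₁ (d n) x ^ 2)) atTop :=
        lintegral_liminf_le' hJm
    _ ≤ ENNReal.ofReal C := by
        refine liminf_le_of_frequently_le' (Frequently.of_forall fun n => ?_)
        obtain ⟨h1, h2⟩ := hC _ (hd n).1 (hd n).2
        rw [← ofReal_integral_eq_lintegral_ofReal h1.integrable_sq
          (Eventually.of_forall fun x => sq_nonneg _)]
        exact ENNReal.ofReal_le_ofReal h2

lemma restrict_line_eq_prod_withDensity (hsol : IsWeakSolution l h ζ η₀ η₀x v₀ η ηt ηx ηtx F D)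
    (hl : 0 < l) {t₁ : ℝ} (ht₁ : 0 < t₁) {s : Set ℝ} (hs : MeasurableSet s) (hsl : s ⊆ Ioo 0 l) :
    F.restrict (({t₁} : Set ℝ) ×ˢ s) = (Measure.dirac t₁).prod ((volume.restrict s).withDensity
      fun x => ENNReal.ofReal ((sliceForce F l t₁).rnDeriv volume x).toReal) := by
  have hlf := hsol.force_locallyFinite
  have hfin : IsFiniteMeasure (sliceForce F l t₁) := isFiniteMeasure_sliceForce
  have e : (volume.restrict s).withDensity
      (fun x => ENNReal.ofReal ((sliceForce F l t₁).rnDeriv volume x).toReal)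
      = (sliceForce F l t₁).restrict s := by
    conv_rhs => rw [← Measure.withDensity_rnDeriv_eq _ _ (hsol.sliceForce_absolutelyContinuous hl ht₁)]
    rw [restrict_withDensity hs]
    refine withDensity_congr_ae (ae_restrict_of_ae ?_)
    filter_upwards [Measure.rnDeriv_lt_top (sliceForce F l t₁) volume] with x hx
    exact ENNReal.ofReal_toReal hx.ne
  rw [restrict_line_eq_dirac_prod hs hsl, e, Measure.dirac_prod]

/-! ### The renormalized inequality at a fixed time -/

lemma memLp_velocity (hsol : IsWeakSolution l h ζ η₀ η₀x v₀ η ηt ηx ηtx F D) :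
    MemLp (fun p => max 0 (ηt p)) 2 (volume.restrict (domain l)) := by
  have hm : AEStronglyMeasurable (fun p => max 0 (ηt p)) (volume.restrict (domain l)) :=
    (aemeasurable_const.max hsol.memLp_t.1.aemeasurable).aestronglyMeasurable
  refine hsol.memLp_t.mono hm (Eventually.of_forall fun p => ?_)
  rw [Real.norm_eq_abs, Real.norm_eq_abs, abs_of_nonneg (le_max_left _ _)]
  exact max_le (abs_nonneg _) (le_abs_self _)

lemma memLp_indicator_mixed (hsol : IsWeakSolution l h ζ η₀ η₀x v₀ η ηt ηx ηtx F D) :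
    MemLp ({q | 0 < ηt q}.indicator ηtx) 2 (volume.restrict (domain l)) :=
  hsol.memLp_tx.mono (hsol.memLp_tx.1.indicator₀
    (nullMeasurableSet_lt aemeasurable_const hsol.memLp_t.1.aemeasurable))
    (Eventually.of_forall fun _ => norm_indicator_le_norm_self _ _)

lemma integrableOn_slope_mul (hsol : IsWeakSolution l h ζ η₀ η₀x v₀ η ηt ηx ηtx F D)
    {w : ℝ × ℝ → ℝ} (hw : MemLp w 2 (volume.restrict (domain l))) {K : Set ℝ} (hK : K ⊆ Ioo 0 l)
    (s t : ℝ) (hs : 0 < s) : IntegrableOn (fun p => ηx p * w p) (Icc s t ×ˢ K) := by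
  have h1 : Icc s t ×ˢ K ⊆ Ioo 0 (t + 1) ×ˢ Ioo 0 l :=
    Set.prod_mono (fun y hy => ⟨hs.trans_le hy.1, by linarith [hy.2]⟩) hK
  have h2 : Icc s t ×ˢ K ⊆ domain l := Set.prod_mono (fun y hy => hs.trans_le hy.1) hK
  exact ((hsol.bound_x.memLp (t + 1)).mono_measure (Measure.restrict_mono h1 le_rfl)).integrable_mul
    (hw.mono_measure (Measure.restrict_mono h2 le_rfl))

/-- The kinetic energy of the positive part of the velocity does not increase across `t₁`. -/
lemma exists_kinetic_energy_lower_bound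
    (hsol : IsWeakSolution l h ζ η₀ η₀x v₀ η ηt ηx ηtx F D) {t₁ : ℝ} {θ : ℝ → ℝ} (ht₁ : 0 < t₁)
    (hθ : IsTestFunction (Ioo 0 l) θ) (hθ0 : ∀ y, 0 ≤ θ y) :
    ∃ R : ℝ → ℝ, Tendsto R (𝓝[>] 0) (𝓝 0) ∧ ∀ δ, 0 < δ → δ < t₁ → R δ ≤
      1 / δ * ((∫ x in Ioo 0 l, (∫ τ in (t₁ - δ)..t₁, max 0 (ηt (τ, x)) ^ 2 / 2) * θ x)
        - ∫ x in Ioo 0 l, (∫ τ in t₁..(t₁ + δ), max 0 (ηt (τ, x)) ^ 2 / 2) * θ x) := by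
  have hv := hsol.memLp_velocity
  have hw := hsol.memLp_indicator_mixed
  set v : ℝ × ℝ → ℝ := fun p => max 0 (ηt p) with hvdef
  set w : ℝ × ℝ → ℝ := {q | 0 < ηt q}.indicator ηtx with hwdef
  have hθc := hθ.1.continuous
  have hdc : Continuous (deriv θ) := hθ.1.continuous_deriv (by simp)
  have hds : HasCompactSupport (deriv θ) := hθ.2.1.deriv
  have hdt : tsupport (deriv θ) ⊆ Ioo 0 l := (tsupport_deriv_subset).trans hθ.2.2
  have hsub : ∀ {K : Set ℝ}, K ⊆ Ioo 0 l → ∀ s t : ℝ, 0 < s → Icc s t ×ˢ K ⊆ domain l :=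
    fun hK s t hs => Set.prod_mono (fun y hy => hs.trans_le hy.1) hK
  have i0 : LocallyIntegrableOn (fun p => v p ^ 2 / 2) (domain l) :=
    IntegrableOn.locallyIntegrableOn (hv.integrable_sq.div_const 2)
  have i1 : IntegrableOn (fun p => ηtx p * v p) (domain l) := hsol.memLp_tx.integrable_mul hv
  have i2 : IntegrableOn (fun p => w p ^ 2) (domain l) := hw.integrable_sq
  have j1 := fun s t hs => i1.mono_set (hsub hdt s t hs)
  have j2 := fun s t hs => i2.mono_set (hsub hθ.2.2 s t hs)
  have j3 := hsol.integrableOn_slope_mul hv hdt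
  have j4 := hsol.integrableOn_slope_mul hw hθ.2.2
  -- `R` collects the stress and dissipation terms of the renormalized inequality. Each is an
  -- integrable function weighted by tents that shrink onto a null line.
  refine ⟨fun δ => (∫ p in domain l, ηtx p * v p * (tent δ (p.1 - t₁) * deriv θ p.2))
    + (∫ p in domain l, w p ^ 2 * (tent δ (p.1 - t₁) * θ p.2))
    + (∫ p in domain l, ηx p * v p * (tent δ (p.1 - t₁) * deriv θ p.2))
    + ∫ p in domain l, ηx p * w p * (tent δ (p.1 - t₁) * θ p.2), ?_, fun δ hδ hδt => ?_⟩
  · have := (((tendsto_setIntegral_tent_zero (U := domain l) ht₁ j1 hdc hds).add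
      (tendsto_setIntegral_tent_zero (U := domain l) ht₁ j2 hθc hθ.2.1)).add
      (tendsto_setIntegral_tent_zero (U := domain l) ht₁ j3 hdc hds)).add
      (tendsto_setIntegral_tent_zero (U := domain l) ht₁ j4 hθc hθ.2.1)
    simpa only [add_zero] using this
  · have l0 := tendsto_setIntegral_tentApproxDeriv i0 hδ hδt hθc hθ.2.1 hθ.2.2
    have l1 := tendsto_integral_tentApprox (U := domain l) j1 hδ hδt hdc hds
    have l2 := tendsto_integral_tentApprox (U := domain l) j2 hδ hδt hθc hθ.2.1
    have l3 := tendsto_integral_tentApprox (U := domain l) j3 hδ hδt hdc hds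
    have l4 := tendsto_integral_tentApprox (U := domain l) j4 hδ hδt hθc hθ.2.1
    refine le_of_tendsto_of_tendsto' (((l1.add l2).add l3).add l4) l0 fun n => ?_
    have hφ := isTestFunction_tentApprox hδ hδt hθ n
    -- The choice `b(s) = s²/2` is admissible with `c = 1` and makes `b(v⁺)` the kinetic energy of
    -- the positive velocity.
    have hren := hsol.renormalized (fun s => s ^ 2 / 2) (fun s => s) (fun _ => 1) 1
      (fun s _ => by
        have := ((hasDerivAt_pow 2 s).div_const 2).hasDerivWithinAt (s := Ici 0)
        refine this.congr_deriv ?_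
        norm_num) (fun s _ => hasDerivWithinAt_id s _) continuousOn_const
      (by norm_num) rfl (fun s _ => by simp) (fun s _ => by simp)
      _ ⟨hφ.1, hφ.2.1, hφ.2.2.trans (Set.prod_mono (subset_univ _) le_rfl)⟩
      (fun p => mul_nonneg (tentApprox_nonneg n hδ _) (hθ0 _))
    have hθ' : ∀ t, HasDerivAt θ (deriv θ t) t := fun t => (hθ.1.differentiable (by simp) t).hasDerivAt
    have e1 : ∀ p, dt (fun p : ℝ × ℝ => tentApprox n δ (p.1 - t₁) * θ p.2) p
        = tentApproxDeriv n δ (p.1 - t₁) * θ p.2 := fun p => by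
      refine fderiv_apply_one_zero hφ.1 ?_
      exact ((tentApprox_hasDerivAt n δ (p.1 - t₁)).comp_sub_const p.1 t₁).mul_const (θ p.2)
    have e2 : ∀ p, dx (fun p : ℝ × ℝ => tentApprox n δ (p.1 - t₁) * θ p.2) p
        = tentApprox n δ (p.1 - t₁) * deriv θ p.2 := fun p => by
      refine fderiv_apply_zero_one hφ.1 ?_
      exact (hθ' p.2).const_mul (tentApprox n δ (p.1 - t₁))
    -- Since `δ < t₁`, the weight vanishes at time 0 and the initial term drops out.
    have e0 : tentApprox n δ (0 - t₁) = 0 := tentApprox_of_lt n hδ (by linarith)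
    simp only [e1, e2, e0, zero_mul, mul_zero, integral_zero, neg_zero, mul_one, one_mul] at hren
    linarith

end IsWeakSolution

end ViscoString

namespace ViscoString

/-! ### Absence of force at a fixed time of contact where the velocity is non-negative. -/

variable {l h : ℝ} {ζ : ℝ × ℝ → ℝ} {η₀ η₀x v₀ : ℝ → ℝ} {η ηt ηx ηtx : ℝ × ℝ → ℝ}
  {F D : Measure (ℝ × ℝ)}

namespace IsWeakSolution

/-- Where the string arrives at the obstacle with non-negative velocity it was already at rest. -/
lemma ae_integral_sq_velocity_eq_zero (hsol : IsWeakSolution l h ζ η₀ η₀x v₀ η ηt ηx ηtx F D)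
    (hl : 0 < l) {t₁ t₂ x₁ x₂ s t : ℝ} (hd : Ioo t₁ t₂ ×ˢ Ioo x₁ x₂ ⊆ domain l)
    (hv : ∀ᵐ z ∂(volume.restrict (Ioo t₁ t₂ ×ˢ Ioo x₁ x₂)), 0 ≤ ηt z)
    (hs : s ∈ Ioo t₁ t₂) (ht : t ∈ Ioo t₁ t₂) (hst : s ≤ t)
    (h0 : ∀ x ∈ Ioo x₁ x₂, η (t, x) = 0) :
    ∀ᵐ x ∂(volume.restrict (Ioo x₁ x₂)), ∫ τ in s..t, max 0 (ηt (τ, x)) ^ 2 / 2 = 0 := by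
  rcases (Ioo x₁ x₂).eq_empty_or_nonempty with he | ⟨x, hx⟩
  · rw [he]; simp
  have hs0 : 0 < s := (hd (mk_mem_prod hs hx)).1
  have hsub : Ioo x₁ x₂ ⊆ Ioo 0 l := fun y hy => (hd (mk_mem_prod hs hy)).2
  rw [Measure.volume_eq_prod, ← Measure.prod_restrict] at hv
  have hv' : ∀ᵐ y ∂(volume.restrict (Ioo x₁ x₂)), ∀ᵐ τ ∂(volume.restrict (Ioo t₁ t₂)),
      0 ≤ ηt (τ, y) :=
    Measure.ae_ae_of_ae_prod ((Measure.measurePreserving_swap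
      (μ := (volume : Measure ℝ).restrict (Ioo x₁ x₂))
      (ν := (volume : Measure ℝ).restrict (Ioo t₁ t₂))).quasiMeasurePreserving.ae hv)
  obtain ⟨n, hn⟩ := exists_nat_gt t
  filter_upwards [hv', ae_restrict_of_ae_restrict_of_subset hsub hsol.ae_integrableOn_velocity,
    ae_restrict_of_ae_restrict_of_subset hsub (hsol.sub_ae_eq_integral_of_lt hl hs0 hst),
    ae_restrict_mem measurableSet_Ioo] with y h1 h2 h3 hy
  have hsub' : Ioc s t ⊆ Ioo t₁ t₂ := fun τ hτ => ⟨hs.1.trans hτ.1, hτ.2.trans_lt ht.2⟩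
  have hi : IntegrableOn (fun τ => ηt (τ, y)) (Ioc s t) :=
    (h2 n).mono_set fun τ hτ => ⟨hs0.trans hτ.1, hτ.2.trans_lt hn⟩
  have hnn := ae_restrict_of_ae_restrict_of_subset hsub' h1
  -- Contact at time `t` and monotonicity force contact at time `s`. The non-negative velocity then
  -- integrates to zero over `(s,t]` and vanishes almost everywhere there.
  have hz : η (s, y) = 0 := le_antisymm
    (h0 y hy ▸ hsol.monotone_of_velocity_nonneg hl hd
      (by rwa [Measure.volume_eq_prod, ← Measure.prod_restrict]) hs ht hst hy)
    (hsol.nonneg _ (hd (mk_mem_prod hs hy)))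
  rw [h0 y hy, hz, sub_zero, intervalIntegral.integral_of_le hst] at h3
  have hzero := (setIntegral_eq_zero_iff_of_nonneg_ae hnn hi).1 h3.symm
  rw [intervalIntegral.integral_of_le hst]
  refine integral_eq_zero_of_ae ?_
  filter_upwards [hzero] with τ hτ
  rw [Pi.zero_apply] at hτ
  simp [hτ]

/-- Young's inequality `v ≤ ε + v²/(4ε)`, written with the energy density `v²/2`. It bounds a mean
velocity by a mean energy up to an arbitrarily small constant. -/
lemma ae_integral_velocity_le (hsol : IsWeakSolution l h ζ η₀ η₀x v₀ η ηt ηx ηtx F D)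
    {s t : ℝ} (hs : 0 < s) (hst : s ≤ t) :
    ∀ᵐ x ∂(volume.restrict (Ioo 0 l)), ∀ ε > 0, ∫ τ in s..t, ηt (τ, x)
      ≤ ε * (t - s) + 1 / (2 * ε) * ∫ τ in s..t, max 0 (ηt (τ, x)) ^ 2 / 2 := by
  have hsub : Ioc s t ×ˢ Ioo 0 l ⊆ domain l := Set.prod_mono (fun τ hτ => hs.trans hτ.1) le_rfl
  have hi : Integrable (fun p => max 0 (ηt p) ^ 2 / 2)
      ((volume.restrict (Ioc s t)).prod (volume.restrict (Ioo 0 l))) := by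
    rw [Measure.prod_restrict, ← Measure.volume_eq_prod]
    exact ((hsol.memLp_velocity.mono_measure
      (Measure.restrict_mono hsub le_rfl)).integrable_sq).div_const 2
  obtain ⟨n, hn⟩ := exists_nat_gt t
  filter_upwards [hi.prod_left_ae, hsol.ae_integrableOn_velocity] with x h1 h2 ε hε
  have h2' : IntegrableOn (fun τ => ηt (τ, x)) (Ioc s t) :=
    (h2 n).mono_set fun τ hτ => ⟨hs.trans hτ.1, hτ.2.trans_lt hn⟩
  rw [intervalIntegral.integral_of_le hst, intervalIntegral.integral_of_le hst]
  calc _ ≤ ∫ τ in Ioc s t, (ε + 1 / (2 * ε) * (max 0 (ηt (τ, x)) ^ 2 / 2)) := by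
        refine integral_mono h2' ((integrable_const ε).add (h1.const_mul _)) fun τ => ?_
        have e1 : ηt (τ, x) ≤ max 0 (ηt (τ, x)) := le_max_right _ _
        have e2 : ε + 1 / (2 * ε) * (max 0 (ηt (τ, x)) ^ 2 / 2) - max 0 (ηt (τ, x))
            = 1 / (4 * ε) * (2 * ε - max 0 (ηt (τ, x))) ^ 2 := by field_simp; ring
        have e3 : 0 ≤ 1 / (4 * ε) * (2 * ε - max 0 (ηt (τ, x))) ^ 2 := by positivity
        simp only
        linarith
    _ = _ := by
        rw [integral_add (integrable_const ε) (h1.const_mul _), integral_const_mul,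
          setIntegral_const, Real.volume_real_Ioc, max_eq_left (by linarith), smul_eq_mul]
        ring

/-- No force acts at time `t` where the string touches the obstacle and the velocity is
non-negative. -/
lemma integral_sliceForce_eq_zero (hsol : IsWeakSolution l h ζ η₀ η₀x v₀ η ηt ηx ηtx F D)
    (hl : 0 < l) {t r x₁ x₂ : ℝ} {θ : ℝ → ℝ} (hr : 0 < r)
    (hd : Ioo (t - r) (t + r) ×ˢ Ioo x₁ x₂ ⊆ domain l) (hsub : Ioo x₁ x₂ ⊆ Ioo 0 l) (ht : 0 < t)
    (hv : ∀ᵐ z ∂(volume.restrict (Ioo (t - r) (t + r) ×ˢ Ioo x₁ x₂)), 0 ≤ ηt z)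
    (h0 : ∀ x ∈ Ioo x₁ x₂, η (t, x) = 0) (hθ : IsTestFunction (Ioo x₁ x₂) θ) (hθ0 : ∀ y, 0 ≤ θ y) :
    ∫ x, θ x ∂(sliceForce F l t) ≤ 0 := by
  have hθ' : IsTestFunction (Ioo 0 l) θ := ⟨hθ.1, hθ.2.1, hθ.2.2.trans hsub⟩
  obtain ⟨R, hR, hRle⟩ := hsol.exists_kinetic_energy_lower_bound ht hθ' hθ0
  have hθi : IntegrableOn θ (Ioo 0 l) :=
    (hθ.1.continuous.integrable_of_hasCompactSupport hθ.2.1).integrableOn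
  have hI0 : 0 ≤ ∫ x in Ioo 0 l, θ x := integral_nonneg hθ0
  have hloc : LocallyIntegrableOn (fun p => max 0 (ηt p) ^ 2 / 2) (domain l) :=
    IntegrableOn.locallyIntegrableOn (hsol.memLp_velocity.integrable_sq.div_const 2)
  obtain ⟨N, hN⟩ := exists_abs_le_of_hasCompactSupport hθ.1.continuous hθ.2.1
  have hmul : ∀ {g : ℝ → ℝ}, LocallyIntegrableOn g (Ioo 0 l) →
      IntegrableOn (fun x => g x * θ x) (Ioo 0 l) := fun hg =>
    (integrable_mul_of_bounded hθ.2.1.measurableSet (hg.integrableOn_compact_subset hθ'.2.2 hθ.2.1)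
      hθ.1.continuous.measurable hN fun x hx => image_eq_zero_of_notMem_tsupport hx).integrableOn
  have main : ∀ ε > 0, ∀ δ, 0 < δ → δ < min r t →
      ∫ x in Ioo 0 l, velocityJump η t δ x * θ x
        ≤ ε * (∫ x in Ioo 0 l, θ x) + 1 / (2 * ε) * (-R δ) := by
    intro ε hε δ hδ hδm
    have hδr : δ < r := hδm.trans_le (min_le_left _ _)
    have hδt : δ < t := hδm.trans_le (min_le_right _ _)
    have hts : t - δ ∈ Ioo (t - r) (t + r) := ⟨by linarith, by linarith⟩
    have htm : t ∈ Ioo (t - r) (t + r) := ⟨by linarith, by linarith⟩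
    -- The energy before `t` is zero, so the renormalized inequality bounds the mean energy after
    -- `t` by `-R δ`.
    have hbefore : ∫ x in Ioo 0 l, (∫ τ in (t - δ)..t, max 0 (ηt (τ, x)) ^ 2 / 2) * θ x = 0 := by
      refine integral_eq_zero_of_ae ?_
      have := hsol.ae_integral_sq_velocity_eq_zero hl hd hv hts htm (by linarith) h0
      rw [ae_restrict_iff' measurableSet_Ioo] at this
      filter_upwards [ae_restrict_of_ae this] with x hx
      by_cases hxI : x ∈ Ioo x₁ x₂
      · rw [hx hxI]; simp
      · rw [image_eq_zero_of_notMem_tsupport fun h' => hxI (hθ.2.2 h')]; simp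
    have hRδ := hRle δ hδ hδt
    rw [hbefore, zero_sub] at hRδ
    have hrest : ∀ x ∈ Ioo x₁ x₂, η (t - δ, x) = 0 := fun x hx => le_antisymm
      (h0 x hx ▸ hsol.monotone_of_velocity_nonneg hl hd hv hts htm (by linarith) hx)
      (hsol.nonneg _ (hd (mk_mem_prod hts hx)))
    calc ∫ x in Ioo 0 l, velocityJump η t δ x * θ x
        ≤ ∫ x in Ioo 0 l, (ε * θ x + 1 / (2 * ε) * (1 / δ) *
            ((∫ τ in t..(t + δ), max 0 (ηt (τ, x)) ^ 2 / 2) * θ x)) := by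
          refine integral_mono_ae
            (hmul ((hsol.velocityJump_continuousOn hδ hδt).locallyIntegrableOn measurableSet_Ioo))
            ((hθi.const_mul ε).add
              ((hmul (locallyIntegrableOn_slice hloc ht (by linarith))).const_mul _)) ?_
          filter_upwards [hsol.ae_integral_velocity_le ht (show t ≤ t + δ by linarith),
            hsol.sub_ae_eq_integral_of_lt hl ht (show t ≤ t + δ by linarith)] with x hx hx'
          by_cases hxI : x ∈ Ioo x₁ x₂
          -- The string is at rest on the obstacle at both `t - δ` and `t`, so the jump is just the
          -- mean velocity after `t`.
          · have hJ : velocityJump η t δ x = 1 / δ * ∫ τ in t..(t + δ), ηt (τ, x) := by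
              rw [← hx', velocityJump, h0 x hxI, hrest x hxI]; ring
            have hle : velocityJump η t δ x
                ≤ ε + 1 / (2 * ε) * (1 / δ) * ∫ τ in t..(t + δ), max 0 (ηt (τ, x)) ^ 2 / 2 := by
              rw [hJ]
              calc _ ≤ 1 / δ * (ε * (t + δ - t) + 1 / (2 * ε) *
                    ∫ τ in t..(t + δ), max 0 (ηt (τ, x)) ^ 2 / 2) :=
                    mul_le_mul_of_nonneg_left (hx ε hε) (one_div_pos.2 hδ).le
                _ = _ := by field_simp; ring
            calc _ ≤ (ε + 1 / (2 * ε) * (1 / δ) *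
                  ∫ τ in t..(t + δ), max 0 (ηt (τ, x)) ^ 2 / 2) * θ x :=
                  mul_le_mul_of_nonneg_right hle (hθ0 x)
              _ = _ := by ring
          · simp [image_eq_zero_of_notMem_tsupport fun h' => hxI (hθ.2.2 h')]
      _ = ε * (∫ x in Ioo 0 l, θ x) + 1 / (2 * ε) * (1 / δ *
            ∫ x in Ioo 0 l, (∫ τ in t..(t + δ), max 0 (ηt (τ, x)) ^ 2 / 2) * θ x) := by
          rw [integral_add (hθi.const_mul ε)
            ((hmul (locallyIntegrableOn_slice hloc ht (by linarith))).const_mul _),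
            integral_const_mul, integral_const_mul]
          ring
      _ ≤ _ := by
          gcongr
          linarith
  have hlim := hsol.tendsto_setIntegral_velocityJump hl ht hθ'
  rw [setIntegral_line_eq hθ'] at hlim
  -- At fixed `ε` the limit `δ → 0` removes `R`; only then is `ε` sent to 0.
  have hle : ∀ ε > 0, ∫ x, θ x ∂(sliceForce F l t) ≤ ε * ∫ x in Ioo 0 l, θ x := by
    intro ε hε
    have h1 : Tendsto (fun δ => ε * (∫ x in Ioo 0 l, θ x) + 1 / (2 * ε) * (-R δ)) (𝓝[>] 0)
        (𝓝 (ε * (∫ x in Ioo 0 l, θ x) + 1 / (2 * ε) * (-0))) :=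
      tendsto_const_nhds.add (hR.neg.const_mul _)
    rw [neg_zero, mul_zero, add_zero] at h1
    refine le_of_tendsto_of_tendsto hlim h1 ?_
    filter_upwards [Ioo_mem_nhdsGT (lt_min hr ht)] with δ hδ
    exact main ε hε δ hδ.1 hδ.2
  have h2 : Tendsto (fun ε : ℝ => ε * ∫ x in Ioo 0 l, θ x) (𝓝[>] 0) (𝓝 0) := by
    have : Tendsto (fun ε : ℝ => ε * ∫ x in Ioo 0 l, θ x) (𝓝 0) (𝓝 (0 * ∫ x in Ioo 0 l, θ x)) :=
      Continuous.tendsto (by fun_prop) 0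
    rw [zero_mul] at this
    exact this.mono_left nhdsWithin_le_nhds
  exact ge_of_tendsto h2 (eventually_of_mem self_mem_nhdsWithin hle)

lemma force_line_inter_intNonneg (hsol : IsWeakSolution l h ζ η₀ η₀x v₀ η ηt ηx ηtx F D) (hl : 0 < l)
    {t₁ x₀ x₁ : ℝ} (hL : ({t₁} : Set ℝ) ×ˢ Ioo x₀ x₁ ⊆ contactBoundary l η) :
    F (({t₁} : Set ℝ) ×ˢ Ioo x₀ x₁ ∩ intNonneg l ηt) = 0 := by
  have hlf := hsol.force_locallyFinite
  have hfin : IsFiniteMeasure (sliceForce F l t₁) := isFiniteMeasure_sliceForce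
  refine measure_null_of_locally_null _ ?_
  rintro ⟨t, x⟩ ⟨⟨ht, hx⟩, hU⟩
  obtain rfl : t = t₁ := ht
  obtain ⟨r, hr, hd, hv⟩ := exists_rectangle_of_mem_intNonneg hU
  simp only at hx hd hv
  have ht0 : 0 < t := (hL (mk_mem_prod rfl hx)).2.1
  -- Keeps the space interval inside both the square of non-negative velocity and the contact
  -- segment.
  set ρ := min r (min (x - x₀) (x₁ - x)) with hρ
  have hρ0 : 0 < ρ := lt_min hr (lt_min (by linarith [hx.1]) (by linarith [hx.2]))
  have hρr : ρ ≤ r := min_le_left _ _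
  have hρ1 : ρ ≤ x - x₀ := (min_le_right _ _).trans (min_le_left _ _)
  have hρ2 : ρ ≤ x₁ - x := (min_le_right _ _).trans (min_le_right _ _)
  have hsub : Ioo (x - ρ) (x + ρ) ⊆ Ioo x₀ x₁ := Ioo_subset_Ioo (by linarith) (by linarith)
  have hrect : Ioo (t - r) (t + r) ×ˢ Ioo (x - ρ) (x + ρ) ⊆ Ioo (t - r) (t + r) ×ˢ Ioo (x - r) (x + r) :=
    Set.prod_mono le_rfl (Ioo_subset_Ioo (by linarith) (by linarith))
  have hsub' : Ioo (x - ρ) (x + ρ) ⊆ Ioo 0 l := fun y hy => (hL (mk_mem_prod rfl (hsub hy))).2.2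
  obtain ⟨θ, hθ, h01, h1⟩ := exists_smooth_cutoff (K := Icc (x - ρ / 2) (x + ρ / 2)) isCompact_Icc
    isOpen_Ioo (fun y hy => show y ∈ Ioo (x - ρ) (x + ρ) from ⟨by linarith [hy.1], by linarith [hy.2]⟩)
  have hθle := hsol.integral_sliceForce_eq_zero hl hr (hrect.trans hd) hsub' ht0
    (ae_restrict_of_ae_restrict_of_subset hrect hv)
    (fun y hy => hsol.eq_zero_of_mem_contactBoundary (hL (mk_mem_prod rfl (hsub hy)))) hθ
    fun y => (h01 y).1
  have hKle : (sliceForce F l t).real (Icc (x - ρ / 2) (x + ρ / 2)) ≤ 0 := by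
    refine le_trans ?_ hθle
    rw [← integral_indicator_one measurableSet_Icc]
    refine integral_mono ((integrable_indicator_iff measurableSet_Icc).2 (integrable_const _))
      (hθ.1.continuous.integrable_of_hasCompactSupport hθ.2.1) fun y => ?_
    by_cases hy : y ∈ Icc (x - ρ / 2) (x + ρ / 2)
    · simp [hy, h1 y hy]
    · simpa [hy] using (h01 y).1
  have hK : sliceForce F l t (Icc (x - ρ / 2) (x + ρ / 2)) = 0 :=
    (measureReal_eq_zero_iff).1 (le_antisymm hKle measureReal_nonneg)
  rw [sliceForce_apply measurableSet_Icc] at hK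
  refine ⟨(({t} : Set ℝ) ×ˢ Ioo x₀ x₁ ∩ intNonneg l ηt) ∩ (univ ×ˢ Ioo (x - ρ / 2) (x + ρ / 2)),
    inter_mem self_mem_nhdsWithin (mem_nhdsWithin_of_mem_nhds
      ((isOpen_univ.prod isOpen_Ioo).mem_nhds
        (mk_mem_prod (mem_univ _) ⟨by linarith, by linarith⟩))), measure_mono_null ?_ hK⟩
  rintro p ⟨⟨⟨hp1, hp2⟩, -⟩, -, hp3⟩
  exact ⟨hp1, Ioo_subset_Icc_self hp3, (hL (mk_mem_prod hp1 hp2)).2.2⟩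

end IsWeakSolution

end ViscoString
-- Assembly of the two parts.
theorem theorem3 (l h : ℝ) (hl : 0 < l) (hh : 0 < h)
    (ζ : ℝ × ℝ → ℝ) (hζ : ViscoString.IsMollifier ζ)
    (η₀ η₀x v₀ : ℝ → ℝ) (η ηt ηx ηtx : ℝ × ℝ → ℝ) (F D : Measure (ℝ × ℝ))
    (hsol : ViscoString.IsWeakSolution l h ζ η₀ η₀x v₀ η ηt ηx ηtx F D) :
    (∀ (a b : ℝ) (f f' : ℝ → ℝ), a < b → ViscoString.IsSobolevH1 a b f f' →
      (fun t => (t, f t)) '' Icc a b ⊆ ViscoString.contactBoundary l η →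
      Tendsto (fun δ : ℝ =>
          -(1 / δ * ((∫ t in a..b, ∫ x in (f t)..(f t + δ), ηx (t, x))
            - (∫ t in a..b, ∫ x in (f t - δ)..(f t), ηx (t, x))
            + (∫ t in a..b, ∫ x in (f t)..(f t + δ), ηtx (t, x))
            - (∫ t in a..b, ∫ x in (f t - δ)..(f t), ηtx (t, x)))))
        (𝓝[>] 0) (𝓝 (F ((fun t => (t, f t)) '' Icc a b)).toReal) ∧
      F ((fun t => (t, f t)) '' Icc a b ∩ ViscoString.intNonneg l ηt) = 0) ∧
    (∀ t₁ x₀ x₁ : ℝ, x₀ < x₁ →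
      ({t₁} : Set ℝ) ×ˢ Ioo x₀ x₁ ⊆ ViscoString.contactBoundary l η →
      (∃ fcon : ℝ → ℝ, MemLp fcon 2 (volume.restrict (Ioo x₀ x₁)) ∧
        (∀ᵐ x ∂(volume.restrict (Ioo x₀ x₁)), 0 ≤ fcon x) ∧
        F.restrict (({t₁} : Set ℝ) ×ˢ Ioo x₀ x₁) =
          (Measure.dirac t₁).prod
            ((volume.restrict (Ioo x₀ x₁)).withDensity (fun x => ENNReal.ofReal (fcon x))) ∧
        ∀ᵐ x ∂(volume.restrict (Ioo x₀ x₁)),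
          Tendsto (fun δ : ℝ =>
              1 / δ * ((∫ t in t₁..(t₁ + δ), ηt (t, x)) - ∫ t in (t₁ - δ)..t₁, ηt (t, x)))
            (𝓝[>] 0) (𝓝 (fcon x))) ∧
      F (({t₁} : Set ℝ) ×ˢ Ioo x₀ x₁ ∩ ViscoString.intNonneg l ηt) = 0) := by
  refine ⟨fun a b f f' hab hf hΓ => ⟨?_, hsol.force_curve_inter_intNonneg hl hab hf hΓ⟩,
    fun t₁ x₀ x₁ hx hL => ⟨?_, hsol.force_line_inter_intNonneg hl hL⟩⟩
  · exact hsol.force_curve_tendsto hab hf fun t ht => (hΓ ⟨t, ht, rfl⟩).2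
  · have hdom : ∀ x ∈ Ioo x₀ x₁, (t₁, x) ∈ ViscoString.domain l := fun x hx => (hL (mk_mem_prod rfl hx)).2
    have hsub : Ioo x₀ x₁ ⊆ Ioo 0 l := fun x hx => (hdom x hx).2
    -- The midpoint serves only as some point of the segment, all of which lies in the open domain.
    have ht₁ : 0 < t₁ := (hdom ((x₀ + x₁) / 2) ⟨by linarith, by linarith⟩).1
    refine ⟨fun x => ((ViscoString.sliceForce F l t₁).rnDeriv volume x).toReal,
      (hsol.memLp_sliceForce_rnDeriv hl ht₁).mono_measure (Measure.restrict_mono hsub le_rfl),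
      Eventually.of_forall fun x => ENNReal.toReal_nonneg,
      hsol.restrict_line_eq_prod_withDensity hl ht₁ measurableSet_Ioo hsub, ?_⟩
    filter_upwards [ae_restrict_of_ae_restrict_of_subset hsub (hsol.ae_tendsto_velocityJump hl ht₁),
      ae_restrict_of_ae_restrict_of_subset hsub (hsol.ae_velocityJump_eq hl)] with x h₁ h₂
    refine h₁.congr' ?_
    filter_upwards [Ioo_mem_nhdsGT ht₁] with δ hδ using h₂ δ hδ.1 hδ.2
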